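/- Let $F$ be a nonarchimedean local field of residue characteristic $\neq 2$, with integers $\mathfrak o$, maximal ideal $\wp$, uniformizer $\pi$, residue field of $q$ elements, normalised valuation $v$ and $|a|=q^{-v(a)}$. Let $D=M_2(F)$ and $G=\mathrm{PGL}_2(F)$, and let $K\subset D$ be one of the following. * (field case) $K=F(\sqrt A)$ with $A\in\mathfrak o^\times$ not a square, embedded by $a+b\sqrt A\mapsto\begin{pmatrix}a&bA\\b&a\end{pmatrix}$, with $\epsilon=\begin{pmatrix}0&-A\\1&0\end{pmatrix}$; * (split case) $K=F\oplus F$, embedded diagonally, with $\epsilon=\begin{pmatrix}0&1\\1&0\end{pmatrix}$. Thus $D=K+\epsilon K$. Let $T=F^\times\backslash K^\times$, let $N$ be the determinant (the norm on $K$), $c=\epsilon^2$, and $P(\gamma_1+\epsilon\gamma_2)=cN(\gamma_2)/N(\gamma_1)$. Let $\omega(a)=1$ if $a\in N(K^\times)$ and $\omega(a)=-1$ otherwise. Let $\chi$ be an unramified character of $T$, i.e. a character of $K^\times$ trivial on $F^\times$ and on $\mathfrak o_K^\times$. In the split case write $\chi=(\chi_1,\chi_1^{-1})$ and assume $\chi_1^2=1$.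 In the field case $\chi=\chi_1\circ N$ for some character $\chi_1$ of $F^\times$ (part of the claim), and $\chi_1$ is any such character. Fix Haar measures on $F$, $F^\times$, $G$, $T$ and the quotient measure on $T\backslash G$. Define $\phi=\chi\cdot\mathbf 1_{\mathrm{GL}_2(\mathfrak o)}$ on $G$ by $\phi(tk)=\chi(t)$ for $t\in T$ and $k$ in the image of $\mathrm{GL}_2(\mathfrak o)$, and $\phi=0$ elsewhere. For $x\in F^\times$, $x\ne1$, $\beta\in F^\times$, let $$L_x(\beta)=\Big\langle\phi,\begin{pmatrix}\beta&0\\0&1\end{pmatrix}.\phi\Big\rangle_x=\int_{T\backslash G}\int_T\phi(t^{-1}\gamma(x)ty)\,dt\;\bar\phi\Big(y\begin{pmatrix}\beta&0\\0&1\end{pmatrix}\Big)dy,$$ where $\gamma(x)\in D^\times$ has trace $0$ and $P(\gamma(x))=x$; if there is no such $\gamma(x)$, then $L_x=0$. In the field case put $L_x^\pm=L_x$. In the split case $L_x=L_x^++L_x^-$ with $$L_x^\pm(\beta)=\chi_1^{\pm1}(\beta)\big(\mathbf 1_{\wp^n}(\beta)|\beta|(c_{\pm,1}v(\beta)+c_{\pm,2})+C_\pm(\beta)+\mathbf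 1_{\wp^n}(\beta^{-1})|\beta|^{-1}(d_{\pm,1}v(\beta)+d_{\pm,2})\big),$$ $C_\pm$ locally constant with compact support in $F^\times$, $n>0$, and, $\chi_1$ being quadratic, $L_x^+=L_x^-$; that such a decomposition exists is part of the claim. For $v(b)\ge0$ put $\mathbf S_b\langle\phi,\phi\rangle_x=\frac14(\mathbf S_b^++\mathbf S_b^-)$ with $$\mathbf S_b^\pm=\sum_{s=0,1}\sum_{i=0}^{v(b)}\frac{\chi_1^{\mp1}(\pi)^{i(-1)^s}\,\omega(b(1-x))^{i+s}}{|\pi^{v(b)-i}|}\,L_x^\pm\big(\pi^{(-1)^s(v(b)-i)}\big),$$ where in the field case the factor $\chi_1^{\mp1}(\pi)^{i(-1)^s}$ is omitted. Let $\psi$ be an additive character of $F$ whose largest fractional ideal in the kernel is $\mathfrak o$. For unramified characters $\mu_1,\mu_2$ of $F^\times$ let $$f(g)=\mu_1(\det g)|\det g|^{1/2}\int_{F^\times}\Phi((0,t)g)(\mu_1\mu_2^{-1})(t)|t|\,d^\times t,\qquad\Phi=\mathbf 1_{\mathfrak o}\otimes\mathbf 1_{\mathfrak o},$$ and let the newform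 of $\Pi(\mu_1,\mu_2)$ in the Kirillov model be $$W_{\mathrm{new}}(a)=\lim_{n\to\infty}\int_{\wp^{-n}}f\Big(\begin{pmatrix}0&-1\\1&0\end{pmatrix}\begin{pmatrix}1&y\\0&1\end{pmatrix}\begin{pmatrix}a&0\\0&1\end{pmatrix}\Big)\bar\psi(y)\,dy .$$ Let $W_{\theta,\mathrm{new}}$ be the newform of the theta series $\Pi(\chi)=\Pi(\chi_1,\omega\chi_1^{-1})$ and $W_{E,\mathrm{new}}$ that of the Eisenstein series $\Pi(1,\omega)$ (central point). Theorem. Let $x\in F^\times$, $x\neq1$, $\xi=\frac{x}{x-1}$, $\eta=1-\xi$. Put $V_W=\mathrm{vol}(\mathfrak o)^2\,\mathrm{vol}^\times(\mathfrak o^\times)^2$, and let $V$ be the volume of the image of $\mathrm{GL}_2(\mathfrak o)$ in $G$. (a) Field case. Let $V_x=V$ if $x\notin1+\wp$ and $V_x=V/(1+q^{-1})$ if $x\in1+\wp$. For all $b\in F^\times$ with $v(b)\ge0$, $$V_x\,W_{\theta,\mathrm{new}}(b\eta)W_{E,\mathrm{new}}(b\xi)=V_W\,|\xi\eta|^{1/2}|b|\;\mathbf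 S_b\langle\phi,\phi\rangle_x .$$ (b) Split case. Let $V'=V/(1+q^{-1})$. For all $b\in F^\times$ with $v(b)\ge0$, $$V'\,W_{\theta,\mathrm{new}}(b\eta)W_{E,\mathrm{new}}(b\xi)=V_W\,|\xi\eta|^{1/2}|b|\,\big(\mathbf S_b\langle\phi,\phi\rangle_x+V'\,R_x(b)\big),$$ where $$R_x(b)=\chi_1(b(1-x))\cdot\begin{cases}v(b)+\tfrac12(|v(x)|+1)(1-q^{-1}),&x\notin1+\wp,\\ \mathbf 1_{\wp^{v(1-x)}}(b)\,\big(v(b)-v(1-x)+\tfrac12\big),&x\in1+\wp.\end{cases}$$ In particular, for fixed $x$, there is a constant $C$ with $$\big|V'\,W_{\theta,\mathrm{new}}(b\eta)W_{E,\mathrm{new}}(b\xi)-V_W|\xi\eta|^{1/2}|b|\,\mathbf S_b\langle\phi,\phi\rangle_x\big|\le C\,|b|\,v(b)\quad\text{for all } b\text{ with }v(b)\ge1 .$$ -/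

import Mathlib

open scoped MatrixGroups ValuativeRel ComplexConjugate
open MeasureTheory Filter Topology Matrix

noncomputable section

namespace LocalGZ

/-! ### The local field -/

section LocalField

variable {F : Type*} [Field F] [ValuativeRel F] [TopologicalSpace F]
  [IsNonarchimedeanLocalField F]

/-- The normalised additive valuation `v : F → ℤ` (with the dummy value `v 0 = 0`);
uniformizers have valuation `1`. -/
def ord (a : F) : ℤ :=
  -WithZero.log (IsNonarchimedeanLocalField.valueGroupWithZeroIsoInt F
    (ValuativeRel.valuation F a))

variable (F) in
/-- The number `q` of elements of the residue field. -/
def resCard : ℕ := Nat.card 𝓀[F]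

open Classical in
/-- The normalised absolute value `|a| = q ^ (-v a)`. -/
def absF (a : F) : ℝ := if a = 0 then 0 else (resCard F : ℝ) ^ (-ord a)

/-- `ψ` is an unramified additive character: `𝒪` is the largest fractional ideal in its kernel. -/
def IsUnramifiedAddChar (ψ : AddChar F Circle) : Prop :=
  (∀ a ∈ 𝒪[F], ψ a = 1) ∧ ∃ a : F, a ≠ 0 ∧ ord a = -1 ∧ ψ a ≠ 1

end LocalField

/-! ### The group `G = PGL₂(F)` -/

section Group

variable {F : Type*} [Field F]

instance [TopologicalSpace F] : TopologicalSpace (PGL(2, F)) :=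
  inferInstanceAs (TopologicalSpace (GL (Fin 2) F ⧸ Subgroup.center (GL (Fin 2) F)))

instance [TopologicalSpace F] : MeasurableSpace (PGL(2, F)) := borel _

instance [TopologicalSpace F] : BorelSpace (PGL(2, F)) := ⟨rfl⟩

/-- The matrix `diag(β, 1)`. -/
def diagGL (β : Fˣ) : GL (Fin 2) F :=
  Matrix.GeneralLinearGroup.mkOfDetNeZero !![(β : F), 0; 0, 1] (by simp)

/-- The matrix `w = (0, -1; 1, 0)`. -/
def weylGL : GL (Fin 2) F :=
  Matrix.GeneralLinearGroup.mkOfDetNeZero !![(0 : F), -1; 1, 0] (by simp)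

/-- The upper triangular unipotent matrix with entry `x`. -/
def unipGL (x : F) : GL (Fin 2) F :=
  Matrix.GeneralLinearGroup.mkOfDetNeZero !![1, x; 0, 1] (by simp)

variable (F) in
/-- The image of `GL₂(𝒪)` in `PGL₂(F)`. -/
def maxCompact [ValuativeRel F] : Subgroup (PGL(2, F)) :=
  ((Matrix.ProjGenLinGroup.mk (n := Fin 2) (R := F)).comp
    (Matrix.GeneralLinearGroup.map (n := Fin 2) (algebraMap 𝒪[F] F))).range

end Group

/-! ### Quotient measures -/

/-- `ν` is the quotient measure on `T \ G` of the measures `μG` and `μT`: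
`∫_G f(g) dg = ∫_{T \ G} ∫_T f(t y) dt dy` for every measurable `f ≥ 0`.
(The inner integral does not depend on the representative of the coset when `μT` is a Haar
measure on a commutative group `T`.) -/
def IsQuotientMeasure {G : Type*} [Group G] [MeasurableSpace G] (T : Subgroup G)
    (μG : Measure G) (μT : Measure T) (ν : Measure (Quotient (QuotientGroup.rightRel T))) : Prop :=
  ∀ f : G → ENNReal, Measurable f →
    ∫⁻ g, f g ∂μG = ∫⁻ y, (∫⁻ t : T, f ((t : G) * y.out) ∂μT) ∂ν

/-! ### Torus, characters, linking numbers

`K` is a quadratic algebra over `F`, embedded in `D = M₂(F)` by `ι`, and `ε ∈ D` is the element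
with `D = K + ε K` and `ε t = t̄ ε`.  These are applied only to the two concrete data
`(fieldEmb A, fieldEps A)` and `(splitEmb, splitEps)` below.  The reduced norm of `D` is the
determinant; its restriction to `K` is the norm of `K / F`. -/

section Torus

variable {F : Type*} [Field F] {K : Type*} [CommRing K] [Algebra F K]

/-- The embedding of `K^×` in `GL₂(F)`. -/
def torusGL (ι : K →ₐ[F] Matrix (Fin 2) (Fin 2) F) : Kˣ →* GL (Fin 2) F :=
  Units.map (ι : K →* Matrix (Fin 2) (Fin 2) F)

/-- The map `K^× → G = PGL₂(F)`. -/
def torusHom (ι : K →ₐ[F] Matrix (Fin 2) (Fin 2) F) : Kˣ →* PGL(2, F) :=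
  Matrix.ProjGenLinGroup.mk.comp (torusGL ι)

/-- The torus `T = F^× \ K^×` as a subgroup of `G`. -/
def torus (ι : K →ₐ[F] Matrix (Fin 2) (Fin 2) F) : Subgroup (PGL(2, F)) :=
  (torusHom ι).range

/-- The norm `K^× → F^×`. -/
def normHom (ι : K →ₐ[F] Matrix (Fin 2) (Fin 2) F) : Kˣ →* Fˣ :=
  Matrix.GeneralLinearGroup.det.comp (torusGL ι)

open Classical in
/-- The character `ω` of `F^×` attached to `K / F`: its value is `1` on norms, `-1` elsewhere. -/
def omega (ι : K →ₐ[F] Matrix (Fin 2) (Fin 2) F) (a : Fˣ) : ℂ :=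
  if a ∈ (normHom ι).range then 1 else -1

/-- A character of `K^×` is a character of `T` if it is trivial on `F^×`. -/
def IsTorusChar (F : Type*) [Field F] {K : Type*} [CommRing K] [Algebra F K]
    (χ : Kˣ →* ℂˣ) : Prop :=
  ∀ a : Fˣ, χ (Units.map (algebraMap F K : F →* K) a) = 1

/-- A character of `K^×` is unramified if it is trivial on the units of the integral closure of
`𝒪[F]` in `K`. -/
def IsUnramifiedChar (F : Type*) [Field F] [ValuativeRel F] {K : Type*} [CommRing K]
    [Algebra 𝒪[F] K] (χ : Kˣ →* ℂˣ) : Prop :=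
  ∀ t : Kˣ, IsIntegral 𝒪[F] (t : K) → IsIntegral 𝒪[F] ((t⁻¹ : Kˣ) : K) → χ t = 1

open Classical in
/-- The function `φ = χ · 1_{GL₂(𝒪)}` on `G`: `φ(t k) = χ(t)` for `t ∈ K^×`, `k ∈ GL₂(𝒪)`, and `φ`
vanishes elsewhere.  (For `χ` an unramified character of `T` the value does not depend on the
factorization.) -/
def sphericalFn [ValuativeRel F] (ι : K →ₐ[F] Matrix (Fin 2) (Fin 2) F) (χ : Kˣ →* ℂˣ)
    (g : PGL(2, F)) : ℂ :=
  if h : ∃ t : Kˣ, ∃ k ∈ maxCompact F, g = torusHom ι t * k then ((χ h.choose : ℂˣ) : ℂ) else 0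

/-- `γ ∈ D^×` has trace zero and `P(γ) = x`, where
`P(γ₁ + ε γ₂) = c N(γ₂) / N(γ₁)` and `c = ε² = -N(ε)`. -/
def IsTracefreePreimage (ι : K →ₐ[F] Matrix (Fin 2) (Fin 2) F) (ε : Matrix (Fin 2) (Fin 2) F)
    (x : F) (γ : GL (Fin 2) F) : Prop :=
  (γ : Matrix (Fin 2) (Fin 2) F).trace = 0 ∧
    ∃ γ₁ γ₂ : K, (γ : Matrix (Fin 2) (Fin 2) F) = ι γ₁ + ε * ι γ₂ ∧ (ι γ₁).det ≠ 0 ∧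
      x = -ε.det * (ι γ₂).det / (ι γ₁).det

variable [TopologicalSpace F]

/-- `⟨φ, ψ⟩_γ = ∫_{T \ G} ∫_T φ(t⁻¹ γ t y) dt ψ̄(y) dy`. -/
def linkingNumber (ι : K →ₐ[F] Matrix (Fin 2) (Fin 2) F) (dt : Measure (torus ι))
    (dy : Measure (Quotient (QuotientGroup.rightRel (torus ι))))
    (φ ψ : PGL(2, F) → ℂ) (γ : PGL(2, F)) : ℂ :=
  ∫ y, (∫ t : torus ι, φ ((t : PGL(2, F))⁻¹ * γ * t * y.out) ∂dt) * conj (ψ y.out) ∂dy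

open Classical in
/-- The local linking number `⟨φ, ψ⟩_x`: it is `⟨φ, ψ⟩_{γ(x)}` for a tracefree preimage `γ(x)` of
`x` under `P`, and `0` if there is none. -/
def localLinkingNumber (ι : K →ₐ[F] Matrix (Fin 2) (Fin 2) F) (ε : Matrix (Fin 2) (Fin 2) F)
    (dt : Measure (torus ι)) (dy : Measure (Quotient (QuotientGroup.rightRel (torus ι))))
    (φ ψ : PGL(2, F) → ℂ) (x : F) : ℂ :=
  if h : ∃ γ : GL (Fin 2) F, IsTracefreePreimage ι ε x γ then
    linkingNumber ι dt dy φ ψ (Matrix.ProjGenLinGroup.mk h.choose)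
  else 0

/-- The translate `(diag(β, 1) . ψ)(y) = ψ(y diag(β, 1))`. -/
def translate (β : Fˣ) (ψ : PGL(2, F) → ℂ) (y : PGL(2, F)) : ℂ :=
  ψ (y * Matrix.ProjGenLinGroup.mk (diagGL β))

/-- The translated local linking number `⟨φ, diag(β, 1) . ψ⟩_x` as a function of `β`. -/
def translatedLinkingNumber (ι : K →ₐ[F] Matrix (Fin 2) (Fin 2) F)
    (ε : Matrix (Fin 2) (Fin 2) F) (dt : Measure (torus ι))
    (dy : Measure (Quotient (QuotientGroup.rightRel (torus ι))))
    (φ ψ : PGL(2, F) → ℂ) (x : F) (β : Fˣ) : ℂ :=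
  localLinkingNumber ι ε dt dy φ (translate β ψ) x

end Torus

/-! ### The two kinds of tori -/

section Concrete

variable {F : Type*} [Field F]

/-- `K = F(√A) → M₂(F)`, `a + b √A ↦ (a, b A; b, a)`. -/
def fieldEmb (A : F) : QuadraticAlgebra F A 0 →ₐ[F] Matrix (Fin 2) (Fin 2) F :=
  QuadraticAlgebra.lift ⟨!![0, A; 1, 0], by
    ext i j; fin_cases i <;> fin_cases j <;> simp [Matrix.mul_apply, Fin.sum_univ_two]⟩

theorem fieldEmb_apply (A : F) (z : QuadraticAlgebra F A 0) :
    fieldEmb A z = !![z.re, z.im * A; z.im, z.re] := by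
  ext i j; fin_cases i <;> fin_cases j <;> simp [fieldEmb, QuadraticAlgebra.lift]

/-- `ε = (0, -A; 1, 0)`. -/
def fieldEps (A : F) : Matrix (Fin 2) (Fin 2) F := !![0, -A; 1, 0]

variable (F) in
/-- `K = F ⊕ F → M₂(F)`, `(a, d) ↦ diag(a, d)`. -/
def splitEmb : (F × F) →ₐ[F] Matrix (Fin 2) (Fin 2) F where
  toFun z := !![z.1, 0; 0, z.2]
  map_one' := by ext i j; fin_cases i <;> fin_cases j <;> simp
  map_mul' z w := by
    ext i j; fin_cases i <;> fin_cases j <;> simp [Matrix.mul_apply, Fin.sum_univ_two]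
  map_zero' := by ext i j; fin_cases i <;> fin_cases j <;> simp
  map_add' z w := by ext i j; fin_cases i <;> fin_cases j <;> simp
  commutes' r := by
    ext i j; fin_cases i <;> fin_cases j <;> simp [Matrix.algebraMap_matrix_apply]

variable (F) in
/-- `ε = (0, 1; 1, 0)`. -/
def splitEps : Matrix (Fin 2) (Fin 2) F := !![0, 1; 1, 0]

/-- For a character `χ = (χ₁, χ₁⁻¹)` of `(F ⊕ F)^×` trivial on `F^×`, its first component `χ₁`. -/
def firstComponent (χ : (F × F)ˣ →* ℂˣ) : Fˣ →* ℂˣ :=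
  χ.comp ((MulEquiv.prodUnits (M := F) (N := F)).symm.toMonoidHom.comp (MonoidHom.inl Fˣ Fˣ))

end Concrete

/-! ### Newforms of principal series in the Kirillov model -/

section Whittaker

variable {F : Type*} [Field F] [ValuativeRel F] [TopologicalSpace F]
  [IsNonarchimedeanLocalField F] [MeasurableSpace F]

open Classical in
/-- The newform in the principal series `Π(μ₁, μ₂)`, `μ₁, μ₂` unramified, at `s = 1/2`:
`f(g) = μ₁(det g) |det g|^{1/2} ∫_{F^×} Φ((0, t) g) (μ₁ μ₂⁻¹)(t) |t| d^×t` with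
`Φ(x, y) = 1_𝒪(x) 1_𝒪(y)`. -/
def newSection (dma : Measure Fˣ) (μ₁ μ₂ : Fˣ → ℂ) (g : GL (Fin 2) F) : ℂ :=
  μ₁ (Matrix.GeneralLinearGroup.det g) *
    (Real.sqrt (absF ((Matrix.GeneralLinearGroup.det g : Fˣ) : F)) : ℂ) *
    ∫ t : Fˣ, (if (t : F) * g 1 0 ∈ 𝒪[F] ∧ (t : F) * g 1 1 ∈ 𝒪[F] then
      μ₁ t / μ₂ t * (absF (t : F) : ℂ) else 0) ∂dma

/-- The newform of `Π(μ₁, μ₂)` in the Kirillov model (with respect to `ψ`), i.e. its Whittaker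
function at `diag(a, 1)`:
`W_new(a) = ∫_F f(w n(x) diag(a, 1)) ψ̄(x) dx`, `w = (0, -1; 1, 0)`, `n(x) = (1, x; 0, 1)`.
The integral over `F` converges only conditionally and is, as usual, the limit of the integrals
over the fractional ideals `{x | v(x) ≥ -n}`. -/
def whittakerNew (da : Measure F) (dma : Measure Fˣ) (ψ : AddChar F Circle) (μ₁ μ₂ : Fˣ → ℂ)
    (a : Fˣ) : ℂ :=
  limUnder atTop (fun n : ℕ =>
    ∫ x in {x : F | x = 0 ∨ -(n : ℤ) ≤ ord x},
      newSection dma μ₁ μ₂ (weylGL * unipGL x * diagGL a) * conj ((ψ x : Circle) : ℂ) ∂da)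

/-- The newform `W_{E,new}` of the Eisenstein series `Π(1, ω)` at the central place. -/
def eisensteinNew (da : Measure F) (dma : Measure Fˣ) (ψ : AddChar F Circle) (ω : Fˣ → ℂ) :
    Fˣ → ℂ :=
  whittakerNew da dma ψ (fun _ => 1) ω

/-- The newform `W_{θ,new}` of the theta series `Π(χ) = Π(χ₁, ω χ₁⁻¹)`, where `χ = (χ₁, χ₁⁻¹)` if
`K = F ⊕ F`, and `χ = χ₁ ∘ N` if `K` is a field. -/
def thetaNew (da : Measure F) (dma : Measure Fˣ) (ψ : AddChar F Circle) (ω : Fˣ → ℂ)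
    (χ₁ : Fˣ →* ℂˣ) : Fˣ → ℂ :=
  whittakerNew da dma ψ (fun a => ((χ₁ a : ℂˣ) : ℂ)) (fun a => ω a * ((χ₁ a)⁻¹ : ℂˣ))

/-- The volume factor `vol(𝒪)² vol^×(𝒪^×)²` of a product of two newforms. -/
def volW (da : Measure F) (dma : Measure Fˣ) : ℝ :=
  da.real {a : F | a ∈ 𝒪[F]} ^ 2 * dma.real {a : Fˣ | ord (a : F) = 0} ^ 2

end Whittaker

/-! ### The operator `S_b` -/

section Hecke

variable {F : Type*} [Field F] [ValuativeRel F] [TopologicalSpace F]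
  [IsNonarchimedeanLocalField F]

open Classical in
/-- The functions
`μ(β) (1_{℘ⁿ}(β) |β| (c₁ v(β) + c₂) + C(β) + 1_{℘ⁿ}(β⁻¹) |β|⁻¹ (d₁ v(β) + d₂))`
on `F^×`, with `n > 0` and `C` locally constant of compact support. -/
def HasTranslateShape (μ : Fˣ →* ℂˣ) (f : Fˣ → ℂ) : Prop :=
  ∃ n : ℤ, 0 < n ∧ ∃ c₁ c₂ d₁ d₂ : ℂ, ∃ C : Fˣ → ℂ, IsLocallyConstant C ∧ HasCompactSupport C ∧
    ∀ β : Fˣ, f β = ((μ β : ℂˣ) : ℂ) *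
      ((if n ≤ ord (β : F) then (absF (β : F) : ℂ) * (c₁ * (ord (β : F) : ℂ) + c₂) else 0) + C β +
        (if ord (β : F) ≤ -n then (absF (β : F) : ℂ)⁻¹ * (d₁ * (ord (β : F) : ℂ) + d₂) else 0))

/-- The splitting `L = L⁺ + L⁻` of a translated local linking number `L` for a noncompact torus
into the summands belonging to `χ₁` and `χ₁⁻¹`; if `χ₁` is quadratic, the two summands coincide. -/
def IsPlusMinusSplitting (χ₁ : Fˣ →* ℂˣ) (L Lp Lm : Fˣ → ℂ) : Prop :=
  HasTranslateShape χ₁ Lp ∧ HasTranslateShape χ₁⁻¹ Lm ∧ (∀ β, L β = Lp β + Lm β) ∧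
    (χ₁ ^ 2 = 1 → Lp = Lm)

/-- `∑_{s=0,1} ∑_{i=0}^{v(b)} μ(π)^{i(-1)^s} ω(b(1-x))^{i+s} / |π^{v(b)-i}| · L(π^{(-1)^s (v(b)-i)})`,
where `u` stands for `1 - x`. -/
def heckePart (ω : Fˣ → ℂ) (μ : Fˣ →* ℂˣ) (π u b : Fˣ) (L : Fˣ → ℂ) : ℂ :=
  ∑ s ∈ Finset.range 2, ∑ i ∈ Finset.range ((ord (b : F)).toNat + 1),
    ((μ π : ℂˣ) : ℂ) ^ ((i : ℤ) * (-1) ^ s) * ω (b * u) ^ (i + s) /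
      (absF ((π ^ (ord (b : F) - i) : Fˣ) : F) : ℂ) *
        L (π ^ ((-1) ^ s * (ord (b : F) - i)))

/-- The geometric Hecke operator `S_b = (S_b⁺ + S_b⁻) / 4` (for `v(b) ≥ 0`), applied to the pair
`L^±(β) = ⟨φ, diag(β, 1) . ψ⟩_x^±`; again `u` stands for `1 - x`. -/
def geomHecke (ω : Fˣ → ℂ) (χ₁ : Fˣ →* ℂˣ) (π u b : Fˣ) (Lp Lm : Fˣ → ℂ) : ℂ :=
  (1 / 4 : ℂ) * (heckePart ω χ₁⁻¹ π u b Lp + heckePart ω χ₁ π u b Lm)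

open Classical in
/-- The error term in the split case (`u = 1 - x`). -/
def splitError (χ₁ : Fˣ →* ℂˣ) (x u b : Fˣ) : ℂ :=
  ((χ₁ (b * u) : ℂˣ) : ℂ) *
    (if 0 < ord (u : F) then
      (if ord (u : F) ≤ ord (b : F) then ((ord (b : F) - ord (u : F) : ℤ) : ℂ) + 1 / 2 else 0)
    else
      (ord (b : F) : ℂ) + ((|ord (x : F)| + 1 : ℤ) : ℂ) * (1 - (resCard F : ℂ)⁻¹) / 2)

open Classical in
/-- The volume factor of the linking numbers for a compact torus (`u = 1 - x`): the volume of
`PGL₂(𝒪)`, divided by `1 + q⁻¹` in case `x ∈ 1 + ℘`. -/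
def volCompact (dg : Measure (PGL(2, F))) (u : Fˣ) : ℝ :=
  if 0 < ord (u : F) then dg.real (maxCompact F) / (1 + (resCard F : ℝ)⁻¹)
  else dg.real (maxCompact F)

/-- The volume factor of the linking numbers for a noncompact torus: the volume of
`PGL₂(𝒪)`, divided by `1 + q⁻¹`. -/
def volSplit (dg : Measure (PGL(2, F))) : ℝ :=
  dg.real (maxCompact F) / (1 + (resCard F : ℝ)⁻¹)

end Hecke

end LocalGZ

end

open scoped MatrixGroups ValuativeRel ComplexConjugate
open MeasureTheory Filter Topology Matrix

noncomputable section

namespace LocalGZ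

section Ord

variable {F : Type*} [Field F] [ValuativeRel F] [TopologicalSpace F]
  [IsNonarchimedeanLocalField F]

variable (F) in
/-- The normalised valuation with values in `ℤᵐ⁰`. -/
def valZ : F →*₀ WithZero (Multiplicative ℤ) where
  toFun a := IsNonarchimedeanLocalField.valueGroupWithZeroIsoInt F (ValuativeRel.valuation F a)
  map_zero' := by simp
  map_one' := by simp
  map_mul' := by simp

theorem valZ_le_iff {a b : F} :
    valZ F a ≤ valZ F b ↔ ValuativeRel.valuation F a ≤ ValuativeRel.valuation F b :=
  (IsNonarchimedeanLocalField.valueGroupWithZeroIsoInt F).strictMono.le_iff_le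

theorem valZ_add (a b : F) : valZ F (a + b) ≤ max (valZ F a) (valZ F b) := by
  rcases le_max_iff.1 ((ValuativeRel.valuation F).map_add a b) with h | h
  · exact le_max_of_le_left (valZ_le_iff.2 h)
  · exact le_max_of_le_right (valZ_le_iff.2 h)

theorem valZ_eq_exp {a : F} (ha : a ≠ 0) : valZ F a = WithZero.exp (-ord a) := by
  have h : valZ F a ≠ 0 := (map_ne_zero _).2 ha
  have h2 : ord a = -WithZero.log (valZ F a) := rfl
  rw [h2, neg_neg]
  exact (WithZero.exp_log h).symm

theorem ord_mul {a b : F} (ha : a ≠ 0) (hb : b ≠ 0) : ord (a * b) = ord a + ord b := by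
  have h := map_mul (valZ F) a b
  rw [valZ_eq_exp ha, valZ_eq_exp hb, valZ_eq_exp (mul_ne_zero ha hb), ← WithZero.exp_add,
    WithZero.exp_inj] at h
  omega

@[simp] theorem ord_one : ord (1 : F) = 0 := by
  have := ord_mul (one_ne_zero (α := F)) one_ne_zero
  simp only [mul_one] at this; omega

theorem ord_inv {a : F} (ha : a ≠ 0) : ord a⁻¹ = -ord a := by
  have := ord_mul ha (inv_ne_zero ha)
  rw [mul_inv_cancel₀ ha, ord_one] at this; omega

theorem ord_div {a b : F} (ha : a ≠ 0) (hb : b ≠ 0) : ord (a / b) = ord a - ord b := by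
  rw [div_eq_mul_inv, ord_mul ha (inv_ne_zero hb), ord_inv hb]; ring

theorem ord_pow {a : F} (ha : a ≠ 0) (n : ℕ) : ord (a ^ n) = n * ord a := by
  induction n with
  | zero => simp
  | succ k ih => rw [pow_succ, ord_mul (pow_ne_zero _ ha) ha, ih]; push_cast; ring

theorem ord_zpow {a : F} (ha : a ≠ 0) (n : ℤ) : ord (a ^ n) = n * ord a := by
  cases n with
  | ofNat k => simpa using ord_pow ha k
  | negSucc k =>
    rw [zpow_negSucc, ord_inv (pow_ne_zero _ ha), ord_pow ha]; push_cast [Int.negSucc_eq]; ring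

@[simp] theorem ord_neg (a : F) : ord (-a) = ord a := by
  by_cases ha : a = 0
  · simp [ha]
  have h1 : ord (-1 : F) = 0 := by
    have := ord_mul (neg_ne_zero.2 (one_ne_zero (α := F))) (neg_ne_zero.2 one_ne_zero)
    rw [neg_mul_neg, one_mul, ord_one] at this; omega
  rw [← neg_one_mul, ord_mul (by simp) ha, h1, zero_add]

variable (F) in
/-- The fractional ideal `{a | v(a) ≥ n}`. -/
def fracIdeal (n : ℤ) : AddSubgroup F where
  carrier := {a | a = 0 ∨ n ≤ ord a}
  zero_mem' := Or.inl rfl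
  neg_mem' := by intro a h; simpa using h
  add_mem' := by
    intro a b ha hb
    by_cases h0 : a + b = 0
    · exact Or.inl h0
    by_cases ha0 : a = 0
    · simpa [ha0] using hb
    by_cases hb0 : b = 0
    · simpa [hb0] using ha
    replace ha := ha.resolve_left ha0
    replace hb := hb.resolve_left hb0
    right
    have h := valZ_add a b
    rw [valZ_eq_exp h0, valZ_eq_exp ha0, valZ_eq_exp hb0] at h
    rcases le_max_iff.1 h with h | h <;> rw [WithZero.exp_le_exp] at h <;> omega

theorem mem_fracIdeal {n : ℤ} {a : F} : a ∈ fracIdeal F n ↔ a = 0 ∨ n ≤ ord a := Iff.rfl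

theorem mem_fracIdeal_of_ne {n : ℤ} {a : F} (ha : a ≠ 0) : a ∈ fracIdeal F n ↔ n ≤ ord a := by
  simp [mem_fracIdeal, ha]

theorem fracIdeal_anti {m n : ℤ} (h : m ≤ n) : fracIdeal F n ≤ fracIdeal F m := by
  rintro a (ha | ha)
  · exact Or.inl ha
  · exact Or.inr (h.trans ha)

theorem mul_mem_fracIdeal {m n k : ℤ} {a b : F} (ha : a ∈ fracIdeal F m) (hb : b ∈ fracIdeal F n)
    (hk : k ≤ m + n) : a * b ∈ fracIdeal F k := by
  rcases ha with rfl | ha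
  · simp [zero_mem]
  rcases hb with rfl | hb
  · simp [zero_mem]
  by_cases ha0 : a = 0
  · simp [ha0, zero_mem]
  by_cases hb0 : b = 0
  · simp [hb0, zero_mem]
  exact Or.inr (by rw [ord_mul ha0 hb0]; omega)

theorem mul_mem_fracIdeal_iff {n : ℤ} {a b : F} (ha : a ≠ 0) :
    a * b ∈ fracIdeal F n ↔ b ∈ fracIdeal F (n - ord a) := by
  by_cases hb : b = 0
  · simp [hb, zero_mem]
  rw [mem_fracIdeal_of_ne (mul_ne_zero ha hb), mem_fracIdeal_of_ne hb, ord_mul ha hb]; omega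

theorem mem_integer_iff {a : F} : a ∈ 𝒪[F] ↔ a ∈ fracIdeal F 0 := by
  rw [Valuation.mem_integer_iff, ← map_one (ValuativeRel.valuation F), ← valZ_le_iff]
  by_cases ha : a = 0
  · simp [ha, zero_mem]
  rw [mem_fracIdeal_of_ne ha, valZ_eq_exp ha, map_one, ← WithZero.exp_zero, WithZero.exp_le_exp]
  omega

theorem ord_add_eq_of_lt {a b : F} (ha : a ≠ 0) (hb : b ∈ fracIdeal F (ord a + 1)) :
    a + b ≠ 0 ∧ ord (a + b) = ord a := by
  have h0 : a + b ≠ 0 := by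
    intro h
    have : b = -a := by linear_combination h
    rw [this, mem_fracIdeal_of_ne (neg_ne_zero.2 ha), ord_neg] at hb; omega
  refine ⟨h0, le_antisymm ?_ ?_⟩
  · by_contra! h
    have h1 : a + b ∈ fracIdeal F (ord a + 1) := Or.inr (by omega)
    have h2 := sub_mem h1 hb
    rw [add_sub_cancel_right, mem_fracIdeal_of_ne ha] at h2; omega
  · have h1 : a ∈ fracIdeal F (ord a) := Or.inr le_rfl
    exact (add_mem h1 (fracIdeal_anti (by omega) hb)).resolve_left h0

theorem ord_eq_zero_iff_isUnit {a : 𝒪[F]} (ha : (a : F) ≠ 0) : ord (a : F) = 0 ↔ IsUnit a := by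
  constructor
  · intro h
    have h' : (a : F)⁻¹ ∈ 𝒪[F] := by
      rw [mem_integer_iff, mem_fracIdeal_of_ne (inv_ne_zero ha), ord_inv ha]; omega
    exact IsUnit.of_mul_eq_one ⟨_, h'⟩ (Subtype.ext (mul_inv_cancel₀ ha))
  · rintro ⟨u, rfl⟩
    have h1 := (mem_fracIdeal_of_ne ha).1 (mem_integer_iff.1 (u : 𝒪[F]).2)
    have h3 : ((u : 𝒪[F]) : F) * ((u⁻¹ : 𝒪[F]ˣ) : 𝒪[F]) = 1 := by
      rw [← Subring.coe_mul, Units.mul_inv]; rfl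
    have h4 : (((u⁻¹ : 𝒪[F]ˣ) : 𝒪[F]) : F) ≠ 0 := right_ne_zero_of_mul_eq_one h3
    have h2 := (mem_fracIdeal_of_ne h4).1 (mem_integer_iff.1 ((u⁻¹ : 𝒪[F]ˣ) : 𝒪[F]).2)
    have := ord_mul ha h4
    rw [h3, ord_one] at this; omega

theorem mem_maximalIdeal_iff {a : 𝒪[F]} : a ∈ 𝓂[F] ↔ (a : F) ∈ fracIdeal F 1 := by
  rw [IsLocalRing.mem_maximalIdeal, mem_nonunits_iff]
  by_cases ha : (a : F) = 0
  · have : a = 0 := Subtype.ext ha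
    subst this; simp [zero_mem]
  rw [← ord_eq_zero_iff_isUnit ha, mem_fracIdeal_of_ne ha]
  have := (mem_fracIdeal_of_ne ha).1 (mem_integer_iff.1 a.2)
  omega

theorem residue_eq_zero_iff {a : 𝒪[F]} : IsLocalRing.residue 𝒪[F] a = 0 ↔ (a : F) ∈ fracIdeal F 1 := by
  rw [IsLocalRing.residue_eq_zero_iff, mem_maximalIdeal_iff]

variable (F) in
theorem one_lt_resCard : 1 < resCard F :=
  Finite.one_lt_card

variable (F) in
theorem resCard_pos : (0 : ℝ) < resCard F := by
  have := one_lt_resCard F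
  positivity

theorem absF_of_ne {a : F} (ha : a ≠ 0) : absF a = (resCard F : ℝ) ^ (-ord a) := by
  simp [absF, ha]

theorem absF_nonneg (a : F) : 0 ≤ absF a := by
  unfold absF; split_ifs <;> positivity

theorem absF_mul (a b : F) : absF (a * b) = absF a * absF b := by
  by_cases ha : a = 0
  · simp [ha, absF]
  by_cases hb : b = 0
  · simp [hb, absF]
  rw [absF_of_ne ha, absF_of_ne hb, absF_of_ne (mul_ne_zero ha hb), ord_mul ha hb, neg_add,
    zpow_add₀ (resCard_pos F).ne']

/-! ### Topology -/

theorem isOpen_fracIdeal_zero : IsOpen (fracIdeal F 0 : Set F) := by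
  have : (fracIdeal F 0 : Set F) = (𝒪[F] : Set F) := by
    ext a; exact mem_integer_iff.symm
  rw [this]
  exact Valuation.isOpen_integer (v := ValuativeRel.valuation F)

theorem isCompact_fracIdeal_zero : IsCompact (fracIdeal F 0 : Set F) := by
  have : (fracIdeal F 0 : Set F) = (𝒪[F] : Set F) := by
    ext a; exact mem_integer_iff.symm
  rw [this]
  exact IsNonarchimedeanLocalField.isCompact_closedBall F 1

theorem exists_ord_eq_one : ∃ π : F, π ≠ 0 ∧ ord π = 1 := by
  obtain ⟨a, ha⟩ := ValuativeRel.valuation_surjective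
    ((IsNonarchimedeanLocalField.valueGroupWithZeroIsoInt F).symm (WithZero.exp (-1 : ℤ)))
  have h : valZ F a = WithZero.exp (-1 : ℤ) := by
    change IsNonarchimedeanLocalField.valueGroupWithZeroIsoInt F (ValuativeRel.valuation F a) = _
    rw [ha]; simp
  have h0 : a ≠ 0 := by
    rintro rfl
    rw [map_zero] at h; exact WithZero.exp_ne_zero h.symm
  refine ⟨a, h0, ?_⟩
  rw [valZ_eq_exp h0, WithZero.exp_inj] at h; omega

theorem exists_ord_eq (n : ℤ) : ∃ a : F, a ≠ 0 ∧ ord a = n := by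
  obtain ⟨π, h0, h1⟩ := exists_ord_eq_one (F := F)
  exact ⟨π ^ n, zpow_ne_zero _ h0, by rw [ord_zpow h0, h1, mul_one]⟩

theorem fracIdeal_eq_image {a : F} (ha : a ≠ 0) (n : ℤ) :
    (fracIdeal F (n + ord a) : Set F) = (a * ·) '' (fracIdeal F n : Set F) := by
  ext b
  constructor
  · intro hb
    refine ⟨a⁻¹ * b, ?_, by field_simp⟩
    rw [SetLike.mem_coe, mul_mem_fracIdeal_iff (inv_ne_zero ha), ord_inv ha, sub_neg_eq_add]
    exact hb
  · rintro ⟨c, hc, rfl⟩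
    rw [SetLike.mem_coe, mul_mem_fracIdeal_iff ha, add_sub_cancel_right]
    exact hc

theorem isOpen_fracIdeal (n : ℤ) : IsOpen (fracIdeal F n : Set F) := by
  obtain ⟨a, h0, h1⟩ := exists_ord_eq (F := F) n
  have := fracIdeal_eq_image h0 0
  rw [zero_add, h1] at this
  rw [this]
  exact (Homeomorph.mulLeft₀ a h0).isOpenMap _ isOpen_fracIdeal_zero

theorem isClosed_fracIdeal (n : ℤ) : IsClosed (fracIdeal F n : Set F) :=
  AddSubgroup.isClosed_of_isOpen _ (isOpen_fracIdeal n)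

theorem isCompact_fracIdeal (n : ℤ) : IsCompact (fracIdeal F n : Set F) := by
  obtain ⟨a, h0, h1⟩ := exists_ord_eq (F := F) n
  have := fracIdeal_eq_image h0 0
  rw [zero_add, h1] at this
  rw [this]
  exact isCompact_fracIdeal_zero.image (continuous_const_mul a)

instance instT2SpaceLocalField : T2Space F := by
  have h : IsClosed ({0} : Set F) := by
    have : ({0} : Set F) = ⋂ n : ℤ, (fracIdeal F n : Set F) := by
      ext a
      simp only [Set.mem_singleton_iff, Set.mem_iInter, SetLike.mem_coe]
      refine ⟨fun h n => h ▸ zero_mem _, fun h => ?_⟩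
      by_contra h0
      have := (mem_fracIdeal_of_ne h0).1 (h (ord a + 1))
      omega
    rw [this]
    exact isClosed_iInter isClosed_fracIdeal
  have := IsTopologicalAddGroup.t1Space F h
  infer_instance

instance instSigmaCompactLocalField : SigmaCompactSpace F where
  isSigmaCompact_univ := by
    refine ⟨fun n => (fracIdeal F (-n) : Set F), fun n => isCompact_fracIdeal _, ?_⟩
    rw [Set.eq_univ_iff_forall]
    intro a
    rw [Set.mem_iUnion]
    exact ⟨(ord a).natAbs, Or.inr (by omega)⟩

theorem hasBasis_nhds_zero_fracIdeal :
    (𝓝 (0 : F)).HasBasis (fun _ : ℕ => True) (fun n => (fracIdeal F n : Set F)) := by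
  rw [Filter.hasBasis_iff]
  intro s
  constructor
  · intro hs
    obtain ⟨γ, h0, hγ⟩ := (IsValuativeTopology.hasBasis_nhds_zero' F).mem_iff.1 hs
    obtain ⟨a, rfl⟩ := ValuativeRel.valuation_surjective γ
    have ha : a ≠ 0 := by rintro rfl; simp at h0
    refine ⟨(ord a + 1).toNat, trivial, fun x hx => hγ ?_⟩
    rw [Set.mem_ofPred_eq, ← not_le, ← valZ_le_iff, not_le]
    by_cases hx0 : x = 0
    · rw [hx0, map_zero]; exact zero_lt_iff.2 ((map_ne_zero _).2 ha)
    rw [valZ_eq_exp hx0, valZ_eq_exp ha, WithZero.exp_lt_exp]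
    have := (mem_fracIdeal_of_ne hx0).1 hx
    omega
  · rintro ⟨n, -, hn⟩
    exact mem_of_superset ((isOpen_fracIdeal n).mem_nhds (zero_mem _)) hn

instance instSecondCountableLocalField : SecondCountableTopology F := by
  let := IsTopologicalAddGroup.rightUniformSpace F
  have := isUniformAddGroup_of_addCommGroup (G := F)
  have : (𝓝 (0 : F)).IsCountablyGenerated :=
    HasCountableBasis.isCountablyGenerated ⟨hasBasis_nhds_zero_fracIdeal, Set.to_countable _⟩
  have : (_root_.uniformity F).IsCountablyGenerated :=
    IsUniformAddGroup.uniformity_countably_generated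
  let := UniformSpace.pseudoMetricSpace F
  exact EMetric.secondCountable_of_sigmaCompact F

end Ord

@[to_additive]
theorem measure_eq_card_mul {G : Type*} [Group G] [MeasurableSpace G] [MeasurableMul G]
    (μ : Measure G) [μ.IsMulLeftInvariant] {ι : Type*} [Finite ι] (S H : Set G) (g : ι → G)
    (hH : MeasurableSet H) (hS : ∀ x, x ∈ S ↔ ∃ i, (g i)⁻¹ * x ∈ H)
    (hd : ∀ i j x, (g i)⁻¹ * x ∈ H → (g j)⁻¹ * x ∈ H → i = j) :
    μ S = Nat.card ι * μ H := by
  have := Fintype.ofFinite ι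
  have h1 : S = ⋃ i, (fun x => (g i)⁻¹ * x) ⁻¹' H := by
    ext x; simp [hS]
  rw [h1, measure_iUnion]
  · simp [measure_preimage_mul]
  · intro i j hij
    rw [Function.onFun, Set.disjoint_left]
    exact fun x hx hy => hij (hd i j x hx hy)
  · exact fun i => measurable_const_mul _ hH

section ResidueClasses

variable {F : Type*} [Field F] [ValuativeRel F] [TopologicalSpace F]
  [IsNonarchimedeanLocalField F]

variable (F) in
/-- Representatives in `𝒪` of the residue classes. -/
def resLift (r : 𝓀[F]) : F := (Function.surjInv (IsLocalRing.residue_surjective (R := 𝒪[F])) r : 𝒪[F])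

theorem resLift_mem (r : 𝓀[F]) : resLift F r ∈ fracIdeal F 0 := by
  rw [← mem_integer_iff]; exact Subtype.property _

theorem sub_resLift_mem_iff {a : F} (ha : a ∈ 𝒪[F]) (r : 𝓀[F]) :
    -resLift F r + a ∈ fracIdeal F 1 ↔ IsLocalRing.residue 𝒪[F] ⟨a, ha⟩ = r := by
  have h : IsLocalRing.residue 𝒪[F]
      (Function.surjInv (IsLocalRing.residue_surjective (R := 𝒪[F])) r) = r :=
    Function.surjInv_eq _ r
  have h2 : -resLift F r + a = ((⟨a, ha⟩ -
      Function.surjInv (IsLocalRing.residue_surjective (R := 𝒪[F])) r : 𝒪[F]) : F) := by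
    rw [resLift, AddSubgroupClass.coe_sub]; ring
  rw [h2, ← residue_eq_zero_iff, map_sub, h, sub_eq_zero]

theorem exists_sub_resLift_mem {a : F} (ha : a ∈ fracIdeal F 0) :
    ∃ r : 𝓀[F], -resLift F r + a ∈ fracIdeal F 1 :=
  ⟨_, (sub_resLift_mem_iff (mem_integer_iff.2 ha) _).2 rfl⟩

theorem eq_of_sub_resLift_mem {a : F} {r s : 𝓀[F]} (hr : -resLift F r + a ∈ fracIdeal F 1)
    (hs : -resLift F s + a ∈ fracIdeal F 1) : r = s := by
  have ha : a ∈ 𝒪[F] := by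
    rw [mem_integer_iff]
    simpa using add_mem (resLift_mem r) (fracIdeal_anti zero_le_one hr)
  rw [← (sub_resLift_mem_iff ha r).1 hr, (sub_resLift_mem_iff ha s).1 hs]

theorem continuous_addChar {ψ : AddChar F Circle} (hψ : IsUnramifiedAddChar ψ) : Continuous ψ := by
  have h : ∀ a ∈ fracIdeal F 0, ψ a = 1 := fun a ha => hψ.1 a (mem_integer_iff.2 ha)
  rw [continuous_iff_continuousAt]
  intro x
  have : ψ =ᶠ[𝓝 x] fun _ => ψ x := by
    have hx : (fun y => -x + y) ⁻¹' (fracIdeal F 0 : Set F) ∈ 𝓝 x :=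
      ((isOpen_fracIdeal 0).preimage (continuous_const_add (-x))).mem_nhds (by simp [zero_mem])
    filter_upwards [hx] with y hy
    have := h _ hy
    rw [AddChar.map_add_eq_mul, AddChar.map_neg_eq_inv, inv_mul_eq_one] at this
    exact this.symm
  exact continuousAt_const.congr this.symm

theorem isOpen_ord_units (s : Set ℤ) : IsOpen {t : Fˣ | ord (t : F) ∈ s} := by
  rw [isOpen_iff_mem_nhds]
  intro t ht
  have h : (fun y : Fˣ => -(t : F) + (y : F)) ⁻¹' (fracIdeal F (ord (t : F) + 1) : Set F) ∈ 𝓝 t :=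
    ((isOpen_fracIdeal _).preimage ((continuous_const_add _).comp Units.continuous_val)).mem_nhds
      (by simp [zero_mem])
  filter_upwards [h] with y hy
  have := (ord_add_eq_of_lt t.ne_zero hy).2
  rw [add_neg_cancel_left] at this
  simpa [this] using ht

theorem isCompact_ord_units : IsCompact {t : Fˣ | ord (t : F) = 0} := by
  have : {t : Fˣ | ord (t : F) = 0} = ((𝒪[F].toSubmonoid).units : Set Fˣ) := by
    ext t
    simp only [Set.mem_ofPred_eq, SetLike.mem_coe, Submonoid.mem_units_iff]
    change _ ↔ (t : F) ∈ 𝒪[F] ∧ ((t⁻¹ : Fˣ) : F) ∈ 𝒪[F]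
    rw [mem_integer_iff, mem_integer_iff, mem_fracIdeal_of_ne t.ne_zero,
      mem_fracIdeal_of_ne (Units.ne_zero _), Units.val_inv_eq_inv_val, ord_inv t.ne_zero]
    omega
  rw [this]
  refine Submonoid.units_isCompact ?_
  have h : ((𝒪[F].toSubmonoid : Submonoid F) : Set F) = (fracIdeal F 0 : Set F) := by
    ext a; exact mem_integer_iff
  rw [h]; exact isCompact_fracIdeal 0

end ResidueClasses

section Measures

variable {F : Type*} [Field F] [ValuativeRel F] [TopologicalSpace F]
  [IsNonarchimedeanLocalField F] [MeasurableSpace F] [BorelSpace F]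

theorem measurableSet_fracIdeal (n : ℤ) : MeasurableSet (fracIdeal F n : Set F) :=
  (isOpen_fracIdeal n).measurableSet

theorem measure_fracIdeal_succ (da : Measure F) [da.IsAddLeftInvariant] (n : ℤ) :
    da (fracIdeal F n) = resCard F * da (fracIdeal F (n + 1)) := by
  obtain ⟨a, h0, ha⟩ := exists_ord_eq (F := F) n
  have key : ∀ (r : 𝓀[F]) (x : F), -(a * resLift F r) + x ∈ fracIdeal F (n + 1) ↔
      -resLift F r + a⁻¹ * x ∈ fracIdeal F 1 := by
    intro r x
    have : -(a * resLift F r) + x = a * (-resLift F r + a⁻¹ * x) := by field_simp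
    rw [this, mul_mem_fracIdeal_iff h0, ha, add_sub_cancel_left]
  refine measure_eq_card_add da _ _ (fun r : 𝓀[F] => a * resLift F r)
    (measurableSet_fracIdeal _) ?_ ?_
  · intro x
    simp only [SetLike.mem_coe, key]
    have hx : x ∈ fracIdeal F n ↔ a⁻¹ * x ∈ fracIdeal F 0 := by
      rw [mul_mem_fracIdeal_iff (inv_ne_zero h0), ord_inv h0, ha, zero_sub, neg_neg]
    rw [hx]
    refine ⟨exists_sub_resLift_mem, fun ⟨r, hr⟩ => ?_⟩
    simpa using add_mem (resLift_mem r) (fracIdeal_anti zero_le_one hr)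
  · intro r s x hr hs
    exact eq_of_sub_resLift_mem ((key r x).1 hr) ((key s x).1 hs)

theorem measureReal_fracIdeal (da : Measure F) [da.IsAddLeftInvariant] (n : ℤ) :
    da.real (fracIdeal F n) = (resCard F : ℝ) ^ (-n) * da.real (fracIdeal F 0) := by
  have hs : ∀ n : ℤ, da.real (fracIdeal F n) = resCard F * da.real (fracIdeal F (n + 1)) := by
    intro n
    simp [Measure.real, measure_fracIdeal_succ da n]
  have hq := (resCard_pos F).ne'
  induction n using Int.induction_on with
  | zero => simp
  | succ k ih =>
    rw [hs] at ih
    rw [neg_add, zpow_add₀ hq, mul_right_comm, ← ih, _root_.zpow_neg_one]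
    field_simp
  | pred k ih =>
    rw [hs, sub_add_cancel, ih, ← mul_assoc]
    congr 1
    rw [neg_sub, sub_eq_add_neg, zpow_add₀ hq, zpow_one]

theorem integrableOn_addChar {ψ : AddChar F Circle} (hψ : IsUnramifiedAddChar ψ)
    (da : Measure F) [IsFiniteMeasureOnCompacts da] (n : ℤ) :
    IntegrableOn (fun x => conj ((ψ x : Circle) : ℂ)) (fracIdeal F n) da := by
  refine ContinuousOn.integrableOn_compact (isCompact_fracIdeal n) (Continuous.continuousOn ?_)
  exact Complex.continuous_conj.comp (continuous_subtype_val.comp (continuous_addChar hψ))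

theorem setIntegral_addChar {ψ : AddChar F Circle} (hψ : IsUnramifiedAddChar ψ)
    (da : Measure F) [da.IsAddHaarMeasure] (n : ℤ) :
    ∫ x in (fracIdeal F n : Set F), conj ((ψ x : Circle) : ℂ) ∂da =
      if 0 ≤ n then ((da.real (fracIdeal F n) : ℝ) : ℂ) else 0 := by
  split_ifs with h
  · rw [setIntegral_congr_fun (g := fun _ => (1 : ℂ)) (measurableSet_fracIdeal n)]
    · simp
    · intro x hx
      have := hψ.1 x (mem_integer_iff.2 (fracIdeal_anti h hx))
      simp [this]
  · obtain ⟨a, h0, ha, hψa⟩ := hψ.2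
    have hm : a ∈ fracIdeal F n := Or.inr (by omega)
    rw [← integral_indicator (measurableSet_fracIdeal n)]
    set f : F → ℂ := (fracIdeal F n : Set F).indicator fun x => conj ((ψ x : Circle) : ℂ) with hf
    have h1 : ∀ x, f (a + x) = conj ((ψ a : Circle) : ℂ) * f x := by
      intro x
      have hx : a + x ∈ (fracIdeal F n : Set F) ↔ x ∈ (fracIdeal F n : Set F) :=
        (fracIdeal F n).add_mem_cancel_left hm
      by_cases h' : x ∈ (fracIdeal F n : Set F)
      · rw [hf, Set.indicator_of_mem (hx.2 h'), Set.indicator_of_mem h']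
        simp [AddChar.map_add_eq_mul]
      · rw [hf, Set.indicator_of_notMem (mt hx.1 h'), Set.indicator_of_notMem h', mul_zero]
    have h2 := integral_add_left_eq_self f a (μ := da)
    simp only [h1] at h2
    rw [integral_const_mul] at h2
    have h3 : (conj ((ψ a : Circle) : ℂ) - 1) * ∫ x, f x ∂da = 0 := by linear_combination h2
    refine (mul_eq_zero.1 h3).resolve_left fun h4 => hψa ?_
    rw [sub_eq_zero] at h4
    have : ((ψ a : Circle) : ℂ) = 1 := by simpa using congrArg conj h4
    exact Circle.ext this

instance instBorelSpaceUnits : BorelSpace Fˣ where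
  measurable_eq := by
    change MeasurableSpace.comap Units.val _ = _
    rw [BorelSpace.measurable_eq (α := F), ← borel_comap]
    congr 1
    exact Units.isEmbedding_val₀.eq_induced.symm

theorem measurableSet_ord_units (s : Set ℤ) : MeasurableSet {t : Fˣ | ord (t : F) ∈ s} :=
  (isOpen_ord_units s).measurableSet

theorem measure_ord_units (dma : Measure Fˣ) [dma.IsMulLeftInvariant] (k : ℤ) :
    dma {t : Fˣ | ord (t : F) = k} = dma {t : Fˣ | ord (t : F) = 0} := by
  obtain ⟨a, h0, ha⟩ := exists_ord_eq (F := F) (-k)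
  rw [← measure_preimage_mul dma (Units.mk0 a h0) {t : Fˣ | ord (t : F) = 0}]
  congr 1
  ext t
  simp only [Set.mem_ofPred_eq, Set.mem_preimage, Units.val_mul, Units.val_mk0,
    ord_mul h0 t.ne_zero, ha]
  omega

end Measures

section Whittaker

variable {F : Type*} [Field F] [ValuativeRel F] [TopologicalSpace F]
  [IsNonarchimedeanLocalField F] [MeasurableSpace F] [BorelSpace F]

theorem measurableSet_ord_eq (k : ℤ) : MeasurableSet {t : Fˣ | ord (t : F) = k} :=
  measurableSet_ord_units {k}

theorem setIntegral_ord_units (dma : Measure Fˣ) [dma.IsHaarMeasure] (ε : ℂ) (k : ℤ) :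
    ∫ t in {t : Fˣ | ord (t : F) = k}, ε ^ ord (t : F) * (absF (t : F) : ℂ) ∂dma =
      ε ^ k * (resCard F : ℂ) ^ (-k) * dma.real {t : Fˣ | ord (t : F) = 0} := by
  rw [setIntegral_congr_fun (g := fun _ => ε ^ k * (resCard F : ℂ) ^ (-k))
    (measurableSet_ord_eq k)]
  · rw [setIntegral_const, Measure.real, measure_ord_units, Measure.real, Complex.real_smul, mul_comm]
  · intro t ht
    have ht' : ord (t : F) = k := ht
    simp only [ht', absF_of_ne t.ne_zero]
    push_cast
    rfl

theorem integrableOn_ord_units (dma : Measure Fˣ) [dma.IsHaarMeasure] {ε : ℂ} (hε : ‖ε‖ = 1)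
    (m : ℤ) :
    IntegrableOn (fun t : Fˣ => ε ^ ord (t : F) * (absF (t : F) : ℂ)) {t : Fˣ | m ≤ ord (t : F)}
      dma := by
  have hU : {t : Fˣ | m ≤ ord (t : F)} = ⋃ i : ℕ, {t : Fˣ | ord (t : F) = m + i} := by
    ext t
    simp only [Set.mem_ofPred_eq, Set.mem_iUnion]
    exact ⟨fun h => ⟨(ord (t : F) - m).toNat, by omega⟩, fun ⟨i, h⟩ => by omega⟩
  have hfin : ∀ k : ℤ, dma {t : Fˣ | ord (t : F) = k} < ⊤ := by
    intro k
    rw [measure_ord_units]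
    exact isCompact_ord_units.measure_lt_top
  have hq := one_lt_resCard F
  have hq' : (1 : ℝ) < resCard F := by exact_mod_cast hq
  rw [hU]
  refine integrableOn_iUnion_of_summable_integral_norm
    (fun i => ?_) ?_
  · refine IntegrableOn.congr_fun (f := fun _ => ε ^ (m + i) * (resCard F : ℂ) ^ (-(m + i : ℤ)))
      (integrableOn_const (hfin _).ne) ?_ (measurableSet_ord_eq (m + i))
    intro t ht
    have ht' : ord (t : F) = m + i := ht
    simp only [ht', absF_of_ne t.ne_zero]
    push_cast
    rfl
  · have : ∀ i : ℕ, ∫ t in {t : Fˣ | ord (t : F) = m + i},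
        ‖ε ^ ord (t : F) * (absF (t : F) : ℂ)‖ ∂dma =
        (dma.real {t : Fˣ | ord (t : F) = 0} * (resCard F : ℝ) ^ (-m)) *
          ((resCard F : ℝ)⁻¹) ^ i := by
      intro i
      rw [setIntegral_congr_fun (g := fun _ => (resCard F : ℝ) ^ (-(m + i : ℤ)))
        (measurableSet_ord_eq (m + i))]
      · rw [setIntegral_const, Measure.real, measure_ord_units, smul_eq_mul, neg_add,
          zpow_add₀ (resCard_pos F).ne', _root_.zpow_neg _ (i : ℤ), zpow_natCast, inv_pow, mul_assoc]
        rfl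
      · intro t ht
        have ht' : ord (t : F) = m + i := ht
        simp only [ht', absF_of_ne t.ne_zero, norm_mul, norm_zpow, hε, _root_.one_zpow, one_mul]
        rw [Complex.norm_real, Real.norm_of_nonneg (by positivity)]
    simp only [this]
    exact (summable_geometric_of_lt_one (by positivity) (inv_lt_one_of_one_lt₀ hq')).mul_left _

theorem integral_newSection (dma : Measure Fˣ) [dma.IsHaarMeasure] {ε : ℂ} (hε : ‖ε‖ = 1)
    (a : Fˣ) {n : ℤ} (hn : -ord (a : F) ≤ n) {x : F} (hx : x ∈ fracIdeal F (-n)) :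
    ∫ t in {t : Fˣ | (t : F) * a ∈ 𝒪[F] ∧ (t : F) * x ∈ 𝒪[F]},
        ε ^ ord (t : F) * (absF (t : F) : ℂ) ∂dma =
      ∑ k ∈ Finset.Ico (-ord (a : F)) n, ε ^ k * (resCard F : ℂ) ^ (-k) *
          dma.real {t : Fˣ | ord (t : F) = 0} * (fracIdeal F (-k) : Set F).indicator 1 x +
        ∫ t in {t : Fˣ | n ≤ ord (t : F)}, ε ^ ord (t : F) * (absF (t : F) : ℂ) ∂dma := by
  classical
  set h : Fˣ → ℂ := fun t => ε ^ ord (t : F) * (absF (t : F) : ℂ) with hh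
  have hmem : ∀ t : Fˣ, (t : F) * a ∈ 𝒪[F] ∧ (t : F) * x ∈ 𝒪[F] ↔
      -ord (a : F) ≤ ord (t : F) ∧ x ∈ fracIdeal F (-ord (t : F)) := by
    intro t
    rw [mem_integer_iff, mem_integer_iff, mul_mem_fracIdeal_iff t.ne_zero,
      mul_mem_fracIdeal_iff t.ne_zero, mem_fracIdeal_of_ne a.ne_zero, zero_sub]
    exact and_congr_left fun _ => by omega
  set S : Finset ℤ := (Finset.Ico (-ord (a : F)) n).filter fun k => x ∈ fracIdeal F (-k) with hS
  have hset : {t : Fˣ | (t : F) * a ∈ 𝒪[F] ∧ (t : F) * x ∈ 𝒪[F]} =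
      (⋃ k ∈ S, {t : Fˣ | ord (t : F) = k}) ∪ {t : Fˣ | n ≤ ord (t : F)} := by
    ext t
    rw [Set.mem_ofPred_eq, hmem]
    simp only [hS, Finset.mem_filter, Finset.mem_Ico, Set.mem_union, Set.mem_iUnion,
      Set.mem_ofPred_eq, exists_prop, exists_eq_right']
    constructor
    · rintro ⟨h1, h2⟩
      by_cases h3 : n ≤ ord (t : F)
      · exact Or.inr h3
      · exact Or.inl ⟨⟨h1, by omega⟩, h2⟩
    · rintro (⟨⟨h1, -⟩, h2⟩ | h3)
      · exact ⟨h1, h2⟩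
      · exact ⟨hn.trans h3, fracIdeal_anti (by omega) hx⟩
  have hi : ∀ k : ℤ, IntegrableOn h {t : Fˣ | ord (t : F) = k} dma := fun k =>
    (integrableOn_ord_units dma hε k).mono_set fun t ht => (show ord (t : F) = k from ht).ge
  rw [hset, setIntegral_union]
  · rw [integral_biUnion_finset S (fun k _ => measurableSet_ord_eq k)]
    · rw [hS, Finset.sum_filter]
      congr 1
      refine Finset.sum_congr rfl fun k _ => ?_
      rw [setIntegral_ord_units]
      by_cases hk : x ∈ fracIdeal F (-k)
      · rw [if_pos hk, Set.indicator_of_mem (by exact hk)]; simp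
      · rw [if_neg hk, Set.indicator_of_notMem (by exact hk)]; simp
    · intro i _ j _ hij
      rw [Function.onFun, Set.disjoint_left]
      intro t h1 h2
      exact hij ((show ord (t : F) = i from h1).symm.trans h2)
    · exact fun k _ => hi k
  · rw [Set.disjoint_left]
    intro t h1 h2
    simp only [hS, Finset.mem_filter, Finset.mem_Ico, Set.mem_iUnion,
      Set.mem_ofPred_eq, exists_prop, exists_eq_right'] at h1 h2
    omega
  · exact measurableSet_ord_units {k | n ≤ k}
  · exact (integrableOn_finset_iUnion).2 fun k _ => hi k
  · exact integrableOn_ord_units dma hε n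

theorem newSection_weyl (dma : Measure Fˣ) {ε : ℂ} {μ₁ μ₂ : Fˣ → ℂ}
    (hμ : ∀ t : Fˣ, μ₁ t / μ₂ t = ε ^ ord (t : F)) (a : Fˣ) (x : F) :
    newSection dma μ₁ μ₂ (weylGL * unipGL x * diagGL a) =
      μ₁ a * (Real.sqrt (absF (a : F)) : ℂ) *
        ∫ t in {t : Fˣ | (t : F) * a ∈ 𝒪[F] ∧ (t : F) * x ∈ 𝒪[F]},
          ε ^ ord (t : F) * (absF (t : F) : ℂ) ∂dma := by
  have hdet : Matrix.GeneralLinearGroup.det (weylGL * unipGL x * diagGL a) = a := by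
    ext
    simp [weylGL, unipGL, diagGL, Matrix.GeneralLinearGroup.mkOfDetNeZero, Matrix.det_fin_two]
  have h10 : (weylGL * unipGL x * diagGL a : GL (Fin 2) F) 1 0 = a := by
    simp [weylGL, unipGL, diagGL, Matrix.GeneralLinearGroup.mkOfDetNeZero]
  have h11 : (weylGL * unipGL x * diagGL a : GL (Fin 2) F) 1 1 = x := by
    simp [weylGL, unipGL, diagGL, Matrix.GeneralLinearGroup.mkOfDetNeZero]
  rw [newSection, hdet, h10, h11]
  congr 1
  rw [← integral_indicator]
  · congr 1
    ext t
    by_cases ht : (t : F) * a ∈ 𝒪[F] ∧ (t : F) * x ∈ 𝒪[F]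
    · rw [if_pos ht, Set.indicator_of_mem (by exact ht), hμ]
    · rw [if_neg ht, Set.indicator_of_notMem (by exact ht)]
  · have h1 : ∀ y : F, MeasurableSet {t : Fˣ | (t : F) * y ∈ 𝒪[F]} := by
      intro y
      have : {t : Fˣ | (t : F) * y ∈ 𝒪[F]} = (fun t : Fˣ => (t : F) * y) ⁻¹' (fracIdeal F 0) := by
        ext t; exact mem_integer_iff
      rw [this]
      exact ((isOpen_fracIdeal 0).preimage (Units.continuous_val.mul continuous_const)).measurableSet
    exact (h1 a).inter (h1 x)

theorem whittakerNew_eq (da : Measure F) [da.IsAddHaarMeasure] (dma : Measure Fˣ)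
    [dma.IsHaarMeasure] {ψ : AddChar F Circle} (hψ : IsUnramifiedAddChar ψ) {ε : ℂ} (hε : ‖ε‖ = 1)
    {μ₁ μ₂ : Fˣ → ℂ} (hμ : ∀ t : Fˣ, μ₁ t / μ₂ t = ε ^ ord (t : F)) (a : Fˣ) :
    whittakerNew da dma ψ μ₁ μ₂ a = μ₁ a * (Real.sqrt (absF (a : F)) : ℂ) *
      (da.real {a : F | a ∈ 𝒪[F]} * dma.real {a : Fˣ | ord (a : F) = 0} : ℝ) *
        ∑ k ∈ Finset.Icc (-ord (a : F)) 0, ε ^ k := by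
  have hO : {a : F | a ∈ 𝒪[F]} = (fracIdeal F 0 : Set F) := by
    ext a; exact mem_integer_iff
  have hq : (resCard F : ℂ) ≠ 0 := by exact_mod_cast (resCard_pos F).ne'
  refine Tendsto.limUnder_eq (tendsto_const_nhds.congr' ?_)
  filter_upwards [eventually_ge_atTop (max 1 (-ord (a : F)).toNat)] with n hn
  have hn1 : (1 : ℤ) ≤ n := by exact_mod_cast (le_max_left _ _).trans hn
  have hn2 : -ord (a : F) ≤ n := by
    have := (le_max_right _ _).trans hn
    omega
  change _ = ∫ x in (fracIdeal F (-n) : Set F), _ ∂da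
  set I := ∫ t in {t : Fˣ | (n : ℤ) ≤ ord (t : F)}, ε ^ ord (t : F) * (absF (t : F) : ℂ) ∂dma
  set c : ℤ → ℂ := fun k => ε ^ k * (resCard F : ℂ) ^ (-k) * dma.real {t : Fˣ | ord (t : F) = 0}
  have hint : ∀ x ∈ (fracIdeal F (-n) : Set F),
      newSection dma μ₁ μ₂ (weylGL * unipGL x * diagGL a) * conj ((ψ x : Circle) : ℂ) =
        μ₁ a * (Real.sqrt (absF (a : F)) : ℂ) * (∑ k ∈ Finset.Ico (-ord (a : F)) n, c k *
          (fracIdeal F (-k) : Set F).indicator (fun x => conj ((ψ x : Circle) : ℂ)) x +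
          I * conj ((ψ x : Circle) : ℂ)) := by
    intro x hx
    rw [newSection_weyl dma hμ, integral_newSection dma hε a hn2 hx, mul_assoc, add_mul,
      Finset.sum_mul]
    congr 2
    refine Finset.sum_congr rfl fun k _ => ?_
    by_cases hk : x ∈ (fracIdeal F (-k) : Set F)
    · simp only [Set.indicator_of_mem hk, Pi.one_apply, c]; ring
    · simp only [Set.indicator_of_notMem hk, mul_zero, zero_mul]
  have hmeas : ∀ k : ℤ, MeasurableSet (fracIdeal F k : Set F) := measurableSet_fracIdeal
  rw [setIntegral_congr_fun (hmeas _) hint, integral_const_mul, mul_assoc (_ * _)]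
  congr 1
  have hik : ∀ k : ℤ, Integrable (fun x => c k * (fracIdeal F (-k) : Set F).indicator
      (fun x => conj ((ψ x : Circle) : ℂ)) x) (da.restrict (fracIdeal F (-n))) := fun k =>
    (((integrable_indicator_iff (hmeas _)).2 (integrableOn_addChar hψ da _)).restrict).const_mul _
  rw [integral_add (integrable_finsetSum _ fun k _ => hik k)
    ((integrableOn_addChar hψ da _).const_mul _), integral_finsetSum _ fun k _ => hik k,
    integral_const_mul, setIntegral_addChar hψ, if_neg (by omega), mul_zero, add_zero]
  have hterm : ∀ k ∈ Finset.Ico (-ord (a : F)) n, ∫ x in (fracIdeal F (-n) : Set F),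
      c k * (fracIdeal F (-k) : Set F).indicator (fun x => conj ((ψ x : Circle) : ℂ)) x ∂da =
      if k ≤ 0 then ((da.real {a : F | a ∈ 𝒪[F]} * dma.real {a : Fˣ | ord (a : F) = 0} : ℝ) : ℂ) *
        ε ^ k else 0 := by
    intro k hk
    rw [Finset.mem_Ico] at hk
    rw [integral_const_mul, setIntegral_indicator (hmeas _),
      Set.inter_eq_right.2 (fracIdeal_anti (F := F) (by omega)), setIntegral_addChar hψ]
    by_cases h0 : k ≤ 0
    · rw [if_pos (by omega), if_pos h0, measureReal_fracIdeal, hO]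
      simp only [c, neg_neg]
      push_cast
      rw [_root_.zpow_neg]
      field_simp
    · rw [if_neg (by omega), if_neg h0, mul_zero]
  rw [Finset.sum_congr rfl hterm, ← Finset.sum_filter, Finset.mul_sum]
  refine Finset.sum_congr ?_ fun _ _ => rfl
  ext k
  simp only [Finset.mem_Icc, Finset.mem_filter, Finset.mem_Ico]
  omega

end Whittaker

section Unfolding

variable {G : Type*} [Group G] {T M : Subgroup G}

/-- The set `T M`. -/
def mulSet (T M : Subgroup G) : Set G := {g | ∃ t : T, (t : G) * g ∈ M}

theorem mul_mem_mulSet_left (t : T) (g : G) : (t : G) * g ∈ mulSet T M ↔ g ∈ mulSet T M := by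
  constructor
  · rintro ⟨s, hs⟩
    exact ⟨s * t, by simpa [mul_assoc] using hs⟩
  · rintro ⟨s, hs⟩
    exact ⟨s * t⁻¹, by simpa [mul_assoc] using hs⟩

theorem mul_mem_mulSet_right {k : G} (hk : k ∈ M) (g : G) : g * k ∈ mulSet T M ↔ g ∈ mulSet T M := by
  simp only [mulSet, Set.mem_ofPred_eq, ← mul_assoc, M.mul_mem_cancel_right hk]

theorem out_invariant {β : Type*} {f : G → β} (hf : ∀ (t : T) g, f (t * g) = f g) (g : G) :
    f ((Quotient.mk (QuotientGroup.rightRel T) g).out) = f g := by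
  have h := Quotient.mk_out (s := QuotientGroup.rightRel T) g
  rw [QuotientGroup.rightRel_apply] at h
  rw [← hf ⟨_, h⟩]
  simp

theorem measurable_out [MeasurableSpace G] {f : G → ENNReal} (hm : Measurable f) (hf : ∀ (t : T) g, f (t * g) = f g) :
    Measurable fun y : Quotient (QuotientGroup.rightRel T) => f y.out := by
  refine measurable_from_quotient.2 ?_
  convert hm using 1
  ext g
  exact out_invariant hf g

theorem indicator_mulSet_left (t : T) (g : G) (c : ENNReal) :
    (mulSet T M).indicator (fun _ => c) (t * g) = (mulSet T M).indicator (fun _ => c) g := by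
  by_cases h : g ∈ mulSet T M
  · rw [Set.indicator_of_mem h, Set.indicator_of_mem ((mul_mem_mulSet_left t g).2 h)]
  · rw [Set.indicator_of_notMem h, Set.indicator_of_notMem (mt (mul_mem_mulSet_left t g).1 h)]

variable [TopologicalSpace G] [IsTopologicalGroup G] [MeasurableSpace G] [BorelSpace G]

theorem measurable_of_right_invariant (hM : IsOpen (M : Set G)) {β : Type*} [MeasurableSpace β]
    {f : G → β} (hf : ∀ g, ∀ k ∈ M, f (g * k) = f g) : Measurable f := by
  have h : IsLocallyConstant f := by
    rw [IsLocallyConstant.iff_eventually_eq]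
    intro g
    have : (fun x => g⁻¹ * x) ⁻¹' (M : Set G) ∈ 𝓝 g :=
      (hM.preimage (continuous_const_mul _)).mem_nhds (by simp [M.one_mem])
    filter_upwards [this] with x hx
    simpa using hf g _ hx
  intro s _
  exact (h s).measurableSet

theorem measurableSet_mulSet (hM : IsOpen (M : Set G)) : MeasurableSet (mulSet T M) := by
  have := measurable_of_right_invariant hM (f := fun g => g ∈ mulSet T M)
    (fun g k hk => propext (mul_mem_mulSet_right hk g))
  exact measurableSet_setOfPred.2 this

/-- `vol {t ∈ T | γ t g ∈ T M}`. -/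
def torusVolume (T M : Subgroup G) (dt : Measure T) (γ g : G) : ENNReal :=
  dt {t : T | γ * t * g ∈ mulSet T M}

variable {dg : Measure G} {dt : Measure T}
  {dy : Measure (Quotient (QuotientGroup.rightRel T))}

theorem measurable_torusVolume (hM : IsOpen (M : Set G)) (γ : G) :
    Measurable (torusVolume T M dt γ) := by
  refine measurable_of_right_invariant hM fun g k hk => ?_
  simp only [torusVolume, ← mul_assoc, mul_mem_mulSet_right hk]

variable [dt.IsMulLeftInvariant]

theorem torusVolume_mul_left (hT : ∀ s t : T, s * t = t * s) (γ : G) (s : T) (g : G) :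
    torusVolume T M dt γ (s * g) = torusVolume T M dt γ g := by
  rw [torusVolume, torusVolume, ← measure_preimage_mul dt s {t : T | γ * t * g ∈ mulSet T M}]
  congr 1
  ext t
  simp only [Set.mem_ofPred_eq, Set.mem_preimage]
  rw [hT s t, Subgroup.coe_mul]
  simp only [mul_assoc]

theorem measure_mul_mem (hT : ∀ s t : T, s * t = t * s) (h : G) :
    dt {t : T | (t : G) * h ∈ M} =
      (mulSet T M).indicator (fun _ => dt {t : T | (t : G) ∈ M}) h := by
  by_cases hh : h ∈ mulSet T M
  · obtain ⟨s, hs⟩ := hh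
    rw [Set.indicator_of_mem (show h ∈ mulSet T M from ⟨s, hs⟩), ← measure_preimage_mul dt s⁻¹ {t : T | (t : G) ∈ M}]
    congr 1
    ext t
    have : (t : G) * h = ((s⁻¹ * t : T) : G) * (s * h) := by
      rw [hT]; simp [mul_assoc]
    simp only [Set.mem_ofPred_eq, Set.mem_preimage, this, M.mul_mem_cancel_right hs]
  · rw [Set.indicator_of_notMem hh]
    have : {t : T | (t : G) * h ∈ M} = ∅ := by
      ext t
      simp only [Set.mem_ofPred_eq, Set.mem_empty_iff_false, iff_false]
      exact fun ht => hh ⟨t, ht⟩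
    rw [this, measure_empty]

theorem lintegral_unfold (hT : ∀ s t : T, s * t = t * s) (hM : IsOpen (M : Set G))
    (hq : IsQuotientMeasure T dg dt dy) (d : G) {f : G → ENNReal} (hf : Measurable f)
    (hfT : ∀ (t : T) g, f (t * g) = f g) :
    ∫⁻ g in {g | g * d ∈ M}, f g ∂dg = dt {t : T | (t : G) ∈ M} *
      ∫⁻ y, f y.out * (mulSet T M).indicator (fun _ => 1) (y.out * d) ∂dy := by
  have hMd : MeasurableSet {g | g * d ∈ M} := (hM.preimage (continuous_mul_const d)).measurableSet
  have hmeas : Measurable fun y : Quotient (QuotientGroup.rightRel T) =>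
      f y.out * (mulSet T M).indicator (fun _ => (1 : ENNReal)) (y.out * d) := by
    refine measurable_out (f := fun g => f g * (mulSet T M).indicator (fun _ => 1) (g * d))
      (hf.mul ((measurable_const.indicator (measurableSet_mulSet hM)).comp
        (continuous_mul_const d).measurable)) fun t g => ?_
    rw [hfT, mul_assoc, indicator_mulSet_left]
  rw [← lintegral_indicator hMd, hq _ (hf.indicator hMd), ← lintegral_const_mul _ hmeas]
  refine lintegral_congr fun y => ?_
  have h1 : ∀ t : T, ({g | g * d ∈ M} : Set G).indicator f (t * y.out) =
      f y.out * ({t : T | (t : G) * (y.out * d) ∈ M} : Set T).indicator (fun _ => 1) t := by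
    intro t
    have hh : (t : G) * y.out ∈ ({g | g * d ∈ M} : Set G) ↔
        t ∈ ({t : T | (t : G) * (y.out * d) ∈ M} : Set T) := by
      simp [mul_assoc]
    by_cases h : t ∈ ({t : T | (t : G) * (y.out * d) ∈ M} : Set T)
    · rw [Set.indicator_of_mem h, Set.indicator_of_mem (hh.2 h), hfT, mul_one]
    · rw [Set.indicator_of_notMem h, Set.indicator_of_notMem (mt hh.1 h), mul_zero]
  have hS : MeasurableSet {t : T | (t : G) * (y.out * d) ∈ M} :=
    (hM.preimage ((continuous_mul_const _).comp continuous_subtype_val)).measurableSet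
  simp only [h1]
  rw [lintegral_const_mul _ (measurable_const.indicator hS), lintegral_indicator hS,
    setLIntegral_const, one_mul, measure_mul_mem hT]
  by_cases h : y.out * d ∈ mulSet T M
  · simp only [Set.indicator_of_mem h]; ring
  · simp only [Set.indicator_of_notMem h]; ring

theorem measure_inter_ne (hT : ∀ s t : T, s * t = t * s) (hM : IsOpen (M : Set G))
    (hq : IsQuotientMeasure T dg dt dy) (h0 : dg M ≠ 0) (h1 : dg M ≠ ⊤) :
    dt {t : T | (t : G) ∈ M} ≠ 0 ∧ dt {t : T | (t : G) ∈ M} ≠ ⊤ := by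
  have h := lintegral_unfold (dg := dg) (dt := dt) hT hM hq 1 (f := fun _ => 1) measurable_const fun _ _ => rfl
  simp only [mul_one, one_mul, setLIntegral_const] at h
  change dg M = _ at h
  constructor
  · intro hc
    rw [hc, zero_mul] at h
    exact h0 h
  · intro hc
    rw [hc] at h
    rcases eq_or_ne (∫⁻ y : Quotient (QuotientGroup.rightRel T),
      (mulSet T M).indicator (fun _ => (1 : ENNReal)) y.out ∂dy) 0 with h2 | h2
    · rw [h2, mul_zero] at h; exact h0 h
    · rw [ENNReal.top_mul h2] at h; exact h1 h

/-- The linking number of `θ 1_{T M}` with its translate, where `θ` is a quadratic character. -/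
theorem integral_linking (hT : ∀ s t : T, s * t = t * s) (hM : IsOpen (M : Set G))
    (θ : G →* ℂˣ) (hθ : ∀ g, θ g = 1 ∨ θ g = -1) (φ : G → ℂ)
    (hφ : ∀ g, φ g = (mulSet T M).indicator (fun g => ((θ g : ℂˣ) : ℂ)) g) (γ d : G)
    (hfin : ∫⁻ y, torusVolume T M dt γ y.out *
      (mulSet T M).indicator (fun _ => 1) (y.out * d) ∂dy ≠ ⊤) :
    ∫ y, (∫ t : T, φ ((t : G)⁻¹ * γ * t * y.out) ∂dt) * conj (φ (y.out * d)) ∂dy =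
      θ (γ * d) * (∫⁻ y, torusVolume T M dt γ y.out *
      (mulSet T M).indicator (fun _ => 1) (y.out * d) ∂dy).toReal := by
  have hθ2 : ∀ g, ((θ g : ℂˣ) : ℂ) * ((θ g : ℂˣ) : ℂ) = 1 := by
    intro g; rcases hθ g with h | h <;> simp [h]
  have hθc : ∀ g, conj ((θ g : ℂˣ) : ℂ) = ((θ g : ℂˣ) : ℂ) := by
    intro g; rcases hθ g with h | h <;> simp [h]
  set J : Quotient (QuotientGroup.rightRel T) → ENNReal := fun y => torusVolume T M dt γ y.out *
      (mulSet T M).indicator (fun _ => 1) (y.out * d) with hJ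
  have hJm : Measurable J := by
    refine measurable_out (f := fun g => torusVolume T M dt γ g *
      (mulSet T M).indicator (fun _ => 1) (g * d))
      ((measurable_torusVolume hM γ).mul ((measurable_const.indicator
        (measurableSet_mulSet hM)).comp (continuous_mul_const d).measurable)) fun t g => ?_
    rw [torusVolume_mul_left hT, mul_assoc, indicator_mulSet_left]
  have hin : ∀ g, ∫ t : T, φ ((t : G)⁻¹ * γ * t * g) ∂dt =
      θ (γ * g) * (torusVolume T M dt γ g).toReal := by
    intro g
    have hS : MeasurableSet {t : T | γ * t * g ∈ mulSet T M} := by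
      have : Measurable fun t : T => γ * t * g :=
        ((continuous_mul_const g).comp ((continuous_const_mul γ).comp
          continuous_subtype_val)).measurable
      exact this (measurableSet_mulSet hM)
    have h1 : ∀ t : T, φ ((t : G)⁻¹ * γ * t * g) =
        ({t : T | γ * t * g ∈ mulSet T M} : Set T).indicator (fun _ => ((θ (γ * g) : ℂˣ) : ℂ)) t := by
      intro t
      have h2 : (t : G)⁻¹ * γ * t * g ∈ mulSet T M ↔ γ * t * g ∈ mulSet T M := by
        simpa [mul_assoc] using mul_mem_mulSet_left (M := M) t⁻¹ (γ * t * g)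
      have h3 : θ ((t : G)⁻¹ * γ * t * g) = θ (γ * g) := by
        simp only [map_mul, map_inv]
        rw [mul_comm (θ (t : G))⁻¹, mul_assoc (θ γ), inv_mul_cancel, mul_one]
      rw [hφ]
      by_cases h : γ * t * g ∈ mulSet T M
      · rw [Set.indicator_of_mem (h2.2 h), Set.indicator_of_mem (by exact h), h3]
      · rw [Set.indicator_of_notMem (mt h2.1 h), Set.indicator_of_notMem (by exact h)]
    simp only [h1]
    rw [integral_indicator hS, setIntegral_const, Complex.real_smul, mul_comm]
    rfl
  have hout : ∀ y : Quotient (QuotientGroup.rightRel T),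
      (∫ t : T, φ ((t : G)⁻¹ * γ * t * y.out) ∂dt) * conj (φ (y.out * d)) =
        θ (γ * d) * ((J y).toReal : ℂ) := by
    intro y
    rw [hin, hφ, hJ]
    by_cases h : y.out * d ∈ mulSet T M
    · simp only [Set.indicator_of_mem h, hθc, mul_one, map_mul, Units.val_mul]
      linear_combination (θ γ : ℂ) * (θ d : ℂ) * ((torusVolume T M dt γ y.out).toReal : ℂ) *
        hθ2 y.out
    · simp [Set.indicator_of_notMem h]
  simp only [hout]
  rw [integral_const_mul, integral_complex_ofReal, integral_toReal hJm.aemeasurable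
    (ae_lt_top hJm hfin)]

variable [SecondCountableTopology G] [dg.IsMulLeftInvariant]

theorem lintegral_linking (hT : ∀ s t : T, s * t = t * s) (hM : IsOpen (M : Set G))
    (hq : IsQuotientMeasure T dg dt dy) (hMc : IsCompact (M : Set G))
    [IsFiniteMeasureOnCompacts dg] (h0 : dg M ≠ 0)
    {ι : Type*} [Countable ι] (D : ι → T) (hD : ∀ t : T, ∃! i, (((D i)⁻¹ * t : T) : G) ∈ M)
    (γ d : G) :
    ∫⁻ y, torusVolume T M dt γ y.out * (mulSet T M).indicator (fun _ => 1) (y.out * d) ∂dy =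
      ∑' i, ∑' j, dg {g | g * d ∈ M ∧ ((D j)⁻¹ : G) * γ * D i * g ∈ M} := by
  have h1 : dg M ≠ ⊤ := hMc.measure_lt_top.ne
  obtain ⟨hc0, hc1⟩ := measure_inter_ne (dt := dt) hT hM hq h0 h1
  have hMd : MeasurableSet {g | g * d ∈ M} := (hM.preimage (continuous_mul_const d)).measurableSet
  set c := dt {t : T | (t : G) ∈ M} with hc
  have hT0 : MeasurableSet {t : T | (t : G) ∈ M} := (hM.preimage continuous_subtype_val).measurableSet
  have key := lintegral_unfold hT hM hq d (measurable_torusVolume (dt := dt) hM γ)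
    (torusVolume_mul_left (dt := dt) hT γ)
  rw [← hc] at key
  rw [← ENNReal.mul_right_inj hc0 hc1, ← key]
  -- split the torus into cosets of `T ∩ M`
  have hmeasδ : ∀ δ g : G, MeasurableSet {t : T | (t : G) ∈ M ∧ δ * t * g ∈ M} := fun δ g =>
    hT0.inter (hM.preimage ((continuous_mul_const _).comp
      ((continuous_const_mul _).comp continuous_subtype_val))).measurableSet
  have hsplit : ∀ g, torusVolume T M dt γ g =
      ∑' i, ∑' j, dt {t : T | (t : G) ∈ M ∧ ((D j)⁻¹ : G) * γ * D i * t * g ∈ M} := by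
    intro g
    have hU : {t : T | γ * t * g ∈ mulSet T M} = ⋃ p : ι × ι, (fun t => (D p.1)⁻¹ * t) ⁻¹'
        {t : T | (t : G) ∈ M ∧ ((D p.2)⁻¹ : G) * γ * D p.1 * t * g ∈ M} := by
      ext t
      simp only [Set.mem_iUnion, Set.mem_preimage, Set.mem_ofPred_eq, Prod.exists]
      constructor
      · rintro ⟨s, hs⟩
        obtain ⟨i, hi, -⟩ := hD t
        obtain ⟨j, hj, -⟩ := hD s⁻¹
        refine ⟨i, j, hi, ?_⟩
        have := M.mul_mem hj hs
        simpa [mul_assoc] using this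
      · rintro ⟨i, j, -, h⟩
        exact ⟨(D j)⁻¹, by simpa [mul_assoc] using h⟩
    rw [torusVolume, hU, measure_iUnion, ← ENNReal.tsum_prod]
    · simp only [measure_preimage_mul]
    · rintro ⟨i, j⟩ ⟨i', j'⟩ hne
      rw [Function.onFun, Set.disjoint_left]
      rintro t ⟨hi, hj⟩ ⟨hi', hj'⟩
      have e1 : i = i' := (hD t).unique hi hi'
      subst e1
      refine hne ?_
      have e2 : j = j' := by
        refine (hD (D j)).unique (by simp [M.one_mem]) ?_
        have := M.mul_mem hj' (M.inv_mem hj)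
        simpa [mul_assoc] using this
      rw [e2]
    · exact fun p => (hmeasδ _ g).preimage (measurable_const_mul _)
  have hmδ : ∀ δ : G, Measurable fun g => dt {t : T | (t : G) ∈ M ∧ δ * t * g ∈ M} := by
    intro δ
    refine measurable_of_right_invariant hM fun g k hk => ?_
    simp only [← mul_assoc, M.mul_mem_cancel_right hk]
  simp only [hsplit]
  rw [lintegral_tsum fun i => (Measurable.tsum fun j => hmδ _).aemeasurable,
    ← ENNReal.tsum_mul_left]
  refine tsum_congr fun i => ?_
  rw [lintegral_tsum fun j => (hmδ _).aemeasurable, ← ENNReal.tsum_mul_left]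
  refine tsum_congr fun j => ?_
  set δ : G := ((D j)⁻¹ : G) * γ * D i with hδ
  -- Tonelli
  have hMdc : dg {g | g * d ∈ M} < ⊤ := by
    have : {g | g * d ∈ M} = (fun g => g * d⁻¹) '' (M : Set G) := by
      ext g
      constructor
      · exact fun h => ⟨g * d, h, by simp⟩
      · rintro ⟨k, hk, rfl⟩; simpa using hk
    rw [this]
    exact (hMc.image (continuous_mul_const _)).measure_lt_top
  have : IsFiniteMeasure (dg.restrict {g | g * d ∈ M}) := ⟨by simpa using hMdc⟩
  have : IsFiniteMeasure (dt.restrict {t : T | (t : G) ∈ M}) :=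
    ⟨by simpa using lt_top_iff_ne_top.2 hc1⟩
  set S : Set (G × T) := {p | δ * p.2 * p.1 ∈ M} with hS
  have hSm : MeasurableSet S := by
    refine (hM.preimage ?_).measurableSet
    fun_prop
  have hA : ∀ g, dt {t : T | (t : G) ∈ M ∧ δ * t * g ∈ M} =
      ∫⁻ t in {t : T | (t : G) ∈ M}, S.indicator 1 (g, t) ∂dt := by
    intro g
    have hm : MeasurableSet {t : T | δ * t * g ∈ M} := (hM.preimage ((continuous_mul_const _).comp
      ((continuous_const_mul _).comp continuous_subtype_val))).measurableSet
    have : ∀ t : T, S.indicator (1 : G × T → ENNReal) (g, t) =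
      ({t : T | δ * t * g ∈ M} : Set T).indicator 1 t := fun t => rfl
    simp only [this]
    rw [lintegral_indicator_one hm, Measure.restrict_apply hm, Set.inter_comm]
    rfl
  have hB : ∀ t ∈ {t : T | (t : G) ∈ M}, ∫⁻ g in {g | g * d ∈ M}, S.indicator 1 (g, t) ∂dg =
      dg {g | g * d ∈ M ∧ δ * g ∈ M} := by
    intro t ht
    have hm : MeasurableSet {g : G | δ * t * g ∈ M} :=
      (hM.preimage (continuous_const_mul _)).measurableSet
    have h2 : ∀ g : G, S.indicator (1 : G × T → ENNReal) (g, t) =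
      ({g : G | δ * t * g ∈ M} : Set G).indicator 1 g := fun t => rfl
    simp only [h2]
    rw [lintegral_indicator_one hm, Measure.restrict_apply hm,
      ← measure_preimage_mul dg (t : G) {g | g * d ∈ M ∧ δ * g ∈ M}]
    congr 1
    ext g
    simp only [Set.mem_inter_iff, Set.mem_ofPred_eq, Set.mem_preimage, mul_assoc,
      M.mul_mem_cancel_left ht]
    exact and_comm
  simp only [hA]
  have hSa : AEMeasurable (Function.uncurry fun g t => S.indicator (1 : G × T → ENNReal) (g, t))
      ((dg.restrict {g | g * d ∈ M}).prod (dt.restrict {t : T | (t : G) ∈ M})) :=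
    (measurable_one.indicator hSm).aemeasurable
  rw [lintegral_lintegral_swap hSa,
    setLIntegral_congr_fun hT0 hB, setLIntegral_const, mul_comm]

end Unfolding

section ProjectiveGroup

variable {F : Type*} [Field F]

instance instIsTopologicalGroupPGL [TopologicalSpace F] [IsTopologicalRing F] :
    IsTopologicalGroup (PGL(2, F)) :=
  inferInstanceAs (IsTopologicalGroup (GL (Fin 2) F ⧸ Subgroup.center (GL (Fin 2) F)))

theorem continuous_pglMk [TopologicalSpace F] :
    Continuous (Matrix.ProjGenLinGroup.mk : GL (Fin 2) F → PGL(2, F)) :=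
  continuous_quot_mk

theorem isOpenMap_pglMk [TopologicalSpace F] [IsTopologicalRing F] :
    IsOpenMap (Matrix.ProjGenLinGroup.mk : GL (Fin 2) F → PGL(2, F)) :=
  QuotientGroup.isOpenMap_coe (N := Subgroup.center (GL (Fin 2) F))

instance instSecondCountablePGL [TopologicalSpace F] [IsTopologicalRing F]
    [SecondCountableTopology F] : SecondCountableTopology (PGL(2, F)) := by
  have h1 : SecondCountableTopology (Matrix (Fin 2) (Fin 2) F) :=
    inferInstanceAs (SecondCountableTopology (Fin 2 → Fin 2 → F))
  have h3 : SecondCountableTopology (Matrix (Fin 2) (Fin 2) F)ᵐᵒᵖ :=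
    MulOpposite.opHomeomorph.symm.isInducing.secondCountableTopology
  have h2 : SecondCountableTopology (GL (Fin 2) F) :=
    (Units.isEmbedding_embedProduct (M := Matrix (Fin 2) (Fin 2) F)).secondCountableTopology
  exact inferInstanceAs (SecondCountableTopology (GL (Fin 2) F ⧸ Subgroup.center (GL (Fin 2) F)))

@[simp] theorem diagGL_coe (β : Fˣ) : ((diagGL β : GL (Fin 2) F) : Matrix (Fin 2) (Fin 2) F) =
    !![(β : F), 0; 0, 1] := rfl

@[simp] theorem weylGL_coe : ((weylGL : GL (Fin 2) F) : Matrix (Fin 2) (Fin 2) F) =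
    !![(0 : F), -1; 1, 0] := rfl

@[simp] theorem unipGL_coe (x : F) : ((unipGL x : GL (Fin 2) F) : Matrix (Fin 2) (Fin 2) F) =
    !![1, x; 0, 1] := rfl

theorem diagGL_mul (α β : Fˣ) : diagGL (α * β) = diagGL α * diagGL β := by
  ext i j; fin_cases i <;> fin_cases j <;> simp

/-- The homomorphism `β ↦ diag(β, 1)`. -/
def diagHom : Fˣ →* GL (Fin 2) F := MonoidHom.mk' diagGL diagGL_mul

theorem diagGL_inv (β : Fˣ) : diagGL β⁻¹ = (diagGL β)⁻¹ := map_inv diagHom β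

theorem unipGL_neg (x : F) : unipGL (-x) = (unipGL x)⁻¹ := by
  rw [eq_inv_iff_mul_eq_one]
  ext i j; fin_cases i <;> fin_cases j <;> simp

theorem scalarGL_coe (z : Fˣ) : ((Matrix.GeneralLinearGroup.scalar (Fin 2) z : GL (Fin 2) F) :
    Matrix (Fin 2) (Fin 2) F) = !![(z : F), 0; 0, z] := by
  ext i j; fin_cases i <;> fin_cases j <;> simp

theorem mk_weyl_mul_diag (β : Fˣ) :
    Matrix.ProjGenLinGroup.mk weylGL * Matrix.ProjGenLinGroup.mk (diagGL β) =
      Matrix.ProjGenLinGroup.mk (diagGL β⁻¹) * Matrix.ProjGenLinGroup.mk weylGL := by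
  rw [← map_mul, ← map_mul, Matrix.ProjGenLinGroup.mk_eq_mk_iff]
  refine ⟨β⁻¹, ?_⟩
  refine Units.ext ?_
  rw [Units.val_mul, Units.val_mul, Units.val_mul, scalarGL_coe, weylGL_coe, diagGL_coe, diagGL_coe]
  ext i j
  fin_cases i <;> fin_cases j <;> simp

end ProjectiveGroup

section Integral

variable {F : Type*} [Field F] [ValuativeRel F]

variable (F) in
/-- The subgroup `GL₂(𝒪)` of `GL₂(F)`. -/
def gl2Int : Subgroup (GL (Fin 2) F) :=
  (Matrix.GeneralLinearGroup.map (n := Fin 2) (algebraMap 𝒪[F] F)).range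

theorem maxCompact_eq_map : maxCompact F = (gl2Int F).map Matrix.ProjGenLinGroup.mk := by
  rw [maxCompact, gl2Int, MonoidHom.map_range]

theorem mk_mem_maxCompact {k : GL (Fin 2) F} (hk : k ∈ gl2Int F) :
    Matrix.ProjGenLinGroup.mk k ∈ maxCompact F := by
  rw [maxCompact_eq_map]; exact ⟨k, hk, rfl⟩

theorem exists_of_mem_maxCompact {g : PGL(2, F)} (hg : g ∈ maxCompact F) :
    ∃ k ∈ gl2Int F, Matrix.ProjGenLinGroup.mk k = g := by
  rw [maxCompact_eq_map] at hg; exact hg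

variable [TopologicalSpace F] [IsNonarchimedeanLocalField F]

theorem mem_gl2Int_iff {g : GL (Fin 2) F} :
    g ∈ gl2Int F ↔ (∀ i j, g i j ∈ fracIdeal F 0) ∧ ord (g : Matrix (Fin 2) (Fin 2) F).det = 0 := by
  constructor
  · rintro ⟨k, rfl⟩
    refine ⟨fun i j => mem_integer_iff.1 (k i j).2, ?_⟩
    have hd : ((Matrix.GeneralLinearGroup.map (n := Fin 2) (algebraMap 𝒪[F] F) k :
        GL (Fin 2) F) : Matrix (Fin 2) (Fin 2) F).det =
        (((k : Matrix (Fin 2) (Fin 2) 𝒪[F]).det : 𝒪[F]) : F) :=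
      ((algebraMap 𝒪[F] F).map_det _).symm
    have hne : (((k : Matrix (Fin 2) (Fin 2) 𝒪[F]).det : 𝒪[F]) : F) ≠ 0 := by
      rw [← hd]; exact Matrix.GeneralLinearGroup.det_ne_zero _
    rw [hd, ord_eq_zero_iff_isUnit hne]
    exact (Matrix.isUnit_iff_isUnit_det _).1 k.isUnit
  · rintro ⟨h1, h2⟩
    set A : Matrix (Fin 2) (Fin 2) 𝒪[F] := Matrix.of fun i j => ⟨g i j, mem_integer_iff.2 (h1 i j)⟩
      with hA
    have hm : A.map (algebraMap 𝒪[F] F) = g := by ext i j; rfl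
    have hdet : ((A.det : 𝒪[F]) : F) = (g : Matrix (Fin 2) (Fin 2) F).det := by
      rw [← hm]; exact (algebraMap 𝒪[F] F).map_det A
    have hne : ((A.det : 𝒪[F]) : F) ≠ 0 := by
      rw [hdet]; exact Matrix.GeneralLinearGroup.det_ne_zero _
    have hu : IsUnit A.det := by rw [← ord_eq_zero_iff_isUnit hne, hdet, h2]
    refine ⟨Matrix.GeneralLinearGroup.mk'' A hu, ?_⟩
    ext i j
    rfl

theorem isOpen_gl2Int : IsOpen (gl2Int F : Set (GL (Fin 2) F)) := by
  have h : (gl2Int F : Set (GL (Fin 2) F)) = (⋂ i, ⋂ j, {g : GL (Fin 2) F | g i j ∈ fracIdeal F 0}) ∩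
      ({g : GL (Fin 2) F | (g : Matrix (Fin 2) (Fin 2) F).det ∈ (fracIdeal F 0 : Set F) \ (fracIdeal F 1)}) := by
    ext g
    simp only [SetLike.mem_coe, mem_gl2Int_iff, Set.mem_inter_iff, Set.mem_iInter,
      Set.mem_ofPred_eq, Set.mem_sdiff,
      mem_fracIdeal_of_ne (Matrix.GeneralLinearGroup.det_ne_zero g)]
    exact and_congr_right fun _ => by omega
  rw [h]
  refine IsOpen.inter (isOpen_iInter_of_finite fun i => isOpen_iInter_of_finite fun j => ?_) ?_
  · exact (isOpen_fracIdeal 0).preimage (Units.continuous_val.matrix_elem i j)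
  · exact ((isOpen_fracIdeal 0).sdiff (isClosed_fracIdeal 1)).preimage
      Units.continuous_val.matrix_det

theorem isCompact_gl2Int : IsCompact (gl2Int F : Set (GL (Fin 2) F)) := by
  set S : Submonoid (Matrix (Fin 2) (Fin 2) F) :=
    { carrier := {A | ∀ i j, A i j ∈ fracIdeal F 0}
      one_mem' := by
        intro i j
        rw [Matrix.one_apply]
        split_ifs
        · exact Or.inr (by simp)
        · exact zero_mem _
      mul_mem' := by
        intro A B hA hB i j
        rw [Matrix.mul_apply]
        exact sum_mem fun k _ => mul_mem_fracIdeal (hA i k) (hB k j) (by simp) } with hS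
  have h : (gl2Int F : Set (GL (Fin 2) F)) = (S.units : Set (GL (Fin 2) F)) := by
    ext g
    constructor
    · intro hg
      exact ⟨(mem_gl2Int_iff.1 hg).1, (mem_gl2Int_iff.1 (inv_mem hg)).1⟩
    · rintro ⟨h1, h2⟩
      refine mem_gl2Int_iff.2 ⟨h1, ?_⟩
      have hd : ∀ A : Matrix (Fin 2) (Fin 2) F, (∀ i j, A i j ∈ fracIdeal F 0) →
          A.det ∈ fracIdeal F 0 := by
        intro A hA
        rw [Matrix.det_fin_two]
        exact sub_mem (mul_mem_fracIdeal (hA _ _) (hA _ _) (by simp))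
          (mul_mem_fracIdeal (hA _ _) (hA _ _) (by simp))
      have e1 := hd _ h1
      have e2 := hd _ h2
      have h0 : (g : Matrix (Fin 2) (Fin 2) F).det ≠ 0 := Matrix.GeneralLinearGroup.det_ne_zero g
      have h3 : ((g⁻¹ : GL (Fin 2) F) : Matrix (Fin 2) (Fin 2) F).det ≠ 0 :=
        Matrix.GeneralLinearGroup.det_ne_zero g⁻¹
      have h4 : (g : Matrix (Fin 2) (Fin 2) F).det *
          ((g⁻¹ : GL (Fin 2) F) : Matrix (Fin 2) (Fin 2) F).det = 1 := by
        rw [← Matrix.det_mul, Units.mul_inv, Matrix.det_one]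
      have h5 := ord_mul h0 h3
      rw [h4, ord_one] at h5
      have e1' := (mem_fracIdeal_of_ne h0).1 e1
      have e2' := (mem_fracIdeal_of_ne h3).1 e2
      omega
  rw [h]
  refine Submonoid.units_isCompact ?_
  have : (S : Set (Matrix (Fin 2) (Fin 2) F)) =
      Set.pi Set.univ fun _ => Set.pi Set.univ fun _ => (fracIdeal F 0 : Set F) := by
    ext A
    exact ⟨fun h i _ j _ => h i j, fun h i j => h i trivial j trivial⟩
  rw [this]
  exact isCompact_univ_pi fun _ => isCompact_univ_pi fun _ => isCompact_fracIdeal 0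

theorem isOpen_maxCompact : IsOpen (maxCompact F : Set (PGL(2, F))) := by
  rw [maxCompact_eq_map, Subgroup.coe_map]
  exact isOpenMap_pglMk _ isOpen_gl2Int

theorem isCompact_maxCompact : IsCompact (maxCompact F : Set (PGL(2, F))) := by
  rw [maxCompact_eq_map, Subgroup.coe_map]
  exact isCompact_gl2Int.image continuous_pglMk

theorem diagGL_mem_gl2Int {β : Fˣ} (hβ : ord (β : F) = 0) : diagGL β ∈ gl2Int F := by
  rw [mem_gl2Int_iff]
  constructor
  · intro i j
    fin_cases i <;> fin_cases j <;> simp [zero_mem, mem_fracIdeal, hβ]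
  · simp [hβ]

theorem weylGL_mem_gl2Int : (weylGL : GL (Fin 2) F) ∈ gl2Int F := by
  rw [mem_gl2Int_iff]
  constructor
  · intro i j
    fin_cases i <;> fin_cases j <;> simp [zero_mem, mem_fracIdeal]
  · simp

theorem unipGL_mem_gl2Int {x : F} (hx : x ∈ fracIdeal F 0) : unipGL x ∈ gl2Int F := by
  rw [mem_gl2Int_iff]
  constructor
  · intro i j
    fin_cases i <;> fin_cases j <;> simp [zero_mem, mem_fracIdeal]
    simpa [mem_fracIdeal] using hx
  · simp

theorem scalar_mem_gl2Int_iff {z : Fˣ} {k : GL (Fin 2) F} (hk : k ∈ gl2Int F) :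
    k * Matrix.GeneralLinearGroup.scalar (Fin 2) z ∈ gl2Int F ↔ ord (z : F) = 0 := by
  rw [(gl2Int F).mul_mem_cancel_left hk, mem_gl2Int_iff]
  have hdet : ((Matrix.GeneralLinearGroup.scalar (Fin 2) z : GL (Fin 2) F) :
      Matrix (Fin 2) (Fin 2) F).det = (z : F) * z := by
    simp [sq]
  rw [hdet, ord_mul z.ne_zero z.ne_zero]
  constructor
  · rintro ⟨-, h⟩; omega
  · intro h
    refine ⟨fun i j => ?_, by omega⟩
    fin_cases i <;> fin_cases j <;> simp [zero_mem, mem_fracIdeal, h]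

end Integral

section Cartan

variable {F : Type*} [Field F] [ValuativeRel F] [TopologicalSpace F]
  [IsNonarchimedeanLocalField F]

/-- The entries of `A` are integral and one of them is a unit. -/
def IsPrimitive (A : Matrix (Fin 2) (Fin 2) F) : Prop :=
  (∀ i j, A i j ∈ fracIdeal F 0) ∧ ∃ i j, A i j ∉ fracIdeal F 1

theorem matrix_mul_mem {A B : Matrix (Fin 2) (Fin 2) F} {m n : ℤ}
    (hA : ∀ i j, A i j ∈ fracIdeal F m) (hB : ∀ i j, B i j ∈ fracIdeal F n) (i j : Fin 2) :
    (A * B) i j ∈ fracIdeal F (m + n) := by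
  rw [Matrix.mul_apply]
  exact sum_mem fun k _ => mul_mem_fracIdeal (hA i k) (hB k j) le_rfl

theorem gl2Int_mem {k : GL (Fin 2) F} (hk : k ∈ gl2Int F) (i j : Fin 2) : k i j ∈ fracIdeal F 0 :=
  (mem_gl2Int_iff.1 hk).1 i j

theorem IsPrimitive.mul_left {A : Matrix (Fin 2) (Fin 2) F} (hA : IsPrimitive A)
    {k : GL (Fin 2) F} (hk : k ∈ gl2Int F) : IsPrimitive ((k : Matrix (Fin 2) (Fin 2) F) * A) := by
  refine ⟨matrix_mul_mem (n := 0) (gl2Int_mem hk) hA.1, ?_⟩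
  by_contra! h
  obtain ⟨i, j, hij⟩ := hA.2
  have := matrix_mul_mem (gl2Int_mem (inv_mem hk)) h i j
  rw [← Matrix.mul_assoc, Units.inv_mul, Matrix.one_mul] at this
  exact hij this

theorem IsPrimitive.mul_right {A : Matrix (Fin 2) (Fin 2) F} (hA : IsPrimitive A)
    {k : GL (Fin 2) F} (hk : k ∈ gl2Int F) : IsPrimitive (A * (k : Matrix (Fin 2) (Fin 2) F)) := by
  refine ⟨matrix_mul_mem (m := 0) hA.1 (gl2Int_mem hk), ?_⟩
  by_contra! h
  obtain ⟨i, j, hij⟩ := hA.2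
  have := matrix_mul_mem h (gl2Int_mem (inv_mem hk)) i j
  rw [Matrix.mul_assoc, Units.mul_inv, Matrix.mul_one] at this
  exact hij this

theorem IsPrimitive.ord_eq_zero {A : Matrix (Fin 2) (Fin 2) F} (hA : IsPrimitive A) {z : F}
    (hz : z ≠ 0) (hzA : IsPrimitive (z • A)) : ord z = 0 := by
  have key : ∀ (A : Matrix (Fin 2) (Fin 2) F) (z : F), z ≠ 0 → IsPrimitive A →
      IsPrimitive (z • A) → 0 ≤ ord z := by
    intro A z hz hA hzA
    obtain ⟨i, j, hij⟩ := hA.2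
    by_contra! h
    have := hzA.1 i j
    rw [Matrix.smul_apply, smul_eq_mul, mul_mem_fracIdeal_iff hz] at this
    exact hij (fracIdeal_anti (by omega) this)
  refine le_antisymm ?_ (key A z hz hA hzA)
  have := key (z • A) z⁻¹ (inv_ne_zero hz) hzA (by rwa [inv_smul_smul₀ hz])
  rw [ord_inv hz] at this
  omega

theorem isPrimitive_diagGL {β : Fˣ} (hβ : 0 ≤ ord (β : F)) :
    IsPrimitive ((diagGL β : GL (Fin 2) F) : Matrix (Fin 2) (Fin 2) F) := by
  refine ⟨fun i j => ?_, 1, 1, ?_⟩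
  · fin_cases i <;> fin_cases j <;> simp [zero_mem, mem_fracIdeal, hβ]
  · simp [mem_fracIdeal]

theorem exists_cartan_of_lower_right {g : GL (Fin 2) F} (hg : ∀ i j, g i j ∈ fracIdeal F 0)
    (h11 : g 1 1 ∉ fracIdeal F 1) {β : Fˣ}
    (hβ : ord (g : Matrix (Fin 2) (Fin 2) F).det = ord (β : F)) :
    ∃ k₁ ∈ gl2Int F, ∃ k₂ ∈ gl2Int F, g = k₁ * diagGL β * k₂ := by
  have hd : g 1 1 ≠ 0 := fun h => h11 (h ▸ zero_mem _)
  have hd0 : ord (g 1 1) = 0 := by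
    have h0 := (mem_fracIdeal_of_ne hd).1 (hg 1 1)
    rw [mem_fracIdeal_of_ne hd] at h11
    omega
  set Δ := (g : Matrix (Fin 2) (Fin 2) F).det with hΔ
  have hΔ0 : Δ ≠ 0 := Matrix.GeneralLinearGroup.det_ne_zero g
  have hb0 : (β : F) ≠ 0 := β.ne_zero
  have hdet : (!![Δ / (g 1 1 * β), 0; g 1 0, g 1 1] : Matrix (Fin 2) (Fin 2) F).det = Δ / β := by
    rw [Matrix.det_fin_two_of]; field_simp; simp
  have hk2 : (!![Δ / (g 1 1 * β), 0; g 1 0, g 1 1] : Matrix (Fin 2) (Fin 2) F).det ≠ 0 := by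
    rw [hdet]; exact div_ne_zero hΔ0 hb0
  refine ⟨unipGL (g 0 1 / g 1 1), unipGL_mem_gl2Int ?_,
    Matrix.GeneralLinearGroup.mkOfDetNeZero _ hk2, ?_, ?_⟩
  · rw [div_eq_mul_inv]
    exact mul_mem_fracIdeal (n := 0) (hg 0 1) (Or.inr (by rw [ord_inv hd, hd0, neg_zero])) (by simp)
  · rw [mem_gl2Int_iff]
    constructor
    · have e0 : Δ / (g 1 1 * β) ∈ fracIdeal F 0 := Or.inr (by
        rw [ord_div hΔ0 (mul_ne_zero hd hb0), ord_mul hd hb0, hd0, hβ]; simp)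
      intro i j
      fin_cases i <;> fin_cases j
      · exact e0
      · exact zero_mem _
      · exact hg 1 0
      · exact hg 1 1
    · change ord (!![Δ / (g 1 1 * β), 0; g 1 0, g 1 1] : Matrix (Fin 2) (Fin 2) F).det = 0
      rw [hdet, ord_div hΔ0 hb0, hβ, sub_self]
  · refine Units.ext ?_
    rw [Units.val_mul, Units.val_mul, unipGL_coe, diagGL_coe]
    change (g : Matrix (Fin 2) (Fin 2) F) = _ * !![Δ / (g 1 1 * β), 0; g 1 0, g 1 1]
    have hΔ' : Δ = g 0 0 * g 1 1 - g 0 1 * g 1 0 := Matrix.det_fin_two _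
    ext i j
    fin_cases i <;> fin_cases j
    · simp
      field_simp
      rw [hΔ']; ring
    · simp
      field_simp
    · simp
    · simp

theorem exists_cartan {g : GL (Fin 2) F} (hg : IsPrimitive (g : Matrix (Fin 2) (Fin 2) F)) {β : Fˣ}
    (hβ : ord (g : Matrix (Fin 2) (Fin 2) F).det = ord (β : F)) :
    ∃ k₁ ∈ gl2Int F, ∃ k₂ ∈ gl2Int F, g = k₁ * diagGL β * k₂ := by
  have hw := weylGL_mem_gl2Int (F := F)
  have hint : ∀ k₁ ∈ gl2Int F, ∀ k₂ ∈ gl2Int F, (k₁ * g * k₂) 1 1 ∉ fracIdeal F 1 →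
      ∃ k₁ ∈ gl2Int F, ∃ k₂ ∈ gl2Int F, g = k₁ * diagGL β * k₂ := by
    intro k₁ h₁ k₂ h₂ h
    have hdet : ord ((k₁ * g * k₂ : GL (Fin 2) F) : Matrix (Fin 2) (Fin 2) F).det =
        ord (β : F) := by
      rw [Units.val_mul, Units.val_mul, Matrix.det_mul, Matrix.det_mul, ord_mul, ord_mul,
        (mem_gl2Int_iff.1 h₁).2, (mem_gl2Int_iff.1 h₂).2, hβ]
      · simp
      all_goals first
        | exact mul_ne_zero (Matrix.GeneralLinearGroup.det_ne_zero _)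
            (Matrix.GeneralLinearGroup.det_ne_zero _)
        | exact Matrix.GeneralLinearGroup.det_ne_zero _
    obtain ⟨l₁, m₁, l₂, m₂, e⟩ :=
      exists_cartan_of_lower_right ((hg.mul_left h₁).mul_right h₂).1 h hdet
    refine ⟨k₁⁻¹ * l₁, mul_mem (inv_mem h₁) m₁, l₂ * k₂⁻¹, mul_mem m₂ (inv_mem h₂), ?_⟩
    have : g = k₁⁻¹ * (k₁ * g * k₂) * k₂⁻¹ := by group
    rw [this, e]
    group
  obtain ⟨i, j, hij⟩ := hg.2
  fin_cases i <;> fin_cases j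
  · refine hint _ hw _ hw ?_
    rw [Units.val_mul, Units.val_mul, weylGL_coe, Matrix.mul_apply, Fin.sum_univ_two,
      Matrix.mul_apply, Matrix.mul_apply, Fin.sum_univ_two, Fin.sum_univ_two]
    simpa using hij
  · refine hint _ hw 1 (one_mem _) ?_
    simpa [Matrix.mul_apply, Fin.sum_univ_two] using hij
  · refine hint 1 (one_mem _) _ hw ?_
    simpa [Matrix.mul_apply, Fin.sum_univ_two] using hij
  · refine hint 1 (one_mem _) 1 (one_mem _) ?_
    simpa using hij

/-- `g ∈ PGL₂(𝒪) diag(β, 1) PGL₂(𝒪)`. -/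
def InDoubleCoset (β : Fˣ) (g : PGL(2, F)) : Prop :=
  ∃ k₁ ∈ maxCompact F, ∃ k₂ ∈ maxCompact F,
    g = k₁ * Matrix.ProjGenLinGroup.mk (diagGL β) * k₂

theorem InDoubleCoset.inv {β : Fˣ} {g : PGL(2, F)} (h : InDoubleCoset β⁻¹ g) :
    InDoubleCoset β g := by
  obtain ⟨k₁, h₁, k₂, h₂, rfl⟩ := h
  have hw := mk_mem_maxCompact (weylGL_mem_gl2Int (F := F))
  refine ⟨k₁ * Matrix.ProjGenLinGroup.mk weylGL, mul_mem h₁ hw,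
    (Matrix.ProjGenLinGroup.mk weylGL)⁻¹ * k₂, mul_mem (inv_mem hw) h₂, ?_⟩
  have h := mk_weyl_mul_diag β
  rw [← mul_inv_eq_iff_eq_mul] at h
  rw [← h]
  group

theorem inDoubleCoset_iff_of_nonneg {g : GL (Fin 2) F}
    (hg : IsPrimitive (g : Matrix (Fin 2) (Fin 2) F)) {β : Fˣ} (hβ : 0 ≤ ord (β : F)) :
    InDoubleCoset β (Matrix.ProjGenLinGroup.mk g) ↔
      ord (g : Matrix (Fin 2) (Fin 2) F).det = ord (β : F) := by
  constructor
  · rintro ⟨k₁, h₁, k₂, h₂, h⟩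
    obtain ⟨l₁, m₁, rfl⟩ := exists_of_mem_maxCompact h₁
    obtain ⟨l₂, m₂, rfl⟩ := exists_of_mem_maxCompact h₂
    rw [← map_mul, ← map_mul, Matrix.ProjGenLinGroup.mk_eq_mk_iff] at h
    obtain ⟨z, hz⟩ := h
    have hz' : ((l₁ * diagGL β * l₂ : GL (Fin 2) F) : Matrix (Fin 2) (Fin 2) F) =
        (z : F) • (g : Matrix (Fin 2) (Fin 2) F) := by
      rw [← hz, Units.val_mul, scalarGL_coe]
      ext i j; fin_cases i <;> fin_cases j <;> simp [Matrix.mul_apply, mul_comm]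
    have hp : IsPrimitive ((z : F) • (g : Matrix (Fin 2) (Fin 2) F)) := by
      rw [← hz']
      exact ((isPrimitive_diagGL hβ).mul_left m₁).mul_right m₂
    have h0 := hg.ord_eq_zero z.ne_zero hp
    have hd := congrArg Matrix.det hz'
    rw [Matrix.det_smul, Units.val_mul, Units.val_mul, Matrix.det_mul, Matrix.det_mul,
      diagGL_coe] at hd
    have hne : ∀ k : GL (Fin 2) F, (k : Matrix (Fin 2) (Fin 2) F).det ≠ 0 :=
      fun k => Matrix.GeneralLinearGroup.det_ne_zero k
    have hd' := congrArg ord hd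
    simp only [Matrix.det_fin_two_of, mul_one, mul_zero, sub_zero, Fintype.card_fin] at hd'
    rw [ord_mul (mul_ne_zero (hne _) β.ne_zero) (hne _), ord_mul (hne _) β.ne_zero,
      ord_mul (pow_ne_zero _ z.ne_zero) (hne _), ord_pow z.ne_zero, h0,
      (mem_gl2Int_iff.1 m₁).2, (mem_gl2Int_iff.1 m₂).2] at hd'
    simpa using hd'.symm
  · intro h
    obtain ⟨k₁, h₁, k₂, h₂, e⟩ := exists_cartan hg h
    exact ⟨_, mk_mem_maxCompact h₁, _, mk_mem_maxCompact h₂, by rw [← map_mul, ← map_mul, ← e]⟩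

theorem inDoubleCoset_iff {g : GL (Fin 2) F} {z : F} (hz : z ≠ 0)
    (hg : IsPrimitive (z • (g : Matrix (Fin 2) (Fin 2) F))) (β : Fˣ) :
    InDoubleCoset β (Matrix.ProjGenLinGroup.mk g) ↔
      ord (g : Matrix (Fin 2) (Fin 2) F).det + 2 * ord z = |ord (β : F)| := by
  set g' : GL (Fin 2) F := g * Matrix.GeneralLinearGroup.scalar (Fin 2) (Units.mk0 z hz) with hg'
  have hmk : Matrix.ProjGenLinGroup.mk g' = Matrix.ProjGenLinGroup.mk g := by
    rw [hg', map_mul, Matrix.ProjGenLinGroup.mk_scalar, mul_one]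
  have hcoe : (g' : Matrix (Fin 2) (Fin 2) F) = z • (g : Matrix (Fin 2) (Fin 2) F) := by
    rw [hg', Units.val_mul, scalarGL_coe]
    ext i j; fin_cases i <;> fin_cases j <;> simp [Matrix.mul_apply, mul_comm]
  have hdet : ord (g' : Matrix (Fin 2) (Fin 2) F).det =
      ord (g : Matrix (Fin 2) (Fin 2) F).det + 2 * ord z := by
    rw [hcoe, Matrix.det_smul, ord_mul (pow_ne_zero _ hz)
      (Matrix.GeneralLinearGroup.det_ne_zero g), ord_pow hz]
    simp; ring
  rw [← hmk, ← hdet]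
  rw [← hcoe] at hg
  rcases le_total 0 (ord (β : F)) with h | h
  · rw [abs_of_nonneg h]
    exact inDoubleCoset_iff_of_nonneg hg h
  · have hi : ord ((β⁻¹ : Fˣ) : F) = -ord (β : F) := by
      rw [Units.val_inv_eq_inv_val, ord_inv β.ne_zero]
    rw [abs_of_nonpos h, ← hi, ← inDoubleCoset_iff_of_nonneg hg (by omega)]
    exact ⟨fun h => InDoubleCoset.inv (by rwa [inv_inv]), fun h => h.inv⟩

end Cartan

section Volume

variable {F : Type*} [Field F] [ValuativeRel F] [TopologicalSpace F]
  [IsNonarchimedeanLocalField F]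

/-- The image in `PGL₂(F)` of the elements of `GL₂(𝒪)` whose upper right entry lies in `℘ⁿ`. -/
def congruenceSet (F : Type*) [Field F] [ValuativeRel F] [TopologicalSpace F]
    [IsNonarchimedeanLocalField F] (n : ℤ) : Set (PGL(2, F)) :=
  Matrix.ProjGenLinGroup.mk '' {k : GL (Fin 2) F | k ∈ gl2Int F ∧ k 0 1 ∈ fracIdeal F n}

theorem isOpen_congruenceSet (n : ℤ) : IsOpen (congruenceSet F n) :=
  isOpenMap_pglMk _ (isOpen_gl2Int.inter
    ((isOpen_fracIdeal n).preimage (Units.continuous_val.matrix_elem 0 1)))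

theorem congruenceSet_zero : congruenceSet F 0 = maxCompact F := by
  ext g
  constructor
  · rintro ⟨k, ⟨hk, -⟩, rfl⟩
    exact mk_mem_maxCompact hk
  · intro hg
    obtain ⟨k, hk, rfl⟩ := exists_of_mem_maxCompact hg
    exact ⟨k, ⟨hk, gl2Int_mem hk 0 1⟩, rfl⟩

theorem mk_mem_congruenceSet {k : GL (Fin 2) F} (hk : k ∈ gl2Int F) {n : ℤ} :
    Matrix.ProjGenLinGroup.mk k ∈ congruenceSet F n ↔ k 0 1 ∈ fracIdeal F n := by
  constructor
  · rintro ⟨l, ⟨hl, hln⟩, e⟩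
    rw [Matrix.ProjGenLinGroup.mk_eq_mk_iff] at e
    obtain ⟨z, rfl⟩ := e
    have hz := (scalar_mem_gl2Int_iff hl).1 hk
    have : (l * Matrix.GeneralLinearGroup.scalar (Fin 2) z : GL (Fin 2) F) 0 1 = l 0 1 * z := by
      rw [Units.val_mul, scalarGL_coe]; simp [Matrix.mul_apply]
    rw [this, mul_comm, mul_mem_fracIdeal_iff z.ne_zero, hz, sub_zero]
    exact hln
  · exact fun h => ⟨k, ⟨hk, h⟩, rfl⟩

theorem not_both_mem {k : GL (Fin 2) F} (hk : k ∈ gl2Int F) :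
    ¬ (k 0 1 ∈ fracIdeal F 1 ∧ k 1 1 ∈ fracIdeal F 1) := by
  rintro ⟨h1, h2⟩
  have hd : (k : Matrix (Fin 2) (Fin 2) F).det ∈ fracIdeal F 1 := by
    rw [Matrix.det_fin_two]
    exact sub_mem (mul_mem_fracIdeal (gl2Int_mem hk 0 0) h2 (by simp))
      (mul_mem_fracIdeal h1 (gl2Int_mem hk 1 0) (by simp))
  rw [mem_fracIdeal_of_ne (Matrix.GeneralLinearGroup.det_ne_zero k), (mem_gl2Int_iff.1 hk).2] at hd
  omega

theorem ord_lower_right {k : GL (Fin 2) F} (hk : k ∈ gl2Int F) (h : k 1 1 ∉ fracIdeal F 1) :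
    k 1 1 ≠ 0 ∧ ord (k 1 1) = 0 := by
  have hd : k 1 1 ≠ 0 := fun h' => h (h' ▸ zero_mem _)
  have h0 := (mem_fracIdeal_of_ne hd).1 (gl2Int_mem hk 1 1)
  rw [mem_fracIdeal_of_ne hd] at h
  exact ⟨hd, by omega⟩

theorem unip_inv_mul_mem {k : GL (Fin 2) F} (hk : k ∈ gl2Int F) {y : F} (hy : y ∈ fracIdeal F 0)
    {n : ℤ} : (Matrix.ProjGenLinGroup.mk (unipGL y))⁻¹ * Matrix.ProjGenLinGroup.mk k ∈
      congruenceSet F n ↔ -(y * k 1 1) + k 0 1 ∈ fracIdeal F n := by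
  rw [← map_inv, ← map_mul, mk_mem_congruenceSet (mul_mem (inv_mem (unipGL_mem_gl2Int hy)) hk),
    ← unipGL_neg, Units.val_mul, unipGL_coe, Matrix.mul_apply, Fin.sum_univ_two]
  have : !![1, -y; 0, 1] 0 0 * k 0 1 + !![1, -y; 0, 1] 0 1 * k 1 1 = -(y * k 1 1) + k 0 1 := by
    simp; ring
  rw [this]

theorem weyl_inv_mul_mem {k : GL (Fin 2) F} (hk : k ∈ gl2Int F) {n : ℤ} :
    (Matrix.ProjGenLinGroup.mk weylGL)⁻¹ * Matrix.ProjGenLinGroup.mk k ∈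
      congruenceSet F n ↔ k 1 1 ∈ fracIdeal F n := by
  have hw : ((weylGL⁻¹ : GL (Fin 2) F) : Matrix (Fin 2) (Fin 2) F) = !![(0 : F), 1; -1, 0] := by
    have : (weylGL⁻¹ : GL (Fin 2) F) =
        Matrix.GeneralLinearGroup.mkOfDetNeZero !![(0 : F), 1; -1, 0] (by simp) := by
      refine inv_eq_of_mul_eq_one_right (Units.ext ?_)
      change !![(0 : F), -1; 1, 0] * !![(0 : F), 1; -1, 0] = 1
      ext i j; fin_cases i <;> fin_cases j <;> simp
    rw [this]; rfl
  rw [← map_inv, ← map_mul, mk_mem_congruenceSet (mul_mem (inv_mem weylGL_mem_gl2Int) hk),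
    Units.val_mul, hw, Matrix.mul_apply, Fin.sum_univ_two]
  simp

/-- A unipotent translate of the upper right entry, in terms of the residue class of the
quotient of the entries of the right column. -/
theorem unip_mem_iff {k : GL (Fin 2) F} (hk : k ∈ gl2Int F) (h : k 1 1 ∉ fracIdeal F 1) {α : F}
    (hα : α ≠ 0) (r : 𝓀[F]) :
    -(α * resLift F r * k 1 1) + k 0 1 ∈ fracIdeal F (ord α + 1) ↔
      -resLift F r + k 0 1 / (α * k 1 1) ∈ fracIdeal F 1 := by
  obtain ⟨hd, hd0⟩ := ord_lower_right hk h
  have : -(α * resLift F r * k 1 1) + k 0 1 =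
      (α * k 1 1) * (-resLift F r + k 0 1 / (α * k 1 1)) := by
    field_simp
  rw [this, mul_mem_fracIdeal_iff (mul_ne_zero hα hd), ord_mul hα hd, hd0]
  simp

variable (μ : Measure (PGL(2, F))) [μ.IsMulLeftInvariant]

theorem measure_congruenceSet_succ {n : ℤ} (hn : 1 ≤ n) :
    μ (congruenceSet F n) = resCard F * μ (congruenceSet F (n + 1)) := by
  obtain ⟨α, hα, hαn⟩ := exists_ord_eq (F := F) n
  have hy : ∀ r, α * resLift F r ∈ fracIdeal F 0 := fun r =>
    mul_mem_fracIdeal (m := n) (Or.inr hαn.ge) (resLift_mem r) (by omega)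
  have hunit : ∀ k ∈ gl2Int F, k 0 1 ∈ fracIdeal F n → k 1 1 ∉ fracIdeal F 1 :=
    fun k hk h h' => not_both_mem hk ⟨fracIdeal_anti hn h, h'⟩
  have hback : ∀ x, ∀ r : 𝓀[F], (Matrix.ProjGenLinGroup.mk (unipGL (α * resLift F r)))⁻¹ * x ∈
      congruenceSet F (n + 1) → ∃ k ∈ gl2Int F, k 0 1 ∈ fracIdeal F n ∧
        Matrix.ProjGenLinGroup.mk k = x := by
    rintro x r ⟨k, ⟨hk, hkn⟩, e⟩
    refine ⟨unipGL (α * resLift F r) * k, mul_mem (unipGL_mem_gl2Int (hy r)) hk, ?_, ?_⟩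
    · rw [Units.val_mul, unipGL_coe, Matrix.mul_apply, Fin.sum_univ_two]
      simp only [Matrix.of_apply, Matrix.cons_val', Matrix.cons_val_zero, Matrix.cons_val_one,
        one_mul]
      exact add_mem (fracIdeal_anti (by omega) hkn)
        (mul_mem_fracIdeal (mul_mem_fracIdeal (m := n) (Or.inr hαn.ge) (resLift_mem r) le_rfl)
          (gl2Int_mem hk 1 1) (by simp))
    · rw [map_mul, e, mul_inv_cancel_left]
  refine measure_eq_card_mul μ _ _
    (fun r : 𝓀[F] => Matrix.ProjGenLinGroup.mk (unipGL (α * resLift F r)))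
    (isOpen_congruenceSet _).measurableSet (fun x => ⟨?_, ?_⟩) ?_
  · rintro ⟨k, ⟨hk, hkn⟩, rfl⟩
    have hu := hunit k hk hkn
    obtain ⟨hd, hd0⟩ := ord_lower_right hk hu
    have : k 0 1 / (α * k 1 1) ∈ fracIdeal F 0 := by
      rw [div_eq_inv_mul, mul_mem_fracIdeal_iff (inv_ne_zero (mul_ne_zero hα hd)),
        ord_inv (mul_ne_zero hα hd), ord_mul hα hd, hd0, hαn]
      simpa using hkn
    obtain ⟨r, hr⟩ := exists_sub_resLift_mem this
    refine ⟨r, ?_⟩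
    rw [unip_inv_mul_mem hk (hy r), ← hαn, unip_mem_iff hk hu hα]
    exact hr
  · rintro ⟨r, hr⟩
    obtain ⟨k, hk, hkn, rfl⟩ := hback x r hr
    exact (mk_mem_congruenceSet hk).2 hkn
  · intro r s x hr hs
    obtain ⟨k, hk, hkn, rfl⟩ := hback x r hr
    have hu := hunit k hk hkn
    rw [unip_inv_mul_mem hk (hy _), ← hαn, unip_mem_iff hk hu hα] at hr hs
    exact eq_of_sub_resLift_mem hr hs

theorem measure_congruenceSet_zero :
    μ (maxCompact F) = (resCard F + 1 : ℕ) * μ (congruenceSet F 1) := by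
  have hcard : resCard F + 1 = Nat.card (Option 𝓀[F]) := Finite.card_option.symm
  rw [hcard]
  have hw := mk_mem_maxCompact (weylGL_mem_gl2Int (F := F))
  have hsub : congruenceSet F 1 ⊆ maxCompact F := by
    rintro _ ⟨k, ⟨hk, -⟩, rfl⟩; exact mk_mem_maxCompact hk
  set g : Option 𝓀[F] → PGL(2, F) := fun o => o.elim (Matrix.ProjGenLinGroup.mk weylGL)
    fun r => Matrix.ProjGenLinGroup.mk (unipGL (resLift F r)) with hg
  have hgm : ∀ o, g o ∈ maxCompact F := by
    rintro (_ | r)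
    · exact hw
    · exact mk_mem_maxCompact (unipGL_mem_gl2Int (resLift_mem r))
  have key : ∀ k ∈ gl2Int F, ∀ r : 𝓀[F], (g (some r))⁻¹ * Matrix.ProjGenLinGroup.mk k ∈
      congruenceSet F 1 ↔ k 1 1 ∉ fracIdeal F 1 ∧ -resLift F r + k 0 1 / k 1 1 ∈ fracIdeal F 1 := by
    intro k hk r
    have h1 := unip_inv_mul_mem hk (resLift_mem r) (n := 1)
    by_cases h : k 1 1 ∈ fracIdeal F 1
    · rw [show (g (some r)) = Matrix.ProjGenLinGroup.mk (unipGL (resLift F r)) from rfl, h1]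
      simp only [h, not_true_eq_false, false_and, iff_false]
      intro h2
      have h3 : resLift F r * k 1 1 ∈ fracIdeal F 1 :=
        mul_mem_fracIdeal (resLift_mem r) h (by simp)
      exact not_both_mem hk ⟨by simpa using add_mem h3 h2, h⟩
    · rw [show (g (some r)) = Matrix.ProjGenLinGroup.mk (unipGL (resLift F r)) from rfl, h1]
      have := unip_mem_iff hk h one_ne_zero r
      simp only [one_mul, ord_one, zero_add] at this
      rw [this]
      simp [h]
  refine measure_eq_card_mul μ _ _ g (isOpen_congruenceSet _).measurableSet
    (fun x => ⟨fun hx => ?_, ?_⟩) ?_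
  · obtain ⟨k, hk, rfl⟩ := exists_of_mem_maxCompact hx
    by_cases h : k 1 1 ∈ fracIdeal F 1
    · exact ⟨none, (weyl_inv_mul_mem hk).2 h⟩
    · obtain ⟨hd, hd0⟩ := ord_lower_right hk h
      have : k 0 1 / k 1 1 ∈ fracIdeal F 0 := by
        rw [div_eq_inv_mul, mul_mem_fracIdeal_iff (inv_ne_zero hd), ord_inv hd, hd0]
        simpa using gl2Int_mem hk 0 1
      obtain ⟨r, hr⟩ := exists_sub_resLift_mem this
      exact ⟨some r, (key k hk r).2 ⟨h, hr⟩⟩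
  · rintro ⟨o, ho⟩
    have := mul_mem (hgm o) (hsub ho)
    rwa [mul_inv_cancel_left] at this
  · intro o o' x ho ho'
    have hx : x ∈ maxCompact F := by
      have := mul_mem (hgm o) (hsub ho)
      rwa [mul_inv_cancel_left] at this
    obtain ⟨k, hk, rfl⟩ := exists_of_mem_maxCompact hx
    have hnone : (g none)⁻¹ * Matrix.ProjGenLinGroup.mk k ∈ congruenceSet F 1 ↔
      k 1 1 ∈ fracIdeal F 1 := weyl_inv_mul_mem hk
    rcases o with _ | r <;> rcases o' with _ | s
    · rfl
    · exact absurd (hnone.1 ho) ((key k hk s).1 ho').1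
    · exact absurd (hnone.1 ho') ((key k hk r).1 ho).1
    · rw [eq_of_sub_resLift_mem ((key k hk r).1 ho).2 ((key k hk s).1 ho').2]

variable (F) in
/-- The inverse of the index in `GL₂(𝒪)` of the elements with upper right entry in `℘ⁿ`. -/
def cosetWeight (n : ℕ) : ℝ :=
  if n = 0 then 1 else ((resCard F : ℝ) ^ n)⁻¹ / (1 + (resCard F : ℝ)⁻¹)

theorem measureReal_congruenceSet (n : ℕ) :
    μ.real (congruenceSet F n) = cosetWeight F n * μ.real (maxCompact F) := by
  have hq := resCard_pos F
  cases n with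
  | zero => simp [cosetWeight, congruenceSet_zero]
  | succ n =>
    have h : μ.real (congruenceSet F (n + 1)) =
        ((resCard F : ℝ) ^ n)⁻¹ * μ.real (congruenceSet F 1) := by
      induction n with
      | zero => simp
      | succ n ih =>
        have h1 := measure_congruenceSet_succ μ (n := n + 1) (by omega)
        rw [Measure.real, h1, ENNReal.toReal_mul, ENNReal.toReal_natCast] at ih
        have : μ.real (congruenceSet F ((n + 1 : ℕ) + 1)) =
          (μ (congruenceSet F (n + 1 + 1))).toReal := by push_cast; rfl
        rw [this, pow_succ, mul_inv, mul_right_comm, ← ih]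
        field_simp
    have h0 : μ.real (maxCompact F) = (resCard F + 1) * μ.real (congruenceSet F 1) := by
      rw [Measure.real, measure_congruenceSet_zero, ENNReal.toReal_mul, ENNReal.toReal_natCast]
      push_cast; rfl
    push_cast
    rw [h, h0, cosetWeight, if_neg (by omega), pow_succ]
    field_simp

end Volume

section LinkVolume

variable {F : Type*} [Field F] [ValuativeRel F] [TopologicalSpace F]
  [IsNonarchimedeanLocalField F]

/-- `M ∩ d M d⁻¹` with `M = PGL₂(𝒪)`, `d = diag(β, 1)`. -/
def conjSet (β : Fˣ) : Set (PGL(2, F)) :=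
  {h | h ∈ maxCompact F ∧ (Matrix.ProjGenLinGroup.mk (diagGL β))⁻¹ * h *
    Matrix.ProjGenLinGroup.mk (diagGL β) ∈ maxCompact F}

theorem conjSet_eq {β : Fˣ} (hβ : 0 ≤ ord (β : F)) : conjSet β = congruenceSet F (ord (β : F)) := by
  have hco : ∀ k : GL (Fin 2) F, (((diagGL β)⁻¹ * k * diagGL β : GL (Fin 2) F) :
      Matrix (Fin 2) (Fin 2) F) = !![k 0 0, (β : F)⁻¹ * k 0 1; k 1 0 * β, k 1 1] := by
    intro k
    rw [← diagGL_inv, Units.val_mul, Units.val_mul, diagGL_coe, diagGL_coe]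
    conv_lhs => rw [Matrix.eta_fin_two (k : Matrix (Fin 2) (Fin 2) F)]
    ext i j
    fin_cases i <;> fin_cases j <;> simp [mul_right_comm]
  have hdet : ∀ k : GL (Fin 2) F, (((diagGL β)⁻¹ * k * diagGL β : GL (Fin 2) F) :
      Matrix (Fin 2) (Fin 2) F).det = (k : Matrix (Fin 2) (Fin 2) F).det := by
    intro k
    rw [hco, Matrix.det_fin_two_of, Matrix.det_fin_two]
    field_simp
  have hb : ∀ x : F, (β : F)⁻¹ * x ∈ fracIdeal F 0 ↔ x ∈ fracIdeal F (ord (β : F)) := by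
    intro x
    rw [mul_mem_fracIdeal_iff (inv_ne_zero β.ne_zero), ord_inv β.ne_zero]
    simp
  ext h
  constructor
  · rintro ⟨h1, h2⟩
    obtain ⟨k, hk, rfl⟩ := exists_of_mem_maxCompact h1
    rw [← map_inv, ← map_mul, ← map_mul] at h2
    obtain ⟨l, hl, e⟩ := exists_of_mem_maxCompact h2
    rw [mk_mem_congruenceSet hk]
    rw [Matrix.ProjGenLinGroup.mk_eq_mk_iff] at e
    obtain ⟨z, hz⟩ := e
    have hd := congrArg (fun g : GL (Fin 2) F => ord (g : Matrix (Fin 2) (Fin 2) F).det) hz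
    simp only [hdet] at hd
    rw [Units.val_mul, Matrix.det_mul, scalarGL_coe, Matrix.det_fin_two_of,
      ord_mul (Matrix.GeneralLinearGroup.det_ne_zero l) (by simp), (mem_gl2Int_iff.1 hl).2,
      (mem_gl2Int_iff.1 hk).2, mul_zero, sub_zero, ord_mul z.ne_zero z.ne_zero] at hd
    have hm : (diagGL β)⁻¹ * k * diagGL β ∈ gl2Int F := by
      rw [← hz, scalar_mem_gl2Int_iff hl]; omega
    have := gl2Int_mem hm 0 1
    rw [hco] at this
    exact (hb _).1 this
  · rintro ⟨k, ⟨hk, hkn⟩, rfl⟩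
    refine ⟨mk_mem_maxCompact hk, ?_⟩
    rw [← map_inv, ← map_mul, ← map_mul]
    refine mk_mem_maxCompact (mem_gl2Int_iff.2 ⟨fun i j => ?_, ?_⟩)
    · rw [hco]
      fin_cases i <;> fin_cases j
      · exact gl2Int_mem hk 0 0
      · exact (hb _).2 hkn
      · exact mul_mem_fracIdeal (gl2Int_mem hk 1 0) (Or.inr hβ) (by simp)
      · exact gl2Int_mem hk 1 1
    · rw [hdet]; exact (mem_gl2Int_iff.1 hk).2

theorem isOpen_conjSet (β : Fˣ) : IsOpen (conjSet β) :=
  isOpen_maxCompact.inter (isOpen_maxCompact.preimage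
    ((continuous_mul_const _).comp (continuous_const_mul _)))

variable (dg : Measure (PGL(2, F))) [dg.IsMulLeftInvariant]

theorem measureReal_conjSet (β : Fˣ) :
    dg.real (conjSet β) = cosetWeight F (ord (β : F)).natAbs * dg.real (maxCompact F) := by
  rcases le_total 0 (ord (β : F)) with h | h
  · rw [conjSet_eq h, ← measureReal_congruenceSet, Int.natAbs_of_nonneg h]
  · set w : PGL(2, F) := Matrix.ProjGenLinGroup.mk weylGL with hw
    have hwM : w ∈ maxCompact F := mk_mem_maxCompact weylGL_mem_gl2Int
    set c : PGL(2, F) →ₙ* PGL(2, F) :=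
      { toFun := fun h => w⁻¹ * h * w
        map_mul' := by intro a b; group } with hc
    have hcc : Continuous c := (continuous_mul_const w).comp (continuous_const_mul w⁻¹)
    have hinv : (dg.map c).IsMulLeftInvariant :=
      isMulLeftInvariant_map c hcc.measurable fun h => ⟨w * h * w⁻¹, by simp [hc, mul_assoc]⟩
    have hi : ord ((β⁻¹ : Fˣ) : F) = -ord (β : F) := by
      rw [Units.val_inv_eq_inv_val, ord_inv β.ne_zero]
    have h1 : conjSet β = c ⁻¹' conjSet β⁻¹ := by
      have e := mk_weyl_mul_diag β
      rw [← hw] at e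
      set d := Matrix.ProjGenLinGroup.mk (diagGL β) with hd
      have hd' : Matrix.ProjGenLinGroup.mk (diagGL β⁻¹) = d⁻¹ := by rw [diagGL_inv, map_inv]
      rw [hd'] at e
      have e1 : d⁻¹ = w * d * w⁻¹ := by rw [e]; group
      have e2 : d = w * d⁻¹ * w⁻¹ :=
        calc d = (w * d * w⁻¹)⁻¹ := by rw [← e1, inv_inv]
          _ = w * d⁻¹ * w⁻¹ := by group
      have e3 : ∀ h, d⁻¹ * h * d = w * (d * (w⁻¹ * h * w) * d⁻¹) * w⁻¹ := fun h =>
        calc d⁻¹ * h * d = (w * d * w⁻¹) * h * (w * d⁻¹ * w⁻¹) := by rw [← e1, ← e2]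
          _ = w * (d * (w⁻¹ * h * w) * d⁻¹) * w⁻¹ := by group
      ext h
      simp only [conjSet, Set.mem_ofPred_eq, Set.mem_preimage, hd', inv_inv]
      rw [e3, (maxCompact F).mul_mem_cancel_right (inv_mem hwM),
        (maxCompact F).mul_mem_cancel_left hwM]
      refine and_congr_left fun _ => ?_
      change _ ↔ w⁻¹ * h * w ∈ maxCompact F
      rw [(maxCompact F).mul_mem_cancel_right hwM, (maxCompact F).mul_mem_cancel_left (inv_mem hwM)]
    have h2 : (maxCompact F : Set (PGL(2, F))) = c ⁻¹' maxCompact F := by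
      ext h
      change _ ↔ w⁻¹ * h * w ∈ maxCompact F
      rw [(maxCompact F).mul_mem_cancel_right hwM, (maxCompact F).mul_mem_cancel_left (inv_mem hwM)]
      rfl
    have h3 := measureReal_congruenceSet (dg.map c) (ord (β : F)).natAbs
    rw [show (((ord (β : F)).natAbs : ℕ) : ℤ) = ord ((β⁻¹ : Fˣ) : F) by rw [hi]; omega,
      ← conjSet_eq (by omega), map_measureReal_apply hcc.measurable (isOpen_conjSet _).measurableSet,
      map_measureReal_apply hcc.measurable isOpen_maxCompact.measurableSet, ← h1, ← h2] at h3
    exact h3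

open Classical in
theorem measure_link [IsFiniteMeasureOnCompacts dg] (β : Fˣ) (δ : PGL(2, F)) :
    dg {g | g * Matrix.ProjGenLinGroup.mk (diagGL β) ∈ maxCompact F ∧ δ * g ∈ maxCompact F} =
      if InDoubleCoset β δ then ENNReal.ofReal
        (cosetWeight F (ord (β : F)).natAbs * dg.real (maxCompact F)) else 0 := by
  set d := Matrix.ProjGenLinGroup.mk (diagGL β) with hd
  split_ifs with h
  · obtain ⟨k₁, h₁, k₂, h₂, e⟩ := h
    rw [← measureReal_conjSet, Measure.real, ENNReal.ofReal_toReal,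
      ← measure_preimage_mul dg (d * k₂) (conjSet β)]
    · congr 1
      ext g
      simp only [conjSet, Set.mem_ofPred_eq, Set.mem_preimage, ← hd, e]
      rw [mul_assoc k₁, mul_assoc k₁, (maxCompact F).mul_mem_cancel_left h₁, and_comm]
      have : d⁻¹ * (d * k₂ * g) * d = k₂ * (g * d) := by group
      rw [this, (maxCompact F).mul_mem_cancel_left h₂]
    · exact (lt_of_le_of_lt (measure_mono fun _ h => h.1)
        isCompact_maxCompact.measure_lt_top).ne
  · have : {g | g * d ∈ maxCompact F ∧ δ * g ∈ maxCompact F} = ∅ := by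
      ext g
      simp only [Set.mem_ofPred_eq, Set.mem_empty_iff_false, iff_false]
      rintro ⟨h1, h2⟩
      exact h ⟨δ * g, h2, (g * d)⁻¹, inv_mem h1, by rw [← hd]; group⟩
    rw [this, measure_empty]

end LinkVolume

section QuadraticCharacter

variable {F : Type*} [Field F]

/-- The character `mk g ↦ χ₁ (det g)` of `PGL₂(F)` attached to a quadratic character `χ₁`. -/
def detChar (χ₁ : Fˣ →* ℂˣ) (h : χ₁ ^ 2 = 1) : PGL(2, F) →* ℂˣ :=
  QuotientGroup.lift (Subgroup.center (GL (Fin 2) F)) (χ₁.comp Matrix.GeneralLinearGroup.det) (by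
    intro g hg
    rw [Matrix.GeneralLinearGroup.center_eq_range_scalar] at hg
    obtain ⟨z, rfl⟩ := hg
    have hd : Matrix.GeneralLinearGroup.det (Matrix.GeneralLinearGroup.scalar (Fin 2) z) =
        z ^ 2 := by
      ext; simp
    rw [MonoidHom.mem_ker, MonoidHom.comp_apply, hd, map_pow]
    exact DFunLike.congr_fun h z)

theorem detChar_mk (χ₁ : Fˣ →* ℂˣ) (h : χ₁ ^ 2 = 1) (g : GL (Fin 2) F) :
    detChar χ₁ h (Matrix.ProjGenLinGroup.mk g) = χ₁ (Matrix.GeneralLinearGroup.det g) := rfl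

theorem quadratic_values {χ₁ : Fˣ →* ℂˣ} (h : χ₁ ^ 2 = 1) (a : Fˣ) : χ₁ a = 1 ∨ χ₁ a = -1 := by
  have h1 : χ₁ a ^ 2 = 1 := DFunLike.congr_fun h a
  have h2 : ((χ₁ a : ℂˣ) : ℂ) ^ 2 = 1 := by rw [← Units.val_pow_eq_pow_val, h1, Units.val_one]
  rcases mul_self_eq_one_iff.1 ((sq _).symm.trans h2) with h3 | h3
  · exact Or.inl (Units.ext h3)
  · exact Or.inr (Units.ext (by simpa using h3))

theorem detChar_values (χ₁ : Fˣ →* ℂˣ) (h : χ₁ ^ 2 = 1) (g : PGL(2, F)) :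
    detChar χ₁ h g = 1 ∨ detChar χ₁ h g = -1 := by
  induction g using Matrix.ProjGenLinGroup.induction_on with | mk g =>
  exact quadratic_values h _

end QuadraticCharacter

theorem torus_comm {F : Type*} [Field F] {K : Type*} [CommRing K] [Algebra F K]
    {ι : K →ₐ[F] Matrix (Fin 2) (Fin 2) F} (s t : torus ι) : s * t = t * s := by
  obtain ⟨_, s, rfl⟩ := s
  obtain ⟨_, t, rfl⟩ := t
  ext
  simp only [Subgroup.coe_mul]
  rw [← map_mul, mul_comm, map_mul]

section Linking

variable {F : Type*} [Field F] [ValuativeRel F] [TopologicalSpace F]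
  [IsNonarchimedeanLocalField F]

/-- A character of `F^×` is unramified. -/
def IsUnram (χ₁ : Fˣ →* ℂˣ) : Prop := ∀ a : Fˣ, ord (a : F) = 0 → χ₁ a = 1

theorem detChar_maxCompact {χ₁ : Fˣ →* ℂˣ} (h : χ₁ ^ 2 = 1) (hu : IsUnram χ₁) {g : PGL(2, F)}
    (hg : g ∈ maxCompact F) : detChar χ₁ h g = 1 := by
  obtain ⟨k, hk, rfl⟩ := exists_of_mem_maxCompact hg
  exact hu _ (mem_gl2Int_iff.1 hk).2

variable {K : Type*} [CommRing K] [Algebra F K] {ι : K →ₐ[F] Matrix (Fin 2) (Fin 2) F}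

theorem sphericalFn_eq {χ : Kˣ →* ℂˣ} {χ₁ : Fˣ →* ℂˣ} (h : χ₁ ^ 2 = 1) (hu : IsUnram χ₁)
    (hχ : χ = χ₁.comp (normHom ι)) (g : PGL(2, F)) :
    sphericalFn ι χ g = (mulSet (torus ι) (maxCompact F)).indicator
      (fun g => ((detChar χ₁ h g : ℂˣ) : ℂ)) g := by
  have hiff : (∃ t : Kˣ, ∃ k ∈ maxCompact F, g = torusHom ι t * k) ↔
      g ∈ mulSet (torus ι) (maxCompact F) := by
    constructor
    · rintro ⟨t, k, hk, rfl⟩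
      exact ⟨⟨torusHom ι t, t, rfl⟩⁻¹, by simpa using hk⟩
    · rintro ⟨⟨_, t, rfl⟩, hs⟩
      exact ⟨t⁻¹, _, hs, by simp⟩
  by_cases hg : g ∈ mulSet (torus ι) (maxCompact F)
  · rw [Set.indicator_of_mem hg]
    have hex := hiff.2 hg
    rw [sphericalFn, dif_pos hex]
    obtain ⟨k, hk, e⟩ := hex.choose_spec
    congr 1
    conv_rhs => rw [e, map_mul, detChar_maxCompact h hu hk, mul_one]
    rw [hχ]
    rfl
  · rw [Set.indicator_of_notMem hg, sphericalFn, dif_neg (mt hiff.1 hg)]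

variable {dg : Measure (PGL(2, F))} [dg.IsHaarMeasure] {dt : Measure (torus ι)} [dt.IsHaarMeasure]
  {dy : Measure (Quotient (QuotientGroup.rightRel (torus ι)))}

variable (dg) in
theorem measure_maxCompact_ne_zero : dg (maxCompact F) ≠ 0 :=
  (isOpen_maxCompact.measure_pos dg ⟨1, one_mem _⟩).ne'

open Classical in
theorem linkingNumber_eq {χ : Kˣ →* ℂˣ} {χ₁ : Fˣ →* ℂˣ} (h : χ₁ ^ 2 = 1) (hu : IsUnram χ₁)
    (hχ : χ = χ₁.comp (normHom ι)) (hq : IsQuotientMeasure (torus ι) dg dt dy)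
    {I : Type*} [Countable I] (D : I → torus ι)
    (hD : ∀ t : torus ι, ∃! i, (((D i)⁻¹ * t : torus ι) : PGL(2, F)) ∈ maxCompact F)
    (γ : GL (Fin 2) F) (β : Fˣ) (S : Finset (I × I))
    (hS : ∀ i j, InDoubleCoset β (((D j)⁻¹ : PGL(2, F)) * Matrix.ProjGenLinGroup.mk γ * D i) ↔
      (i, j) ∈ S) :
    linkingNumber ι dt dy (sphericalFn ι χ) (translate β (sphericalFn ι χ))
        (Matrix.ProjGenLinGroup.mk γ) =
      χ₁ (Matrix.GeneralLinearGroup.det γ) * χ₁ β *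
        (S.card * (cosetWeight F (ord (β : F)).natAbs * dg.real (maxCompact F)) : ℝ) := by
  have hw : 0 ≤ cosetWeight F (ord (β : F)).natAbs * dg.real (maxCompact F) := by
    refine mul_nonneg ?_ measureReal_nonneg
    rw [cosetWeight]
    split_ifs <;> positivity
  have hsum := lintegral_linking (dg := dg) (dt := dt) (T := torus ι) (M := maxCompact F) torus_comm
    isOpen_maxCompact hq isCompact_maxCompact (measure_maxCompact_ne_zero dg) D hD
    (Matrix.ProjGenLinGroup.mk γ) (Matrix.ProjGenLinGroup.mk (diagGL β))
  simp only [measure_link, hS] at hsum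
  rw [← ENNReal.tsum_prod (f := fun i j => if (i, j) ∈ S then ENNReal.ofReal
      (cosetWeight F (ord (β : F)).natAbs * dg.real (maxCompact F)) else 0),
    tsum_eq_sum (s := S) (fun p hp => if_neg hp), Finset.sum_congr rfl (fun p hp => if_pos hp),
    Finset.sum_const, nsmul_eq_mul] at hsum
  have hfin : ∫⁻ y, torusVolume (torus ι) (maxCompact F) dt (Matrix.ProjGenLinGroup.mk γ) y.out *
      (mulSet (torus ι) (maxCompact F)).indicator (fun _ => 1)
        (y.out * Matrix.ProjGenLinGroup.mk (diagGL β)) ∂dy ≠ ⊤ := by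
    rw [hsum]
    exact ENNReal.mul_ne_top (ENNReal.natCast_ne_top _) ENNReal.ofReal_ne_top
  have key := integral_linking torus_comm isOpen_maxCompact (detChar χ₁ h) (detChar_values χ₁ h)
    (sphericalFn ι χ) (sphericalFn_eq h hu hχ) (Matrix.ProjGenLinGroup.mk γ)
    (Matrix.ProjGenLinGroup.mk (diagGL β)) hfin
  rw [hsum, ENNReal.toReal_mul, ENNReal.toReal_natCast, ENNReal.toReal_ofReal hw] at key
  have hdet : Matrix.GeneralLinearGroup.det (diagGL β) = β := by ext; simp
  rw [map_mul, detChar_mk, detChar_mk, hdet, Units.val_mul] at key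
  exact key

end Linking

section Count

/-- The points `(l, m)` with `max (|l + m - Y|) (|l - m| - Y) = k`. -/
def rimSet (Y k : ℤ) : Finset (ℤ × ℤ) :=
  if k < 0 then ∅ else if k = 0 then (Finset.Icc 0 Y).image fun l => (l, Y - l) else
    ((Finset.Icc 0 (k + Y)).image (fun l => (l, k + Y - l)) ∪
      (Finset.Icc (-k) Y).image (fun l => (l, Y - k - l))) ∪
    ((Finset.Ioo Y (k + Y)).image (fun l => (l, l - k - Y)) ∪
      (Finset.Ioo (-k) 0).image (fun l => (l, l + k + Y)))

/-- The number of points of `rimSet`. -/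
def rimCount (Y k : ℤ) : ℤ := if k < 0 then 0 else if k = 0 then Y + 1 else 4 * k + 2 * Y

theorem card_rimSet {Y : ℤ} (hY : 0 ≤ Y) (k : ℤ) : ((rimSet Y k).card : ℤ) = rimCount Y k := by
  have hinj : ∀ f : ℤ → ℤ, Function.Injective fun l : ℤ => (l, f l) := fun f a b h =>
    congrArg Prod.fst h
  rw [rimSet, rimCount]
  split_ifs with h1 h2
  · simp
  · rw [Finset.card_image_of_injective _ (hinj _), Int.card_Icc]; omega
  · rw [Finset.card_union_of_disjoint, Finset.card_union_of_disjoint,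
      Finset.card_union_of_disjoint, Finset.card_image_of_injective _ (hinj _),
      Finset.card_image_of_injective _ (hinj _), Finset.card_image_of_injective _ (hinj _),
      Finset.card_image_of_injective _ (hinj _), Int.card_Icc, Int.card_Icc, Int.card_Ioo,
      Int.card_Ioo]
    · omega
    all_goals
      rw [Finset.disjoint_left]
      rintro ⟨l, m⟩ ha hb
      simp only [Finset.mem_union, Finset.mem_image, Finset.mem_Icc, Finset.mem_Ioo,
        Prod.mk.injEq, ↓existsAndEq, true_and] at ha hb
      omega

theorem mem_rimSet {Y : ℤ} (hY : 0 ≤ Y) (k l m : ℤ) : (l, m) ∈ rimSet Y k ↔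
    (l + m - Y ≤ k ∧ Y - l - m ≤ k ∧ l - m ≤ k + Y ∧ m - l ≤ k + Y) ∧
      (l + m - Y = k ∨ Y - l - m = k ∨ l - m = k + Y ∨ m - l = k + Y) := by
  rw [rimSet]
  split_ifs with h1 h2
  · simp only [Finset.notMem_empty, false_iff]; omega
  · simp only [Finset.mem_image, Finset.mem_Icc, Prod.mk.injEq, ↓existsAndEq, true_and]
    omega
  · simp only [Finset.mem_union, Finset.mem_image, Finset.mem_Icc, Finset.mem_Ioo,
        Prod.mk.injEq, ↓existsAndEq, true_and]
    omega

theorem exists_equiv_rimSet {X U A P E : ℤ} (hPE : P + E = X + 2 * A)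
    (hXU : (0 < X ∧ U = 0) ∨ (X = 0 ∧ 0 ≤ U) ∨ (X < 0 ∧ U = X)) :
    ∃ e : ℤ × ℤ ≃ ℤ × ℤ, ∀ i j n : ℤ,
      i - j + 2 * A + U - 2 * min (min (i - j + A) (P - j)) (min (i + E) A) = n ↔
        e (i, j) ∈ rimSet |X| (n - max U 0) := by
  rcases le_or_gt 0 X with hX | hX
  · refine ⟨⟨fun p => (p.1 + E - A, P - A - p.2), fun p => (p.1 - E + A, P - A - p.2),
      fun p => by ext <;> dsimp only <;> omega,
      fun p => by ext <;> dsimp only <;> omega⟩, fun i j n => ?_⟩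
    simp only [Equiv.coe_fn_mk]
    rw [mem_rimSet (abs_nonneg _), abs_of_nonneg hX, max_eq_left (by omega)]
    simp only [min_def]
    split_ifs <;> omega
  · refine ⟨⟨fun p => (p.1 + E - A - X, p.2 - P + A), fun p => (p.1 - E + A + X, p.2 + P - A),
      fun p => by ext <;> dsimp only <;> omega,
      fun p => by ext <;> dsimp only <;> omega⟩, fun i j n => ?_⟩
    simp only [Equiv.coe_fn_mk]
    rw [mem_rimSet (abs_nonneg _), abs_of_neg hX, max_eq_right (by omega)]
    simp only [min_def]
    split_ifs <;> omega

end Count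

section Split

variable {F : Type*} [Field F]

theorem isTracefreePreimage_split {x : F} {γ : GL (Fin 2) F}
    (h : IsTracefreePreimage (splitEmb F) (splitEps F) x γ) :
    ∃ a f e : F, a ≠ 0 ∧ (γ : Matrix (Fin 2) (Fin 2) F) = !![a, f; e, -a] ∧ f * e = -(x * a ^ 2) := by
  obtain ⟨htr, ⟨a, d⟩, ⟨e, f⟩, hγ, hdet, hx⟩ := h
  have h1 : splitEmb F (a, d) = !![a, 0; 0, d] := rfl
  have h2 : splitEmb F (e, f) = !![e, 0; 0, f] := rfl
  rw [h1, h2] at hγ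
  have hγ' : (γ : Matrix (Fin 2) (Fin 2) F) = !![a, f; e, d] := by
    rw [hγ, splitEps]
    ext i j; fin_cases i <;> fin_cases j <;> simp
  rw [hγ', Matrix.trace_fin_two_of] at htr
  have hd : d = -a := by linear_combination htr
  rw [h1, Matrix.det_fin_two_of] at hdet
  rw [h1, h2, splitEps, Matrix.det_fin_two_of, Matrix.det_fin_two_of, Matrix.det_fin_two_of] at hx
  subst hd
  have ha : a ≠ 0 := by rintro rfl; simp at hdet
  refine ⟨a, f, e, ha, hγ', ?_⟩
  rw [hx]
  field_simp
  ring

theorem exists_tracefreePreimage_split {x : F} (hx : x ≠ 1) :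
    ∃ γ : GL (Fin 2) F, IsTracefreePreimage (splitEmb F) (splitEps F) x γ := by
  have hdet : (!![1, 1; -x, -1] : Matrix (Fin 2) (Fin 2) F).det ≠ 0 := by
    rw [Matrix.det_fin_two_of]
    intro h
    exact hx (by linear_combination h)
  refine ⟨Matrix.GeneralLinearGroup.mkOfDetNeZero _ hdet, ?_, (1, -1), (-x, 1), ?_, ?_, ?_⟩
  · change (!![1, 1; -x, -1] : Matrix (Fin 2) (Fin 2) F).trace = 0
    simp [Matrix.trace_fin_two_of]
  · change (!![1, 1; -x, -1] : Matrix (Fin 2) (Fin 2) F) =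
      !![1, 0; 0, -1] + splitEps F * !![-x, 0; 0, 1]
    rw [splitEps]
    ext i j; fin_cases i <;> fin_cases j <;> simp
  · change (!![1, 0; 0, -1] : Matrix (Fin 2) (Fin 2) F).det ≠ 0
    simp
  · change x = -(splitEps F).det * (!![-x, 0; 0, 1] : Matrix (Fin 2) (Fin 2) F).det /
      (!![1, 0; 0, -1] : Matrix (Fin 2) (Fin 2) F).det
    simp [splitEps]

/-- The elements `diag(α, 1)` of the diagonal torus. -/
def splitRep (α : Fˣ) : torus (splitEmb F) :=
  ⟨Matrix.ProjGenLinGroup.mk (diagGL α), MulEquiv.prodUnits.symm (α, 1), by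
    refine congrArg Matrix.ProjGenLinGroup.mk (Units.ext ?_)
    ext i j; fin_cases i <;> fin_cases j <;> rfl⟩

theorem splitRep_coe (α : Fˣ) :
    (splitRep α : PGL(2, F)) = Matrix.ProjGenLinGroup.mk (diagGL α) := rfl

theorem exists_splitRep_eq (t : torus (splitEmb F)) : ∃ α, t = splitRep α := by
  obtain ⟨_, t, rfl⟩ := t
  set a : Fˣ := (MulEquiv.prodUnits t).1
  set d : Fˣ := (MulEquiv.prodUnits t).2
  refine ⟨a / d, Subtype.ext ?_⟩
  change Matrix.ProjGenLinGroup.mk (torusGL (splitEmb F) t) = Matrix.ProjGenLinGroup.mk _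
  symm
  rw [Matrix.ProjGenLinGroup.mk_eq_mk_iff]
  refine ⟨d, Units.ext ?_⟩
  have ht : ((torusGL (splitEmb F) t : GL (Fin 2) F) : Matrix (Fin 2) (Fin 2) F) =
    !![(a : F), 0; 0, d] := rfl
  rw [Units.val_mul, scalarGL_coe, diagGL_coe, ht]
  ext i j; fin_cases i <;> fin_cases j <;> simp

variable [ValuativeRel F] [TopologicalSpace F] [IsNonarchimedeanLocalField F]

theorem mk_diagGL_mem_maxCompact_iff (α : Fˣ) :
    Matrix.ProjGenLinGroup.mk (diagGL α) ∈ maxCompact F ↔ ord (α : F) = 0 := by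
  refine ⟨fun h => ?_, fun h => mk_mem_maxCompact (diagGL_mem_gl2Int h)⟩
  have hd : InDoubleCoset 1 (Matrix.ProjGenLinGroup.mk (diagGL α)) := by
    refine ⟨_, h, 1, one_mem _, ?_⟩
    have : diagGL (1 : Fˣ) = 1 := map_one diagHom
    rw [this, map_one, mul_one, mul_one]
  have hdet : ((diagGL α : GL (Fin 2) F) : Matrix (Fin 2) (Fin 2) F).det = α := by simp
  rcases le_total 0 (ord (α : F)) with h0 | h0
  · have := (inDoubleCoset_iff_of_nonneg (isPrimitive_diagGL h0) (β := 1) (by simp)).1 hd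
    rw [hdet] at this
    simpa using this
  · have hp : IsPrimitive ((α : F)⁻¹ •
        ((diagGL α : GL (Fin 2) F) : Matrix (Fin 2) (Fin 2) F)) := by
      refine ⟨fun i j => ?_, 0, 0, ?_⟩
      · fin_cases i <;> fin_cases j <;>
          simp [zero_mem, mem_fracIdeal, ord_inv α.ne_zero, h0]
      · simp [mem_fracIdeal]
    have := (inDoubleCoset_iff (inv_ne_zero α.ne_zero) hp 1).1 hd
    rw [hdet, ord_inv α.ne_zero] at this
    simp at this
    omega

theorem splitRep_unique {π : Fˣ} (hπ : ord (π : F) = 1) (t : torus (splitEmb F)) :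
    ∃! i : ℤ, (((splitRep (π ^ i))⁻¹ * t : torus (splitEmb F)) : PGL(2, F)) ∈ maxCompact F := by
  obtain ⟨α, rfl⟩ := exists_splitRep_eq t
  have h : ∀ i : ℤ, (((splitRep (π ^ i))⁻¹ * splitRep α : torus (splitEmb F)) : PGL(2, F)) ∈
      maxCompact F ↔ i = ord (α : F) := by
    intro i
    rw [Subgroup.coe_mul, Subgroup.coe_inv, splitRep_coe, splitRep_coe, ← map_inv, ← diagGL_inv,
      ← map_mul, ← diagGL_mul, mk_diagGL_mem_maxCompact_iff, Units.val_mul,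
      ord_mul (Units.ne_zero _) α.ne_zero, Units.val_inv_eq_inv_val, ord_inv (Units.ne_zero _),
      Units.val_zpow_eq_zpow_val, ord_zpow π.ne_zero, hπ]
    omega
  simp only [h]
  exact ⟨_, rfl, fun _ h => h⟩

theorem isPrimitive_smul {A : Matrix (Fin 2) (Fin 2) F} (hA : ∀ i j, A i j ≠ 0) {z : F}
    (hz : z ≠ 0) (h : ord z = -min (min (ord (A 0 0)) (ord (A 0 1)))
      (min (ord (A 1 0)) (ord (A 1 1)))) : IsPrimitive (z • A) := by
  have hmem : ∀ (n : ℤ) i j, (z • A) i j ∈ fracIdeal F n ↔ n ≤ ord z + ord (A i j) := by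
    intro n i j
    rw [Matrix.smul_apply, smul_eq_mul, mem_fracIdeal_of_ne (mul_ne_zero hz (hA i j)),
      ord_mul hz (hA i j)]
  refine ⟨fun i j => ?_, ?_⟩
  · rw [hmem]
    fin_cases i <;> fin_cases j <;> simp <;> omega
  · by_contra! hc
    simp only [hmem] at hc
    have h00 := hc 0 0
    have h01 := hc 0 1
    have h10 := hc 1 0
    have h11 := hc 1 1
    omega

theorem ord_one_sub_cases {x u : Fˣ} (hu : (u : F) = 1 - x) :
    (0 < ord (x : F) ∧ ord (u : F) = 0) ∨ (ord (x : F) = 0 ∧ 0 ≤ ord (u : F)) ∨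
      (ord (x : F) < 0 ∧ ord (u : F) = ord (x : F)) := by
  rcases lt_trichotomy (ord (x : F)) 0 with h | h | h
  · refine Or.inr (Or.inr ⟨h, ?_⟩)
    have := (ord_add_eq_of_lt (neg_ne_zero.2 x.ne_zero) (b := 1)
      (Or.inr (by rw [ord_neg, ord_one]; omega))).2
    rw [hu, ← ord_neg (x : F), ← this]
    congr 1; ring
  · refine Or.inr (Or.inl ⟨h, ?_⟩)
    have h1 : (1 : F) ∈ fracIdeal F 0 := Or.inr (by simp)
    have h2 : (x : F) ∈ fracIdeal F 0 := Or.inr h.ge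
    have := sub_mem h1 h2
    rw [← hu, mem_fracIdeal_of_ne u.ne_zero] at this
    exact this
  · refine Or.inl ⟨h, ?_⟩
    have := (ord_add_eq_of_lt (one_ne_zero (α := F)) (b := -(x : F))
      (Or.inr (by rw [ord_neg, ord_one]; omega))).2
    rw [hu, sub_eq_add_neg, this, ord_one]

theorem IsUnram.neg {χ₁ : Fˣ →* ℂˣ} (h : IsUnram χ₁) (a : Fˣ) : χ₁ (-a) = χ₁ a := by
  have h1 : χ₁ (-1) = 1 := h _ (by simp)
  rw [← neg_one_mul, map_mul, h1, one_mul]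

theorem inDoubleCoset_split_iff {π : Fˣ} (hπ : ord (π : F) = 1) {x u : Fˣ} (hu : (u : F) = 1 - x)
    {γ : GL (Fin 2) F} {a f e : F} (ha : a ≠ 0)
    (hγ : (γ : Matrix (Fin 2) (Fin 2) F) = !![a, f; e, -a]) (hfe : f * e = -(x * a ^ 2))
    (β : Fˣ) (i j : ℤ) :
    InDoubleCoset β (((splitRep (π ^ j))⁻¹ : PGL(2, F)) * Matrix.ProjGenLinGroup.mk γ *
        splitRep (π ^ i)) ↔
      i - j + 2 * ord a + ord (u : F) - 2 * min (min (i - j + ord a) (ord f - j))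
        (min (i + ord e) (ord a)) = |ord (β : F)| := by
  have hfe0 : f * e ≠ 0 := by
    rw [hfe]; exact neg_ne_zero.2 (mul_ne_zero x.ne_zero (pow_ne_zero _ ha))
  have hf : f ≠ 0 := left_ne_zero_of_mul hfe0
  have he : e ≠ 0 := right_ne_zero_of_mul hfe0
  set g : GL (Fin 2) F := (diagGL (π ^ j))⁻¹ * γ * diagGL (π ^ i) with hg
  have hmk : ((splitRep (π ^ j))⁻¹ : PGL(2, F)) * Matrix.ProjGenLinGroup.mk γ *
      splitRep (π ^ i) = Matrix.ProjGenLinGroup.mk g := by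
    rw [hg, map_mul, map_mul, map_inv]; rfl
  have hp : ∀ k : ℤ, (π : F) ^ k ≠ 0 := fun k => zpow_ne_zero _ π.ne_zero
  have hpo : ∀ k : ℤ, ord ((π : F) ^ k) = k := fun k => by rw [ord_zpow π.ne_zero, hπ, mul_one]
  have hgc : (g : Matrix (Fin 2) (Fin 2) F) =
      !![(π : F) ^ (i - j) * a, (π : F) ^ (-j) * f; (π : F) ^ i * e, -a] := by
    rw [hg, ← diagGL_inv, Units.val_mul, Units.val_mul, hγ, diagGL_coe, diagGL_coe,
      sub_eq_add_neg, zpow_add₀ π.ne_zero, _root_.zpow_neg]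
    ext r s
    fin_cases r <;> fin_cases s <;> simp [mul_comm, mul_left_comm]
  have hdet : (g : Matrix (Fin 2) (Fin 2) F).det = -((π : F) ^ (i - j) * a ^ 2 * u) := by
    have h1 : (π : F) ^ (-j) * (π : F) ^ i = (π : F) ^ (i - j) := by
      rw [← zpow_add₀ π.ne_zero]; congr 1; ring
    rw [hgc, Matrix.det_fin_two_of, hu]
    linear_combination -(f * e) * h1 - (π : F) ^ (i - j) * hfe
  have hdeto : ord (g : Matrix (Fin 2) (Fin 2) F).det = i - j + 2 * ord a + ord (u : F) := by
    rw [hdet, ord_neg, ord_mul (mul_ne_zero (hp _) (pow_ne_zero _ ha)) u.ne_zero,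
      ord_mul (hp _) (pow_ne_zero _ ha), hpo, ord_pow ha]
    push_cast; ring
  have hne : ∀ r s, g r s ≠ 0 := by
    intro r s
    rw [hgc]
    fin_cases r <;> fin_cases s
    · exact mul_ne_zero (hp _) ha
    · exact mul_ne_zero (hp _) hf
    · exact mul_ne_zero (hp _) he
    · exact neg_ne_zero.2 ha
  have h00 : ord (g 0 0) = i - j + ord a := by
    rw [hgc]; exact (ord_mul (hp _) ha).trans (by rw [hpo])
  have h01 : ord (g 0 1) = ord f - j := by
    rw [hgc]; exact (ord_mul (hp _) hf).trans (by rw [hpo]; ring)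
  have h10 : ord (g 1 0) = i + ord e := by
    rw [hgc]; exact (ord_mul (hp _) he).trans (by rw [hpo])
  have h11 : ord (g 1 1) = ord a := by
    rw [hgc]; exact ord_neg a
  obtain ⟨z, hz, hzo⟩ := exists_ord_eq (F := F) (-min (min (ord (g 0 0)) (ord (g 0 1)))
      (min (ord (g 1 0)) (ord (g 1 1))))
  rw [hmk, inDoubleCoset_iff hz (isPrimitive_smul hne hz hzo), hdeto, hzo, h00, h01, h10, h11]
  constructor <;> intro h <;> omega

theorem splitLinking {π : Fˣ} (hπ : ord (π : F) = 1) {dg : Measure (PGL(2, F))} [dg.IsHaarMeasure]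
    {dt : Measure (torus (splitEmb F))} [dt.IsHaarMeasure]
    {dy : Measure (Quotient (QuotientGroup.rightRel (torus (splitEmb F))))}
    (hq : IsQuotientMeasure (torus (splitEmb F)) dg dt dy)
    {χ : (F × F)ˣ →* ℂˣ} {χ₁ : Fˣ →* ℂˣ} (h : χ₁ ^ 2 = 1) (hχ₁ : IsUnram χ₁)
    (hχ : χ = χ₁.comp (normHom (splitEmb F))) {x u : Fˣ} (hu : (u : F) = 1 - x) (β : Fˣ) :
    translatedLinkingNumber (splitEmb F) (splitEps F) dt dy (sphericalFn (splitEmb F) χ)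
        (sphericalFn (splitEmb F) χ) (x : F) β =
      χ₁ u * χ₁ β * ((rimCount |ord (x : F)| (|ord (β : F)| - max (ord (u : F)) 0) : ℤ) *
        (cosetWeight F (ord (β : F)).natAbs * dg.real (maxCompact F)) : ℝ) := by
  have hx1 : (x : F) ≠ 1 := by
    intro hx
    rw [hx, sub_self] at hu
    exact u.ne_zero hu
  have hex := exists_tracefreePreimage_split hx1
  rw [translatedLinkingNumber, localLinkingNumber, dif_pos hex]
  obtain ⟨a, f, e, ha, hγ, hfe⟩ := isTracefreePreimage_split hex.choose_spec
  set γ := hex.choose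
  have hfe0 : f * e ≠ 0 := by
    rw [hfe]; exact neg_ne_zero.2 (mul_ne_zero x.ne_zero (pow_ne_zero _ ha))
  have hord : ord f + ord e = ord (x : F) + 2 * ord a := by
    rw [← ord_mul (left_ne_zero_of_mul hfe0) (right_ne_zero_of_mul hfe0), hfe, ord_neg,
      ord_mul x.ne_zero (pow_ne_zero _ ha), ord_pow ha]
    push_cast; ring
  obtain ⟨eq, heq⟩ := exists_equiv_rimSet hord (ord_one_sub_cases hu)
  have hdet : Matrix.GeneralLinearGroup.det γ = -(u * (Units.mk0 a ha) ^ 2) := by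
    ext
    change (γ : Matrix (Fin 2) (Fin 2) F).det = -((u : F) * a ^ 2)
    rw [hγ, Matrix.det_fin_two_of, hu]
    linear_combination -hfe
  have hχdet : χ₁ (Matrix.GeneralLinearGroup.det γ) = χ₁ u := by
    have : χ₁ (Units.mk0 a ha) ^ 2 = 1 := DFunLike.congr_fun h _
    rw [hdet, hχ₁.neg, map_mul, map_pow, this, mul_one]
  rw [linkingNumber_eq h hχ₁ hχ hq (fun i : ℤ => splitRep (π ^ i)) (splitRep_unique hπ) γ β
    ((rimSet |ord (x : F)| (|ord (β : F)| - max (ord (u : F)) 0)).map eq.symm.toEmbedding) ?_,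
    hχdet, Finset.card_map, ← card_rimSet (abs_nonneg _)]
  · push_cast; rfl
  · intro i j
    rw [inDoubleCoset_split_iff hπ hu ha hγ hfe, heq]
    simp

end Split

section Squares

variable {F : Type*} [Field F] [ValuativeRel F] [TopologicalSpace F]
  [IsNonarchimedeanLocalField F]

theorem ord_eq_zero_of_mem {a : F} (h0 : a ∈ fracIdeal F 0) (h1 : a ∉ fracIdeal F 1) :
    a ≠ 0 ∧ ord a = 0 := by
  have ha : a ≠ 0 := fun h => h1 (h ▸ zero_mem _)
  rw [mem_fracIdeal_of_ne ha] at h0 h1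
  exact ⟨ha, by omega⟩

theorem mem_fracIdeal_of_sq_mem {a : F} (h : a ^ 2 ∈ fracIdeal F 1) : a ∈ fracIdeal F 1 := by
  rcases eq_or_ne a 0 with rfl | ha
  · exact zero_mem _
  · rw [mem_fracIdeal_of_ne (pow_ne_zero _ ha), ord_pow ha] at h
    rw [mem_fracIdeal_of_ne ha]
    push_cast at h
    omega

theorem two_notMem (hF : ringChar 𝓀[F] ≠ 2) : (2 : F) ∉ fracIdeal F 1 := by
  have h2 : (2 : 𝓀[F]) ≠ 0 := Ring.two_ne_zero hF
  intro h
  refine h2 ?_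
  have := residue_eq_zero_iff (a := (2 : 𝒪[F])).2 h
  rwa [map_ofNat] at this

open Polynomial in
theorem isSquare_of_sq_sub_mem (hF : ringChar 𝓀[F] ≠ 2) {a c : F} (ha : a ∈ fracIdeal F 0)
    (ha1 : a ∉ fracIdeal F 1) (h : a ^ 2 - c ∈ fracIdeal F 1) : IsSquare c := by
  let := IsTopologicalAddGroup.rightUniformSpace F
  have := isUniformAddGroup_of_addCommGroup (G := F)
  have hc : c ∈ fracIdeal F 0 := by
    have h2 : a ^ 2 ∈ fracIdeal F 0 := by
      rw [sq]; exact mul_mem_fracIdeal ha ha (by simp)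
    have := sub_mem h2 (fracIdeal_anti zero_le_one h)
    rwa [sub_sub_cancel] at this
  lift a to 𝒪[F] using mem_integer_iff.2 ha
  lift c to 𝒪[F] using mem_integer_iff.2 hc
  have hH : HenselianRing 𝒪[F] 𝓂[F] := IsAdicComplete.henselianRing _ _
  obtain ⟨r, hr, -⟩ := hH.is_henselian (X ^ 2 - C c) (monic_X_pow_sub_C c two_ne_zero) a (by
    rw [mem_maximalIdeal_iff]
    simpa using h) (by
    change IsUnit (IsLocalRing.residue 𝒪[F] _)
    rw [isUnit_iff_ne_zero, Ne, residue_eq_zero_iff]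
    have e : (((X ^ 2 - C c : 𝒪[F][X]).derivative.eval a : 𝒪[F]) : F) = 2 * (a : F) := by
      simp only [derivative_sub, derivative_X_pow, derivative_C, eval_mul, eval_C, eval_pow,
        eval_X, sub_zero]
      norm_num
      exact Or.inl rfl
    rw [e]
    intro hm
    have h2 := ord_eq_zero_of_mem (a := (2 : F)) (mem_integer_iff.1 (2 : 𝒪[F]).2) (two_notMem hF)
    rw [mul_mem_fracIdeal_iff h2.1, h2.2, sub_zero] at hm
    exact ha1 hm)
  refine ⟨(r : F), ?_⟩
  have hr' : r ^ 2 - c = 0 := by simpa [IsRoot] using hr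
  have := congrArg (Subtype.val) hr'
  push_cast at this
  linear_combination -this

theorem mem_of_normForm_mem (hF : ringChar 𝓀[F] ≠ 2) {A : F} (hA : A ≠ 0) (hA0 : ord A = 0)
    (hsq : ¬IsSquare A) {e f : F} (he : e ∈ fracIdeal F 0) (hf : f ∈ fracIdeal F 0)
    (h : e ^ 2 - A * f ^ 2 ∈ fracIdeal F 1) : e ∈ fracIdeal F 1 ∧ f ∈ fracIdeal F 1 := by
  have hf1 : f ∈ fracIdeal F 1 := by
    by_contra hf1
    obtain ⟨hfn, hf0⟩ := ord_eq_zero_of_mem hf hf1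
    have hfi : ord f⁻¹ = 0 := by rw [ord_inv hfn, hf0, neg_zero]
    have h1 : (f⁻¹ * e) ^ 2 - A ∈ fracIdeal F 1 := by
      have e1 : (f⁻¹ * e) ^ 2 - A = f⁻¹ * (f⁻¹ * (e ^ 2 - A * f ^ 2)) := by field_simp
      rw [e1, mul_mem_fracIdeal_iff (inv_ne_zero hfn), mul_mem_fracIdeal_iff (inv_ne_zero hfn), hfi]
      simpa using h
    refine hsq (isSquare_of_sq_sub_mem hF (a := f⁻¹ * e) ?_ ?_ h1)
    · rw [mul_mem_fracIdeal_iff (inv_ne_zero hfn), hfi]; simpa using he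
    · intro h2
      have h3 : (f⁻¹ * e) ^ 2 ∈ fracIdeal F 1 := by
        rw [sq]; exact mul_mem_fracIdeal h2 h2 (by norm_num)
      have h4 := sub_mem h3 h1
      rw [sub_sub_cancel, mem_fracIdeal_of_ne hA, hA0] at h4
      omega
  refine ⟨mem_fracIdeal_of_sq_mem ?_, hf1⟩
  have h5 : A * f ^ 2 ∈ fracIdeal F 1 := by
    rw [mul_mem_fracIdeal_iff hA, hA0, sq]
    exact mul_mem_fracIdeal hf1 hf1 (by norm_num)
  have := add_mem h h5
  rwa [sub_add_cancel] at this

theorem exists_normalize_pair {e f : F} (h : e ≠ 0 ∨ f ≠ 0) :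
    ∃ z : F, z ≠ 0 ∧ z * e ∈ fracIdeal F 0 ∧ z * f ∈ fracIdeal F 0 ∧
      ¬(z * e ∈ fracIdeal F 1 ∧ z * f ∈ fracIdeal F 1) := by
  have key : ∀ e f : F, e ≠ 0 → (f = 0 ∨ ord e ≤ ord f) → ∃ z : F, z ≠ 0 ∧ z * e ∈ fracIdeal F 0 ∧
      z * f ∈ fracIdeal F 0 ∧ z * e ∉ fracIdeal F 1 := by
    intro e f he hf
    refine ⟨e⁻¹, inv_ne_zero he, ?_, ?_, ?_⟩
    · rw [inv_mul_cancel₀ he]; simp [mem_fracIdeal]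
    · rw [mul_mem_fracIdeal_iff (inv_ne_zero he), ord_inv he, mem_fracIdeal]
      simpa using hf
    · rw [inv_mul_cancel₀ he]; simp [mem_fracIdeal]
  by_cases hc : e ≠ 0 ∧ (f = 0 ∨ ord e ≤ ord f)
  · obtain ⟨z, h1, h2, h3, h4⟩ := key e f hc.1 hc.2
    exact ⟨z, h1, h2, h3, fun h => h4 h.1⟩
  · have hf : f ≠ 0 := by
      rintro rfl
      simp at h hc
      exact h hc
    obtain ⟨z, h1, h2, h3, h4⟩ := key f e hf (by
      by_cases he : e = 0
      · exact Or.inl he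
      · push Not at hc
        exact Or.inr (hc he).2.le)
    exact ⟨z, h1, h3, h2, fun h => h4 h.2⟩

theorem ord_normForm (hF : ringChar 𝓀[F] ≠ 2) {A : F} (hA : A ≠ 0) (hA0 : ord A = 0)
    (hsq : ¬IsSquare A) {e f z : F} (hz : z ≠ 0) (he : z * e ∈ fracIdeal F 0)
    (hf : z * f ∈ fracIdeal F 0) (h : ¬(z * e ∈ fracIdeal F 1 ∧ z * f ∈ fracIdeal F 1)) :
    e ^ 2 - A * f ^ 2 ≠ 0 ∧ ord (e ^ 2 - A * f ^ 2) = -2 * ord z := by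
  have hm : (z * e) ^ 2 - A * (z * f) ^ 2 ∈ fracIdeal F 0 := by
    refine sub_mem ?_ ?_
    · rw [sq]; exact mul_mem_fracIdeal he he (by simp)
    · rw [mul_mem_fracIdeal_iff hA, hA0, sq]; exact mul_mem_fracIdeal hf hf (by simp)
  obtain ⟨h0, h1⟩ := ord_eq_zero_of_mem hm (mt (mem_of_normForm_mem hF hA hA0 hsq he hf) h)
  have e1 : (z * e) ^ 2 - A * (z * f) ^ 2 = z ^ 2 * (e ^ 2 - A * f ^ 2) := by ring
  rw [e1] at h0 h1
  have h2 := right_ne_zero_of_mul h0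
  rw [ord_mul (pow_ne_zero _ hz) h2, ord_pow hz] at h1
  exact ⟨h2, by push_cast at h1; omega⟩

theorem exists_normForm_ord (hF : ringChar 𝓀[F] ≠ 2) {A : F} (hA : A ≠ 0) (hA0 : ord A = 0)
    (hsq : ¬IsSquare A) {e f : F} (h : e ≠ 0 ∨ f ≠ 0) : Even (ord (e ^ 2 - A * f ^ 2)) := by
  obtain ⟨z, h1, h2, h3, h4⟩ := exists_normalize_pair h
  rw [(ord_normForm hF hA hA0 hsq h1 h2 h3 h4).2]
  exact ⟨-ord z, by ring⟩

open Polynomial in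
theorem exists_normForm_eq (hF : ringChar 𝓀[F] ≠ 2) {A : F} (hA : A ≠ 0) (hA0 : ord A = 0)
    {a : F} (ha : a ≠ 0) (h0 : ord a = 0) : ∃ e f : F, e ^ 2 - A * f ^ 2 = a := by
  have hAm : A ∈ fracIdeal F 0 := Or.inr hA0.ge
  have ham : a ∈ fracIdeal F 0 := Or.inr h0.ge
  set A' : 𝒪[F] := ⟨A, mem_integer_iff.2 hAm⟩ with hA'
  set a' : 𝒪[F] := ⟨a, mem_integer_iff.2 ham⟩ with ha'
  have hAr : IsLocalRing.residue 𝒪[F] A' ≠ 0 := by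
    rw [Ne, residue_eq_zero_iff, mem_fracIdeal_of_ne hA, hA0]; omega
  let := Fintype.ofFinite 𝓀[F]
  have hd : ∀ r s : 𝓀[F], r ≠ 0 → degree (C r * X ^ 2 + C 0 * X + C s) = 2 :=
    fun r s hr => degree_quadratic hr
  obtain ⟨e, f, hef⟩ := FiniteField.exists_root_sum_quadratic
    (hd 1 (-IsLocalRing.residue 𝒪[F] a') one_ne_zero)
    (hd (-IsLocalRing.residue 𝒪[F] A') 0 (neg_ne_zero.2 hAr))
    (FiniteField.odd_card_of_char_ne_two hF)
  obtain ⟨e, rfl⟩ := IsLocalRing.residue_surjective e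
  obtain ⟨f, rfl⟩ := IsLocalRing.residue_surjective f
  have hm : e ^ 2 - A' * f ^ 2 - a' ∈ 𝓂[F] := by
    rw [← IsLocalRing.residue_eq_zero_iff]
    simp at hef
    simp only [map_sub, map_mul, map_pow]
    linear_combination hef
  rw [mem_maximalIdeal_iff] at hm
  push_cast at hm
  have hm' : (e : F) ^ 2 - A * (f : F) ^ 2 - a ∈ fracIdeal F 1 := hm
  have he0 : (e : F) ∈ fracIdeal F 0 := mem_integer_iff.1 e.2
  have hf0 : (f : F) ∈ fracIdeal F 0 := mem_integer_iff.1 f.2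
  by_cases he : (e : F) ∈ fracIdeal F 1
  · have he2 : (e : F) ^ 2 ∈ fracIdeal F 1 := by
      rw [sq]; exact mul_mem_fracIdeal he he (by norm_num)
    have h1 : A * (f : F) ^ 2 + a ∈ fracIdeal F 1 := by
      have := sub_mem he2 hm'
      convert this using 1; ring
    obtain ⟨r, hr⟩ := isSquare_of_sq_sub_mem hF (a := (f : F)) (c := A⁻¹ * -a) hf0 (by
      intro hf
      have hf2 : A * (f : F) ^ 2 ∈ fracIdeal F 1 := by
        rw [mul_mem_fracIdeal_iff hA, hA0, sq]; exact mul_mem_fracIdeal hf hf (by norm_num)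
      have := sub_mem h1 hf2
      rw [add_sub_cancel_left, mem_fracIdeal_of_ne ha, h0] at this
      omega) (by
      have : (f : F) ^ 2 - A⁻¹ * -a = A⁻¹ * (A * (f : F) ^ 2 + a) := by field_simp; ring
      rw [this, mul_mem_fracIdeal_iff (inv_ne_zero hA), ord_inv hA, hA0]
      simpa using h1)
    refine ⟨0, r, ?_⟩
    have : A * (r * r) = -a := by rw [← hr]; field_simp
    linear_combination -this
  · obtain ⟨r, hr⟩ := isSquare_of_sq_sub_mem hF (a := (e : F)) (c := a + A * (f : F) ^ 2) he0 he (by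
      convert hm' using 1; ring)
    exact ⟨r, f, by linear_combination -hr⟩

end Squares

section FieldTorus

variable {F : Type*} [Field F]

theorem normHom_fieldEmb_coe {A : F} (t : (QuadraticAlgebra F A 0)ˣ) :
    ((normHom (fieldEmb A) t : Fˣ) : F) =
      (t : QuadraticAlgebra F A 0).re ^ 2 - A * (t : QuadraticAlgebra F A 0).im ^ 2 := by
  change (fieldEmb A (t : QuadraticAlgebra F A 0)).det = _
  rw [fieldEmb_apply, Matrix.det_fin_two_of]
  ring

theorem re_ne_zero_or_im_ne_zero {A : F} (t : (QuadraticAlgebra F A 0)ˣ) :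
    (t : QuadraticAlgebra F A 0).re ≠ 0 ∨ (t : QuadraticAlgebra F A 0).im ≠ 0 := by
  by_contra! h
  exact t.ne_zero (QuadraticAlgebra.ext h.1 h.2)

theorem exists_unit_re_im {A e f : F} (h : e ^ 2 - A * f ^ 2 ≠ 0) :
    ∃ t : (QuadraticAlgebra F A 0)ˣ, (t : QuadraticAlgebra F A 0) = ⟨e, f⟩ := by
  have hu : IsUnit (⟨e, f⟩ : QuadraticAlgebra F A 0) := by
    rw [QuadraticAlgebra.isUnit_iff_norm_isUnit, QuadraticAlgebra.norm_def, isUnit_iff_ne_zero]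
    convert h using 1
    simp
    ring
  exact ⟨hu.unit, rfl⟩

theorem isTracefreePreimage_field (h2 : (2 : F) ≠ 0) {A x : F} (hA : A ≠ 0) {γ : GL (Fin 2) F}
    (h : IsTracefreePreimage (fieldEmb A) (fieldEps A) x γ) :
    ∃ b e f : F, b ≠ 0 ∧
      (γ : Matrix (Fin 2) (Fin 2) F) = !![-(A * f), A * (b - e); b + e, A * f] ∧
      x * b ^ 2 = e ^ 2 - A * f ^ 2 := by
  obtain ⟨htr, ⟨a, b⟩, ⟨e, f⟩, hγ, hdet, hx⟩ := h
  rw [fieldEmb_apply, fieldEmb_apply, fieldEps] at hγ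
  have hγ' : (γ : Matrix (Fin 2) (Fin 2) F) = !![a - A * f, A * (b - e); b + e, a + A * f] := by
    rw [hγ]
    ext i j; fin_cases i <;> fin_cases j <;> simp <;> ring
  rw [hγ', Matrix.trace_fin_two_of] at htr
  have ha : a = 0 := by
    have : 2 * a = 0 := by linear_combination htr
    exact (mul_eq_zero.1 this).resolve_left h2
  subst ha
  rw [fieldEmb_apply, Matrix.det_fin_two_of] at hdet
  rw [fieldEmb_apply, fieldEmb_apply, fieldEps, Matrix.det_fin_two_of, Matrix.det_fin_two_of,
    Matrix.det_fin_two_of] at hx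
  dsimp only at hdet hx
  have hb : b ≠ 0 := by rintro rfl; simp at hdet
  refine ⟨b, e, f, hb, by rw [hγ', zero_sub, zero_add], ?_⟩
  rw [hx]
  field_simp
  ring

theorem exists_tracefreePreimage_field {A x e f : F} (hA : A ≠ 0) (hx1 : x ≠ 1)
    (hx : e ^ 2 - A * f ^ 2 = x) :
    ∃ γ : GL (Fin 2) F, IsTracefreePreimage (fieldEmb A) (fieldEps A) x γ := by
  have hdet : (!![-(A * f), A * (1 - e); 1 + e, A * f] : Matrix (Fin 2) (Fin 2) F).det ≠ 0 := by
    rw [Matrix.det_fin_two_of]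
    intro h
    have : A * (x - 1) = 0 := by rw [← hx]; linear_combination h
    exact (mul_ne_zero hA (sub_ne_zero.2 hx1)) this
  refine ⟨Matrix.GeneralLinearGroup.mkOfDetNeZero _ hdet, ?_, ⟨0, 1⟩, ⟨e, f⟩, ?_, ?_, ?_⟩
  · change (!![-(A * f), A * (1 - e); 1 + e, A * f] : Matrix (Fin 2) (Fin 2) F).trace = 0
    simp [Matrix.trace_fin_two_of]
  · change (!![-(A * f), A * (1 - e); 1 + e, A * f] : Matrix (Fin 2) (Fin 2) F) = _
    rw [fieldEmb_apply, fieldEmb_apply, fieldEps]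
    ext i j; fin_cases i <;> fin_cases j <;> simp <;> ring
  · rw [fieldEmb_apply, Matrix.det_fin_two_of]
    simpa using hA
  · rw [fieldEmb_apply, fieldEmb_apply, fieldEps, Matrix.det_fin_two_of, Matrix.det_fin_two_of,
      Matrix.det_fin_two_of, ← hx]
    dsimp only
    rw [eq_div_iff (by simpa using hA)]
    ring

variable [ValuativeRel F] [TopologicalSpace F] [IsNonarchimedeanLocalField F]

section Unramified

variable {A : F}

theorem exists_normForm_eq_of_even (hF : ringChar 𝓀[F] ≠ 2) (hA : A ≠ 0) (hA0 : ord A = 0)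
    {a : F} (ha : a ≠ 0) (h : Even (ord a)) : ∃ e f : F, e ^ 2 - A * f ^ 2 = a := by
  obtain ⟨m, hm⟩ := h
  obtain ⟨z, hz, hzm⟩ := exists_ord_eq (F := F) m
  obtain ⟨e, f, h⟩ := exists_normForm_eq hF hA hA0 (a := a / z ^ 2)
    (div_ne_zero ha (pow_ne_zero _ hz)) (by
      rw [ord_div ha (pow_ne_zero _ hz), ord_pow hz, hzm, hm]; push_cast; ring)
  refine ⟨z * e, z * f, ?_⟩
  have : (z * e) ^ 2 - A * (z * f) ^ 2 = z ^ 2 * (e ^ 2 - A * f ^ 2) := by ring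
  rw [this, h]
  field_simp

theorem omega_fieldEmb (hF : ringChar 𝓀[F] ≠ 2) (hA : A ≠ 0) (hA0 : ord A = 0)
    (hsq : ¬IsSquare A) (a : Fˣ) : omega (fieldEmb A) a = (-1) ^ ord (a : F) := by
  have hiff : a ∈ (normHom (fieldEmb A)).range ↔ Even (ord (a : F)) := by
    constructor
    · rintro ⟨t, rfl⟩
      rw [normHom_fieldEmb_coe]
      exact exists_normForm_ord hF hA hA0 hsq (re_ne_zero_or_im_ne_zero t)
    · intro h
      obtain ⟨e, f, hef⟩ := exists_normForm_eq_of_even hF hA hA0 a.ne_zero h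
      obtain ⟨t, ht⟩ := exists_unit_re_im (hef.trans_ne a.ne_zero)
      refine ⟨t, Units.ext ?_⟩
      rw [normHom_fieldEmb_coe, ht]
      exact hef
  rw [omega]
  split_ifs with h
  · exact (Even.neg_one_zpow (hiff.1 h)).symm
  · exact (Odd.neg_one_zpow (Int.not_even_iff_odd.1 (mt hiff.2 h))).symm

theorem torusHom_fieldEmb_mem (hF : ringChar 𝓀[F] ≠ 2) (hA : A ≠ 0) (hA0 : ord A = 0)
    (hsq : ¬IsSquare A) (t : (QuadraticAlgebra F A 0)ˣ) :
    torusHom (fieldEmb A) t ∈ maxCompact F := by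
  obtain ⟨z, hz, he, hf, hn⟩ := exists_normalize_pair (re_ne_zero_or_im_ne_zero t)
  obtain ⟨h1, h2⟩ := ord_normForm hF hA hA0 hsq hz he hf hn
  set e := (t : QuadraticAlgebra F A 0).re
  set f := (t : QuadraticAlgebra F A 0).im
  have hmk : torusHom (fieldEmb A) t = Matrix.ProjGenLinGroup.mk (torusGL (fieldEmb A) t *
      Matrix.GeneralLinearGroup.scalar (Fin 2) (Units.mk0 z hz)) := by
    rw [map_mul, Matrix.ProjGenLinGroup.mk_scalar, mul_one]; rfl
  have hcoe : ((torusGL (fieldEmb A) t *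
      Matrix.GeneralLinearGroup.scalar (Fin 2) (Units.mk0 z hz) : GL (Fin 2) F) :
        Matrix (Fin 2) (Fin 2) F) = !![z * e, A * (z * f); z * f, z * e] := by
    have ht : ((torusGL (fieldEmb A) t : GL (Fin 2) F) : Matrix (Fin 2) (Fin 2) F) =
      fieldEmb A (t : QuadraticAlgebra F A 0) := rfl
    rw [Units.val_mul, scalarGL_coe, ht, fieldEmb_apply]
    ext i j; fin_cases i <;> fin_cases j <;> simp <;> ring
  rw [hmk]
  refine mk_mem_maxCompact (mem_gl2Int_iff.2 ⟨?_, ?_⟩)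
  · rw [hcoe]
    have hAf : A * (z * f) ∈ fracIdeal F 0 := by rwa [mul_mem_fracIdeal_iff hA, hA0]
    intro i j
    fin_cases i <;> fin_cases j
    exacts [he, hAf, hf, he]
  · rw [hcoe, Matrix.det_fin_two_of]
    have e1 : z * e * (z * e) - A * (z * f) * (z * f) = z ^ 2 * (e ^ 2 - A * f ^ 2) := by ring
    rw [e1, ord_mul (pow_ne_zero _ hz) h1, h2, ord_pow hz]
    push_cast; ring

theorem isIntegral_of_re_im_mem (hA0 : ord A = 0) {w : QuadraticAlgebra F A 0}
    (hre : w.re ∈ fracIdeal F 0) (him : w.im ∈ fracIdeal F 0) : IsIntegral 𝒪[F] w := by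
  have hb : ∀ a : F, a ∈ fracIdeal F 0 →
      IsIntegral 𝒪[F] (algebraMap F (QuadraticAlgebra F A 0) a) := fun a ha =>
    isIntegral_algebraMap (R := 𝒪[F]) (A := QuadraticAlgebra F A 0)
      (x := ⟨a, mem_integer_iff.2 ha⟩)
  have hω : IsIntegral 𝒪[F] (QuadraticAlgebra.omega : QuadraticAlgebra F A 0) := by
    refine IsIntegral.of_pow two_pos ?_
    rw [sq, QuadraticAlgebra.omega_mul_omega_eq_algebraMap, map_zero, zero_mul, add_zero]
    exact hb A (Or.inr hA0.ge)
  have hw : w = algebraMap F _ w.re + algebraMap F _ w.im * QuadraticAlgebra.omega := by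
    ext <;> simp
  rw [hw]
  exact (hb _ hre).add ((hb _ him).mul hω)

theorem unramified_torusChar_eq_one (hF : ringChar 𝓀[F] ≠ 2) (hA : A ≠ 0) (hA0 : ord A = 0)
    (hsq : ¬IsSquare A) {χ : (QuadraticAlgebra F A 0)ˣ →* ℂˣ} (hT : IsTorusChar F χ)
    (hU : IsUnramifiedChar F χ) : χ = 1 := by
  ext1 t
  obtain ⟨z, hz, he, hf, hn⟩ := exists_normalize_pair (re_ne_zero_or_im_ne_zero t)
  obtain ⟨h1, h2⟩ := ord_normForm hF hA hA0 hsq hz he hf hn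
  set e := (t : QuadraticAlgebra F A 0).re
  set f := (t : QuadraticAlgebra F A 0).im
  set n := (z * e) ^ 2 - A * (z * f) ^ 2 with hndef
  have hnz : n = z ^ 2 * (e ^ 2 - A * f ^ 2) := by rw [hndef]; ring
  have hn0 : n ≠ 0 := by rw [hnz]; exact mul_ne_zero (pow_ne_zero _ hz) h1
  have hno : ord n⁻¹ = 0 := by
    rw [ord_inv hn0, hnz, ord_mul (pow_ne_zero _ hz) h1, h2, ord_pow hz]; push_cast; ring
  set t' := Units.map (algebraMap F (QuadraticAlgebra F A 0) : F →* QuadraticAlgebra F A 0)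
    (Units.mk0 z hz) * t with ht'
  have hcoe : (t' : QuadraticAlgebra F A 0) = ⟨z * e, z * f⟩ := by
    ext <;> simp [ht', e, f]
  have hinv : ((t'⁻¹ : (QuadraticAlgebra F A 0)ˣ) : QuadraticAlgebra F A 0) =
      ⟨n⁻¹ * (z * e), n⁻¹ * -(z * f)⟩ := by
    refine Units.inv_eq_of_mul_eq_one_right ?_
    rw [hcoe]
    ext
    · simp only [QuadraticAlgebra.re_mul, QuadraticAlgebra.re_one]
      rw [← inv_mul_cancel₀ hn0]
      conv_rhs => rw [hndef]
      ring
    · simp only [QuadraticAlgebra.im_mul, QuadraticAlgebra.im_one]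
      ring
  have hχ : χ t' = χ t := by rw [ht', map_mul, hT, one_mul]
  rw [← hχ, MonoidHom.one_apply]
  refine hU t' ?_ ?_
  · rw [hcoe]; exact isIntegral_of_re_im_mem hA0 he hf
  · rw [hinv]
    refine isIntegral_of_re_im_mem hA0 ?_ ?_
    · dsimp only
      rw [mul_mem_fracIdeal_iff (inv_ne_zero hn0), hno]; exact he
    · dsimp only
      rw [mul_mem_fracIdeal_iff (inv_ne_zero hn0), hno]; exact neg_mem hf

theorem inDoubleCoset_field_iff (hF : ringChar 𝓀[F] ≠ 2) (hA : A ≠ 0) (hA0 : ord A = 0)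
    (hsq : ¬IsSquare A) {x u : Fˣ} (hu : (u : F) = 1 - x) {γ : GL (Fin 2) F} {b e f : F}
    (hb : b ≠ 0)
    (hγ : (γ : Matrix (Fin 2) (Fin 2) F) = !![-(A * f), A * (b - e); b + e, A * f])
    (hx : x * b ^ 2 = e ^ 2 - A * f ^ 2) (β : Fˣ) :
    InDoubleCoset β (Matrix.ProjGenLinGroup.mk γ) ↔ max (ord (u : F)) 0 = |ord (β : F)| := by
  have hdet : (γ : Matrix (Fin 2) (Fin 2) F).det = -(A * (b ^ 2 * u)) := by
    rw [hγ, Matrix.det_fin_two_of, hu]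
    linear_combination -A * hx
  have hdeto : ord (γ : Matrix (Fin 2) (Fin 2) F).det = 2 * ord b + ord (u : F) := by
    rw [hdet, ord_neg, ord_mul hA (mul_ne_zero (pow_ne_zero _ hb) u.ne_zero), hA0,
      ord_mul (pow_ne_zero _ hb) u.ne_zero, ord_pow hb]
    push_cast; ring
  have hx' : (b⁻¹ * e) ^ 2 - A * (b⁻¹ * f) ^ 2 = x := by
    have : (b⁻¹ * e) ^ 2 - A * (b⁻¹ * f) ^ 2 = b⁻¹ ^ 2 * (e ^ 2 - A * f ^ 2) := by ring
    rw [this, ← hx]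
    field_simp
  have hAmem : ∀ {a : F} {n : ℤ}, A * a ∈ fracIdeal F n ↔ a ∈ fracIdeal F n := by
    intro a n
    rw [mul_mem_fracIdeal_iff hA, hA0, sub_zero]
  have hcases := ord_one_sub_cases hu
  set e' := b⁻¹ * e with he'
  set f' := b⁻¹ * f with hf'
  have hsmul : ∀ z : F, (z * b⁻¹) • (γ : Matrix (Fin 2) (Fin 2) F) =
      !![-(A * (z * f')), A * (z - z * e'); z + z * e', A * (z * f')] := by
    intro z
    rw [hγ]
    ext i j; fin_cases i <;> fin_cases j <;> simp [he', hf'] <;> field_simp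
  have h2 := two_notMem hF
  by_cases hint : e' ∈ fracIdeal F 0 ∧ f' ∈ fracIdeal F 0
  · have h1 : (1 : F) ∈ fracIdeal F 0 := by simp [mem_fracIdeal]
    have hp : IsPrimitive ((1 * b⁻¹) • (γ : Matrix (Fin 2) (Fin 2) F)) := by
      rw [hsmul, one_mul, one_mul]
      refine ⟨fun i j => ?_, ?_⟩
      · fin_cases i <;> fin_cases j
        exacts [neg_mem (hAmem.2 hint.2), hAmem.2 (sub_mem h1 hint.1), add_mem h1 hint.1,
          hAmem.2 hint.2]
      · by_contra! hc
        have h01 : A * (1 - e') ∈ fracIdeal F 1 := hc 0 1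
        have h10 : 1 + e' ∈ fracIdeal F 1 := hc 1 0
        have := add_mem (hAmem.1 h01) h10
        refine h2 ?_
        convert this using 1; ring
    rw [inDoubleCoset_iff (mul_ne_zero one_ne_zero (inv_ne_zero hb)) hp, hdeto, one_mul, ord_inv hb]
    have hX : 0 ≤ ord (x : F) := by
      have : (x : F) ∈ fracIdeal F 0 := by
        rw [← hx']
        refine sub_mem ?_ (hAmem.2 ?_)
        · rw [sq]; exact mul_mem_fracIdeal hint.1 hint.1 (by simp)
        · rw [sq]; exact mul_mem_fracIdeal hint.2 hint.2 (by simp)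
      rwa [mem_fracIdeal_of_ne x.ne_zero] at this
    constructor <;> intro h <;> omega
  · have hne : e' ≠ 0 ∨ f' ≠ 0 := by
      by_contra! h
      exact hint ⟨h.1 ▸ zero_mem _, h.2 ▸ zero_mem _⟩
    obtain ⟨z, hz, he, hf, hn⟩ := exists_normalize_pair hne
    obtain ⟨-, hxo⟩ := ord_normForm hF hA hA0 hsq hz he hf hn
    rw [hx'] at hxo
    have hz0 : 0 < ord z := by
      by_contra! hc
      rw [mul_mem_fracIdeal_iff hz] at he hf
      exact hint ⟨fracIdeal_anti (by omega) he, fracIdeal_anti (by omega) hf⟩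
    have hzm : ∀ n : ℤ, n ≤ 1 → z ∈ fracIdeal F n := fun n hn => Or.inr (by omega)
    have hp : IsPrimitive ((z * b⁻¹) • (γ : Matrix (Fin 2) (Fin 2) F)) := by
      rw [hsmul]
      refine ⟨fun i j => ?_, ?_⟩
      · fin_cases i <;> fin_cases j
        exacts [neg_mem (hAmem.2 hf), hAmem.2 (sub_mem (hzm _ (by simp)) he),
          add_mem (hzm _ (by simp)) he, hAmem.2 hf]
      · by_contra! hc
        have h11 : A * (z * f') ∈ fracIdeal F 1 := hc 1 1
        have h10 : z + z * e' ∈ fracIdeal F 1 := hc 1 0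
        refine hn ⟨?_, hAmem.1 h11⟩
        have := sub_mem h10 (hzm 1 le_rfl)
        rwa [add_sub_cancel_left] at this
    rw [inDoubleCoset_iff (mul_ne_zero hz (inv_ne_zero hb)) hp, hdeto,
      ord_mul hz (inv_ne_zero hb), ord_inv hb]
    constructor <;> intro h <;> omega

open Classical in
theorem fieldLinking (hF : ringChar 𝓀[F] ≠ 2) (hA : A ≠ 0) (hA0 : ord A = 0)
    (hsq : ¬IsSquare A) {dg : Measure (PGL(2, F))} [dg.IsHaarMeasure]
    {dt : Measure (torus (fieldEmb A))} [dt.IsHaarMeasure]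
    {dy : Measure (Quotient (QuotientGroup.rightRel (torus (fieldEmb A))))}
    (hq : IsQuotientMeasure (torus (fieldEmb A)) dg dt dy)
    {x u : Fˣ} (hu : (u : F) = 1 - x) (β : Fˣ) :
    translatedLinkingNumber (fieldEmb A) (fieldEps A) dt dy (sphericalFn (fieldEmb A) 1)
        (sphericalFn (fieldEmb A) 1) (x : F) β =
      if Even (ord (x : F)) ∧ max (ord (u : F)) 0 = |ord (β : F)| then
        ((cosetWeight F (ord (β : F)).natAbs * dg.real (maxCompact F) : ℝ) : ℂ) else 0 := by
  have hx1 : (x : F) ≠ 1 := by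
    intro hx
    rw [hx, sub_self] at hu
    exact u.ne_zero hu
  have h20 : (2 : F) ≠ 0 := fun h => two_notMem hF (h ▸ zero_mem _)
  rw [translatedLinkingNumber, localLinkingNumber]
  by_cases hex : ∃ γ : GL (Fin 2) F, IsTracefreePreimage (fieldEmb A) (fieldEps A) (x : F) γ
  · rw [dif_pos hex]
    obtain ⟨b, e, f, hb, hγ, hx⟩ := isTracefreePreimage_field h20 hA hex.choose_spec
    set γ := hex.choose
    have hev : Even (ord (x : F)) := by
      have hne : e ≠ 0 ∨ f ≠ 0 := by
        by_contra! h
        rw [h.1, h.2] at hx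
        refine (mul_ne_zero x.ne_zero (pow_ne_zero 2 hb)) (hx.trans ?_)
        ring
      have := exists_normForm_ord hF hA hA0 hsq hne
      rw [← hx, ord_mul x.ne_zero (pow_ne_zero _ hb), ord_pow hb] at this
      push_cast at this
      rcases this with ⟨r, hr⟩
      exact ⟨r - ord b, by omega⟩
    rw [linkingNumber_eq (χ₁ := 1) (by ext; simp) (fun _ _ => rfl) (MonoidHom.one_comp _).symm hq
      (fun _ : Unit => (1 : torus (fieldEmb A))) ?_ γ β
      (if max (ord (u : F)) 0 = |ord (β : F)| then {((), ())} else ∅) ?_]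
    · by_cases h : max (ord (u : F)) 0 = |ord (β : F)| <;> simp [h, hev]
    · rintro ⟨_, t, rfl⟩
      refine ⟨(), ?_, fun _ _ => rfl⟩
      simpa using torusHom_fieldEmb_mem hF hA hA0 hsq t
    · intro i j
      rw [Subgroup.coe_one, inv_one, one_mul, mul_one,
        inDoubleCoset_field_iff hF hA hA0 hsq hu hb hγ hx]
      split_ifs with h <;> simp [h]
  · rw [dif_neg hex, if_neg]
    rintro ⟨hev, -⟩
    obtain ⟨e, f, hef⟩ := exists_normForm_eq_of_even hF hA hA0 x.ne_zero hev
    exact hex (exists_tracefreePreimage_field hA hx1 hef)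

end Unramified

end FieldTorus

section Comparison

variable {F : Type*} [Field F] [ValuativeRel F] [TopologicalSpace F]
  [IsNonarchimedeanLocalField F]

theorem sum_Icc_neg_one_zpow (n : ℤ) :
    ∑ k ∈ Finset.Icc (-n) 0, (-1 : ℂ) ^ k = if 0 ≤ n ∧ Even n then 1 else 0 := by
  rcases lt_or_ge n 0 with h | h
  · rw [Finset.Icc_eq_empty (by omega), Finset.sum_empty, if_neg (by omega)]
  · lift n to ℕ using h
    induction n with
    | zero => simp
    | succ m ih =>
      have e : Finset.Icc (-((m + 1 : ℕ) : ℤ)) 0 =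
          insert (-((m + 1 : ℕ) : ℤ)) (Finset.Icc (-(m : ℤ)) 0) := by
        ext k; simp only [Finset.mem_insert, Finset.mem_Icc]; omega
      rw [e, Finset.sum_insert (by simp), ih]
      rcases Nat.even_or_odd m with hm | hm
      · have h1 : Odd (-((m + 1 : ℕ) : ℤ)) := by
          rw [odd_neg]; exact_mod_cast hm.add_one
        have h2 : ¬Even ((m + 1 : ℕ) : ℤ) := by
          rw [Int.not_even_iff_odd]; exact_mod_cast hm.add_one
        rw [h1.neg_one_zpow, if_pos ⟨by omega, by exact_mod_cast hm⟩, if_neg (fun h => h2 h.2)]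
        norm_num
      · have h1 : Even (-((m + 1 : ℕ) : ℤ)) := by
          rw [even_neg]; exact_mod_cast hm.add_one
        have h2 : ¬Even (m : ℤ) := by
          rw [Int.not_even_iff_odd]; exact_mod_cast hm
        rw [h1.neg_one_zpow, if_neg (fun h => h2 h.2),
          if_pos ⟨by omega, by exact_mod_cast hm.add_one⟩]
        norm_num

theorem sqrt_absF_mul (b ξ η : Fˣ) :
    √(absF ((b * η : Fˣ) : F)) * √(absF ((b * ξ : Fˣ) : F)) =
      √(absF ((ξ * η : Fˣ) : F)) * absF (b : F) := by
  rw [← Real.sqrt_mul (absF_nonneg _), Units.val_mul, Units.val_mul, Units.val_mul, absF_mul,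
    absF_mul, absF_mul]
  have : absF (b : F) * absF (η : F) * (absF (b : F) * absF (ξ : F)) =
      absF (ξ : F) * absF (η : F) * absF (b : F) ^ 2 := by ring
  rw [this, Real.sqrt_mul (mul_nonneg (absF_nonneg _) (absF_nonneg _)),
    Real.sqrt_sq (absF_nonneg _)]

theorem ord_xi_eta {x u ξ η : Fˣ} (hu : (u : F) = 1 - x) (hξ : (ξ : F) = x / (x - 1))
    (hη : (η : F) = 1 - ξ) : ord (ξ : F) = ord (x : F) - ord (u : F) ∧ ord (η : F) = -ord (u : F) := by
  have hxu : (x : F) - 1 = -u := by rw [hu]; ring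
  have h1 : (η : F) = (u : F)⁻¹ := by
    have : (u : F) ≠ 0 := u.ne_zero
    rw [hη, hξ, hxu]
    field_simp
    rw [hu]; ring
  rw [h1, ord_inv u.ne_zero, hξ, hxu, ord_div x.ne_zero (neg_ne_zero.2 u.ne_zero), ord_neg]
  exact ⟨rfl, rfl⟩

theorem absF_zpow_uniformizer {π : Fˣ} (hπ : ord (π : F) = 1) (n : ℤ) :
    absF ((π ^ n : Fˣ) : F) = (resCard F : ℝ) ^ (-n) := by
  rw [absF_of_ne (Units.ne_zero _), Units.val_zpow_eq_zpow_val, ord_zpow π.ne_zero, hπ, mul_one]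

theorem heckePart_eq {ω : Fˣ → ℂ} {μ : Fˣ →* ℂˣ} {π u b : Fˣ} (hπ : ord (π : F) = 1) {B : ℕ}
    (hb : ord (b : F) = B) {ε : ℂ} (hε : ε = 1 ∨ ε = -1) (hμ : (μ π : ℂ) = ε) {L : Fˣ → ℂ}
    {l : ℕ → ℂ} (hL : ∀ β : Fˣ, L β = ε ^ ord (β : F) * l (ord (β : F)).natAbs) :
    heckePart ω μ π u b L = ε ^ B * (1 + ω (b * u)) *
      ∑ j ∈ Finset.range (B + 1), ω (b * u) ^ (B - j) * (resCard F : ℂ) ^ j * l j := by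
  have hi : ε⁻¹ = ε := by rcases hε with rfl | rfl <;> norm_num
  have hsq : ε * ε = 1 := by rcases hε with rfl | rfl <;> norm_num
  have hz : ∀ n : ℕ, ε ^ (-(n : ℤ)) = ε ^ n := by
    intro n
    rw [_root_.zpow_neg, ← _root_.inv_zpow, hi, zpow_natCast]
  have hord : ∀ n : ℤ, ord ((π ^ n : Fˣ) : F) = n := by
    intro n
    rw [Units.val_zpow_eq_zpow_val, ord_zpow π.ne_zero, hπ, mul_one]
  rw [heckePart, hb, Int.toNat_natCast, Finset.sum_comm, ← Finset.sum_range_reflect, Finset.mul_sum]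
  refine Finset.sum_congr rfl fun j hj => ?_
  obtain ⟨i, rfl⟩ : ∃ i, B = j + i := ⟨B - j, by have := Finset.mem_range.1 hj; omega⟩
  have e1 : j + i + 1 - 1 - j = i := by omega
  have e2 : ((j + i : ℕ) : ℤ) - (i : ℤ) = j := by push_cast; ring
  have e3 : j + i - j = i := by omega
  rw [e1, e3, e2, Finset.sum_range_succ, Finset.sum_range_one, hμ, absF_zpow_uniformizer hπ]
  simp only [pow_zero, mul_one, one_mul, pow_one, add_zero, mul_neg, neg_mul, hL, hord,
    Int.natAbs_neg, Int.natAbs_natCast, hz]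
  simp only [zpow_natCast, _root_.zpow_neg]
  push_cast
  rw [div_inv_eq_mul, div_inv_eq_mul, pow_add, pow_succ]
  ring

theorem resCard_pow_mul_cosetWeight (n : ℕ) : (resCard F : ℝ) ^ n * cosetWeight F n =
    if n = 0 then 1 else (1 + (resCard F : ℝ)⁻¹)⁻¹ := by
  rw [cosetWeight]
  have h := resCard_pos F
  split_ifs with h0
  · simp [h0]
  · have : (resCard F : ℝ) ≠ 0 := by positivity
    field_simp

variable [MeasurableSpace F] [BorelSpace F] {da : Measure F} [da.IsAddHaarMeasure]
  {dma : Measure Fˣ} [dma.IsHaarMeasure] {ψ : AddChar F Circle}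

theorem newform_product (hψ : IsUnramifiedAddChar ψ) {ω : Fˣ → ℂ} {ε : ℂ} (hε : ε = 1 ∨ ε = -1)
    (hω : ∀ a, ω a = ε ^ ord (a : F)) {χ₁ : Fˣ →* ℂˣ} (hχ₁ : χ₁ ^ 2 = 1) (a a' : Fˣ) :
    thetaNew da dma ψ ω χ₁ a * eisensteinNew da dma ψ ω a' =
      volW da dma * (√(absF (a : F)) * √(absF (a' : F)) : ℝ) * χ₁ a *
        (∑ k ∈ Finset.Icc (-ord (a : F)) 0, ε ^ k) * ∑ k ∈ Finset.Icc (-ord (a' : F)) 0, ε ^ k := by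
  have hi : ε⁻¹ = ε := by rcases hε with rfl | rfl <;> norm_num
  have hn : ‖ε‖ = 1 := by rcases hε with rfl | rfl <;> simp
  have hinv : ∀ a, (ω a)⁻¹ = ε ^ ord (a : F) := fun a => by rw [hω, ← _root_.inv_zpow, hi]
  rw [thetaNew, eisensteinNew, whittakerNew_eq da dma hψ hn (fun t => ?_),
    whittakerNew_eq da dma hψ hn (fun t => ?_), volW]
  · push_cast; ring
  · rw [one_div, hinv]
  · have h2 : χ₁ t * χ₁ t = 1 := by rw [← sq]; exact DFunLike.congr_fun hχ₁ t
    have h3 : (χ₁ t : ℂ) * χ₁ t = 1 := by rw [← Units.val_mul, h2, Units.val_one]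
    rw [Units.val_inv_eq_inv_val, div_mul_eq_div_div, div_inv_eq_mul, div_eq_mul_inv, hinv,
      mul_right_comm, h3, one_mul]

end Comparison

section FieldCase

variable {F : Type*} [Field F] [ValuativeRel F] [TopologicalSpace F]
  [IsNonarchimedeanLocalField F] [MeasurableSpace F] [BorelSpace F] {da : Measure F}
  [da.IsAddHaarMeasure] {dma : Measure Fˣ} [dma.IsHaarMeasure] {ψ : AddChar F Circle}

theorem field_comparison (hF : ringChar 𝓀[F] ≠ 2) (hψ : IsUnramifiedAddChar ψ)
    {dg : Measure (PGL(2, F))} [dg.IsHaarMeasure] {π : Fˣ} (hπ : ord (π : F) = 1)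
    {A : F} (hA : A ≠ 0) (hA0 : ord A = 0) (hsq : ¬IsSquare A)
    {dt : Measure (torus (fieldEmb A))} [dt.IsHaarMeasure]
    {dy : Measure (Quotient (QuotientGroup.rightRel (torus (fieldEmb A))))}
    (hq : IsQuotientMeasure (torus (fieldEmb A)) dg dt dy) {χ₁ : Fˣ →* ℂˣ}
    (hχ₁ : 1 = χ₁.comp (normHom (fieldEmb A))) {x u ξ η : Fˣ} (hu : (u : F) = 1 - x)
    (hξ : (ξ : F) = x / (x - 1)) (hη : (η : F) = 1 - ξ) {b : Fˣ} (hb : 0 ≤ ord (b : F)) :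
    (volCompact dg u : ℂ) * (thetaNew da dma ψ (omega (fieldEmb A)) χ₁ (b * η) *
        eisensteinNew da dma ψ (omega (fieldEmb A)) (b * ξ)) =
      (volW da dma : ℂ) * ((√(absF ((ξ * η : Fˣ) : F)) * absF (b : F) : ℝ) *
        geomHecke (omega (fieldEmb A)) 1 π u b
          (translatedLinkingNumber (fieldEmb A) (fieldEps A) dt dy (sphericalFn (fieldEmb A) 1)
            (sphericalFn (fieldEmb A) 1) (x : F))
          (translatedLinkingNumber (fieldEmb A) (fieldEps A) dt dy (sphericalFn (fieldEmb A) 1)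
            (sphericalFn (fieldEmb A) 1) (x : F))) := by
  classical
  have heven : ∀ a : Fˣ, Even (ord (a : F)) → χ₁ a = 1 := by
    intro a ha
    obtain ⟨e, f, hef⟩ := exists_normForm_eq_of_even hF hA hA0 a.ne_zero ha
    obtain ⟨t, ht⟩ := exists_unit_re_im (hef.trans_ne a.ne_zero)
    have : normHom (fieldEmb A) t = a := Units.ext (by rw [normHom_fieldEmb_coe, ht]; exact hef)
    rw [← this]
    exact (DFunLike.congr_fun hχ₁ t).symm
  have hquad : χ₁ ^ 2 = 1 := by
    ext1 a
    rw [MonoidHom.pow_apply, ← map_pow, MonoidHom.one_apply]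
    exact heven _ (by rw [Units.val_pow_eq_pow_val, ord_pow a.ne_zero]; simp)
  have hω := omega_fieldEmb hF hA hA0 hsq
  have hone : (1 : Fˣ →* ℂˣ)⁻¹ = 1 := by ext; simp
  rw [newform_product hψ (Or.inr rfl) hω hquad, sqrt_absF_mul, sum_Icc_neg_one_zpow,
    sum_Icc_neg_one_zpow, geomHecke, hone]
  obtain ⟨B, hB⟩ := Int.eq_ofNat_of_zero_le hb
  set l : ℕ → ℂ := fun n => if Even (ord (x : F)) ∧ max (ord (u : F)) 0 = n then
    ((cosetWeight F n * dg.real (maxCompact F) : ℝ) : ℂ) else 0 with hl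
  rw [heckePart_eq hπ hB (Or.inl rfl) (μ := 1) rfl (l := l) (fun β => by
    rw [fieldLinking hF hA hA0 hsq hq hu, hl, _root_.one_zpow, one_mul]
    simp only [Int.natCast_natAbs])]
  obtain ⟨hξo, hηo⟩ := ord_xi_eta hu hξ hη
  rw [Units.val_mul b η, ord_mul b.ne_zero η.ne_zero, Units.val_mul b ξ,
    ord_mul b.ne_zero ξ.ne_zero, hξo, hηo, hω, Units.val_mul b u, ord_mul b.ne_zero u.ne_zero,
    one_pow, one_mul]
  have hcases := ord_one_sub_cases hu
  obtain ⟨N, hN⟩ : ∃ N : ℕ, max (ord (u : F)) 0 = N :=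
    Int.eq_ofNat_of_zero_le (le_max_right _ _)
  by_cases hBU : Even (ord (b : F) + ord (u : F))
  · rw [hBU.neg_one_zpow]
    have hχ : χ₁ (b * η) = 1 := heven _ (by
      rw [Units.val_mul, ord_mul b.ne_zero η.ne_zero, hηo]
      rw [Int.even_iff] at hBU ⊢; omega)
    by_cases hc : Even (ord (x : F)) ∧ N ≤ B
    · have hsum : ∑ j ∈ Finset.range (B + 1), (1 : ℂ) ^ (B - j) * (resCard F : ℂ) ^ j * l j =
          volCompact dg u := by
        rw [Finset.sum_eq_single_of_mem N (by simp; omega)]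
        · have h1 : l N = ((cosetWeight F N * dg.real (maxCompact F) : ℝ) : ℂ) :=
            if_pos ⟨hc.1, hN⟩
          rw [h1, one_pow, one_mul]
          have h2 := resCard_pow_mul_cosetWeight (F := F) N
          have h3 : volCompact dg u = (if N = 0 then 1 else (1 + (resCard F : ℝ)⁻¹)⁻¹) *
              dg.real (maxCompact F) := by
            rw [volCompact]
            by_cases hU : 0 < ord (u : F)
            · rw [if_pos hU, if_neg (by omega), div_eq_inv_mul]
            · rw [if_neg hU, if_pos (by omega), one_mul]
          rw [h3, ← h2]
          push_cast; ring
        · intro j _ hj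
          have : l j = 0 := if_neg (by rintro ⟨-, h⟩; omega)
          rw [this, mul_zero]
      rw [hsum, hχ, if_pos, if_pos]
      · push_cast; ring
      · obtain ⟨h1, h2⟩ := hc
        rw [Int.even_iff] at hBU h1 ⊢
        omega
      · rw [Int.even_iff] at hBU ⊢
        omega
    · have hsum : ∑ j ∈ Finset.range (B + 1), (1 : ℂ) ^ (B - j) * (resCard F : ℂ) ^ j * l j = 0 := by
        refine Finset.sum_eq_zero fun j hj => ?_
        have hj := Finset.mem_range.1 hj
        have : l j = 0 := if_neg (by rintro ⟨h0, h⟩; exact hc ⟨h0, by omega⟩)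
        rw [this, mul_zero]
      rw [hsum]
      have : ¬((0 ≤ ord (b : F) + -ord (u : F) ∧ Even (ord (b : F) + -ord (u : F))) ∧
          (0 ≤ ord (b : F) + (ord (x : F) - ord (u : F)) ∧
            Even (ord (b : F) + (ord (x : F) - ord (u : F))))) := by
        rintro ⟨⟨h1, h2⟩, h3, h4⟩
        refine hc ⟨?_, ?_⟩
        · rw [Int.even_iff] at *; omega
        · omega
      rw [not_and_or] at this
      rcases this with h | h <;> rw [if_neg h] <;> ring
  · rw [(Int.not_even_iff_odd.1 hBU).neg_one_zpow, if_neg]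
    · ring
    · rintro ⟨-, h⟩
      refine hBU ?_
      rw [Int.even_iff] at *; omega

end FieldCase

section SplitTorus

variable {F : Type*} [Field F]

theorem normHom_splitEmb (a d : Fˣ) :
    normHom (splitEmb F) (MulEquiv.prodUnits.symm (a, d)) = a * d := by
  ext
  change (!![(a : F), 0; 0, d] : Matrix (Fin 2) (Fin 2) F).det = a * d
  rw [Matrix.det_fin_two_of]
  ring

theorem omega_splitEmb (a : Fˣ) : omega (splitEmb F) a = 1 :=
  if_pos ⟨_, (normHom_splitEmb a 1).trans (mul_one a)⟩

theorem inv_eq_self_of_sq_eq_one {χ₁ : Fˣ →* ℂˣ} (h : χ₁ ^ 2 = 1) : χ₁⁻¹ = χ₁ := by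
  ext1 a
  rw [MonoidHom.inv_apply]
  rcases quadratic_values h a with h1 | h1 <;> rw [h1] <;> simp

theorem eq_firstComponent_comp_normHom {χ : (F × F)ˣ →* ℂˣ} (hT : IsTorusChar F χ)
    (h : firstComponent χ ^ 2 = 1) : χ = (firstComponent χ).comp (normHom (splitEmb F)) := by
  ext1 t
  obtain ⟨⟨a, d⟩, rfl⟩ := MulEquiv.prodUnits.symm.surjective t
  rw [MonoidHom.comp_apply, normHom_splitEmb]
  have h1 : (MulEquiv.prodUnits.symm (a, d) : (F × F)ˣ) = MulEquiv.prodUnits.symm (a * d⁻¹, 1) *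
      Units.map (algebraMap F (F × F) : F →* F × F) d := by
    ext
    · change (a : F) = ((a * d⁻¹ : Fˣ) : F) * d
      simp
    · change (d : F) = 1 * d
      simp
  have h2 : χ (MulEquiv.prodUnits.symm (a * d⁻¹, 1)) = firstComponent χ (a * d⁻¹) := rfl
  rw [h1, map_mul, hT, mul_one, h2, map_mul, map_mul, map_inv, ← MonoidHom.inv_apply,
    inv_eq_self_of_sq_eq_one h]

variable [ValuativeRel F] [TopologicalSpace F] [IsNonarchimedeanLocalField F]

theorem firstComponent_isUnram {χ : (F × F)ˣ →* ℂˣ} (hU : IsUnramifiedChar F χ) :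
    IsUnram (firstComponent χ) := by
  have hint : ∀ a : F, ord a = 0 → IsIntegral 𝒪[F] ((a, 1) : F × F) := by
    intro a ha
    exact IsIntegral.pair (isIntegral_algebraMap (R := 𝒪[F]) (A := F)
      (x := ⟨a, mem_integer_iff.2 (Or.inr ha.ge)⟩)) isIntegral_one
  intro a ha
  refine hU (MulEquiv.prodUnits.symm (a, 1)) (hint a ha) ?_
  have : ((MulEquiv.prodUnits.symm (a, 1) : (F × F)ˣ)⁻¹ : (F × F)ˣ) =
      MulEquiv.prodUnits.symm (a⁻¹, 1) := by
    rw [← map_inv, Prod.inv_mk, inv_one]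
  rw [this]
  refine hint ((a⁻¹ : Fˣ) : F) ?_
  rw [Units.val_inv_eq_inv_val, ord_inv a.ne_zero, ha, neg_zero]

theorem IsUnram.eq_zpow {χ₁ : Fˣ →* ℂˣ} (h : IsUnram χ₁) {π : Fˣ} (hπ : ord (π : F) = 1) (a : Fˣ) :
    χ₁ a = χ₁ π ^ ord (a : F) := by
  have h1 : χ₁ (a * (π ^ ord (a : F))⁻¹) = 1 := by
    refine h _ ?_
    rw [Units.val_mul, ord_mul a.ne_zero (Units.ne_zero _), Units.val_inv_eq_inv_val,
      ord_inv (Units.ne_zero _), Units.val_zpow_eq_zpow_val, ord_zpow π.ne_zero, hπ]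
    ring
  rw [map_mul, map_inv, mul_inv_eq_one, map_zpow] at h1
  exact h1

end SplitTorus

section Shape

variable {F : Type*} [Field F] [ValuativeRel F] [TopologicalSpace F]
  [IsNonarchimedeanLocalField F]

theorem isCompact_abs_ord_lt {π : Fˣ} (hπ : ord (π : F) = 1) (n : ℤ) :
    IsCompact {β : Fˣ | |ord (β : F)| < n} := by
  have : {β : Fˣ | |ord (β : F)| < n} =
      ⋃ k ∈ Finset.Ioo (-n) n, (fun t => π ^ k * t) '' {t : Fˣ | ord (t : F) = 0} := by
    have hord : ∀ k : ℤ, ord ((π ^ k : Fˣ) : F) = k := by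
      intro k
      rw [Units.val_zpow_eq_zpow_val, ord_zpow π.ne_zero, hπ, mul_one]
    ext β
    simp only [Set.mem_ofPred_eq, Set.mem_iUnion, Set.mem_image, Finset.mem_Ioo, exists_prop]
    rw [abs_lt]
    constructor
    · intro h
      refine ⟨ord (β : F), h, (π ^ ord (β : F))⁻¹ * β, ?_, by simp⟩
      rw [Units.val_mul, ord_mul (Units.ne_zero _) β.ne_zero, Units.val_inv_eq_inv_val,
        ord_inv (Units.ne_zero _), hord]
      ring
    · rintro ⟨k, hk, t, ht, rfl⟩
      rwa [Units.val_mul, ord_mul (Units.ne_zero _) t.ne_zero, hord, ht, add_zero]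
  rw [this]
  exact Finset.isCompact_biUnion _ fun k _ =>
    isCompact_ord_units.image (continuous_const_mul (π ^ k))

theorem hasTranslateShape_of_eventually {μ : Fˣ →* ℂˣ} {f : Fˣ → ℂ} {π : Fˣ}
    (hπ : ord (π : F) = 1) {g : ℕ → ℂ} (hf : ∀ β : Fˣ, f β = μ β * g (ord (β : F)).natAbs) {n : ℕ}
    (hn : 0 < n) {c₁ c₂ : ℂ}
    (hg : ∀ k, n ≤ k → g k = ((resCard F : ℂ) ^ k)⁻¹ * (c₁ * k + c₂)) :
    HasTranslateShape μ f := by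
  classical
  refine ⟨n, by exact_mod_cast hn, c₁, c₂, -c₁, c₂,
    fun β => if |ord (β : F)| < n then g (ord (β : F)).natAbs else 0, ?_, ?_, fun β => ?_⟩
  · have : IsLocallyConstant fun β : Fˣ => ord (β : F) := fun s => isOpen_ord_units s
    exact this.comp fun k : ℤ => if |k| < n then g k.natAbs else 0
  · exact HasCompactSupport.intro (isCompact_abs_ord_lt hπ n) fun β hβ => if_neg hβ
  · rw [hf]
    congr 1
    dsimp only
    rcases lt_or_ge |ord (β : F)| n with h | h
    · rw [if_pos h, if_neg (by have := abs_lt.1 h; omega), if_neg (by have := abs_lt.1 h; omega)]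
      ring
    · rw [if_neg (not_lt.2 h), hg _ (by rw [← Int.natCast_natAbs] at h; exact_mod_cast h), absF_of_ne β.ne_zero]
      rcases le_total 0 (ord (β : F)) with h0 | h0
      · obtain ⟨k, hk⟩ := Int.eq_ofNat_of_zero_le h0
        rw [abs_of_nonneg h0] at h
        rw [if_pos h, if_neg (by omega), hk]
        simp
      · obtain ⟨k, hk⟩ := Int.eq_ofNat_of_zero_le (neg_nonneg.2 h0)
        have hk' : ord (β : F) = -k := by omega
        rw [abs_of_nonpos h0] at h
        rw [if_neg (by omega), if_pos (by omega), hk']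
        simp

end Shape

section SplitCase

variable {F : Type*} [Field F] [ValuativeRel F] [TopologicalSpace F]
  [IsNonarchimedeanLocalField F]

theorem sum_rimCount_mul_weight (Y : ℤ) (N B : ℕ) :
    ∑ j ∈ Finset.range (B + 1), (rimCount Y (j - N) : ℝ) * ((resCard F : ℝ) ^ j * cosetWeight F j) =
      (1 + (resCard F : ℝ)⁻¹)⁻¹ * if B < N then 0 else
        2 * ((B : ℝ) - N) * (B - N + 1) + 2 * Y * (B - N) +
          (Y + 1) * (1 + if N = 0 then (resCard F : ℝ)⁻¹ else 0) := by
  have hq : (1 + (resCard F : ℝ)⁻¹) ≠ 0 := by positivity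
  induction B with
  | zero =>
    rw [Finset.sum_range_one, resCard_pow_mul_cosetWeight, if_pos rfl]
    rcases Nat.eq_zero_or_pos N with rfl | hN
    · simp [rimCount]
      field_simp
    · rw [rimCount, if_pos (by omega), if_pos hN]
      simp
  | succ B ih =>
    rw [Finset.sum_range_succ, ih, resCard_pow_mul_cosetWeight, if_neg (Nat.succ_ne_zero B),
      rimCount]
    rcases lt_trichotomy (B + 1) N with h | h | h
    · rw [if_pos (by omega), if_pos (by omega), if_pos (by omega)]
      simp
    · rw [if_pos (by omega), if_neg (by omega), if_pos (by omega), if_neg (by omega),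
        if_neg (by omega), ← h]
      push_cast
      ring
    · rw [if_neg (by omega : ¬B < N), if_neg (by omega : ¬B + 1 < N),
        if_neg (by omega : ¬((B + 1 : ℕ) : ℤ) - N < 0), if_neg (by omega : ¬((B + 1 : ℕ) : ℤ) - N = 0)]
      push_cast
      ring

/-- The error term of the split case without the character. -/
def splitErrorReal (x u b : Fˣ) : ℝ :=
  if 0 < ord (u : F) then
    (if ord (u : F) ≤ ord (b : F) then ((ord (b : F) - ord (u : F) : ℤ) : ℝ) + 1 / 2 else 0)
  else (ord (b : F) : ℝ) + ((|ord (x : F)| + 1 : ℤ) : ℝ) * (1 - (resCard F : ℝ)⁻¹) / 2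

theorem splitError_eq (χ₁ : Fˣ →* ℂˣ) (x u b : Fˣ) :
    splitError χ₁ x u b = χ₁ (b * u) * (splitErrorReal x u b : ℝ) := by
  rw [splitError, splitErrorReal]
  generalize |ord (x : F)| = Y
  congr 1
  split_ifs <;> push_cast <;> rfl

theorem abs_splitErrorReal_le {x u b : Fˣ} (hb : 1 ≤ ord (b : F)) :
    |splitErrorReal x u b| ≤ (|ord (x : F)| + 2 : ℤ) * (ord (b : F) : ℝ) := by
  have hb' : (1 : ℝ) ≤ (ord (b : F) : ℝ) := by exact_mod_cast hb
  have hX : (0 : ℝ) ≤ ((|ord (x : F)| : ℤ) : ℝ) := by exact_mod_cast abs_nonneg (ord (x : F))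
  have hXb := mul_le_mul_of_nonneg_left hb' hX
  rw [splitErrorReal]
  split_ifs with h1 h2
  · have h1' : (0 : ℝ) < (ord (u : F) : ℝ) := by exact_mod_cast h1
    have h2' : (ord (u : F) : ℝ) ≤ (ord (b : F) : ℝ) := by exact_mod_cast h2
    rw [abs_of_nonneg (by push_cast; linarith)]
    push_cast at *
    linarith
  · rw [abs_zero]
    push_cast at *
    nlinarith
  · have hq0 : 0 ≤ (resCard F : ℝ)⁻¹ := by positivity
    have hq1 : (resCard F : ℝ)⁻¹ ≤ 1 := inv_le_one_of_one_le₀ (by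
      exact_mod_cast (one_lt_resCard F).le)
    have h3 : 0 ≤ (((|ord (x : F)| : ℤ) : ℝ) + 1) * (1 - (resCard F : ℝ)⁻¹) :=
      mul_nonneg (by linarith) (by linarith)
    have h4 : (((|ord (x : F)| : ℤ) : ℝ) + 1) * (1 - (resCard F : ℝ)⁻¹) ≤
        ((|ord (x : F)| : ℤ) : ℝ) + 1 := mul_le_of_le_one_right (by linarith) (by linarith)
    push_cast at *
    rw [abs_of_nonneg (by linarith)]
    linarith

theorem sum_rimCount_add_splitErrorReal {x u b : Fˣ} (hu : (u : F) = 1 - x) {B N : ℕ}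
    (hB : ord (b : F) = B) (hN : max (ord (u : F)) 0 = N) :
    (∑ j ∈ Finset.range (B + 1), (rimCount |ord (x : F)| (j - N) : ℝ) *
        ((resCard F : ℝ) ^ j * cosetWeight F j)) / 2 +
      (1 + (resCard F : ℝ)⁻¹)⁻¹ * splitErrorReal x u b =
    (1 + (resCard F : ℝ)⁻¹)⁻¹ * (((ord (b : F) - ord (u : F) + 1).toNat : ℝ) *
      ((ord (b : F) + (ord (x : F) - ord (u : F)) + 1).toNat : ℝ)) := by
  rw [sum_rimCount_mul_weight, splitErrorReal]
  have hcast : ∀ k : ℤ, 0 ≤ k → ((k.toNat : ℕ) : ℝ) = (k : ℝ) := by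
    intro k hk
    exact_mod_cast Int.toNat_of_nonneg hk
  rcases ord_one_sub_cases hu with ⟨hX, hU⟩ | ⟨hX, hU⟩ | ⟨hX, hU⟩
  · have hN0 : N = 0 := by omega
    rw [if_neg (by omega), if_pos hN0, if_neg (by omega), hcast _ (by omega), hcast _ (by omega),
      hB, hU, hN0, abs_of_pos hX]
    push_cast
    ring
  · rcases hU.lt_or_eq with hU | hU
    · have hNU : ord (u : F) = N := by omega
      rw [if_pos hU, hX, hNU, hB, if_neg (by omega : ¬N = 0)]
      rcases lt_or_ge B N with h | h
      · rw [if_pos h, if_neg (by omega), Int.toNat_of_nonpos (by omega)]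
        simp
      · rw [if_neg (by omega), if_pos (by omega), hcast _ (by omega), hcast _ (by omega)]
        push_cast
        ring
    · have hN0 : N = 0 := by omega
      rw [if_neg (by omega), if_pos hN0, if_neg (by omega), hcast _ (by omega), hcast _ (by omega),
        hB, ← hU, hN0, hX]
      push_cast
      ring
  · have hN0 : N = 0 := by omega
    rw [if_neg (by omega), if_pos hN0, if_neg (by omega), hcast _ (by omega), hcast _ (by omega),
      hB, hU, hN0, abs_of_neg hX]
    push_cast
    ring

theorem sum_Icc_one_zpow (n : ℤ) :
    ∑ k ∈ Finset.Icc (-n) 0, (1 : ℂ) ^ k = ((n + 1).toNat : ℂ) := by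
  simp only [_root_.one_zpow, Finset.sum_const, nsmul_eq_mul, mul_one, Int.card_Icc]
  congr 2
  ring

theorem split_splitting {π : Fˣ} (hπ : ord (π : F) = 1) {χ₁ : Fˣ →* ℂˣ} (h : χ₁ ^ 2 = 1)
    {L : Fˣ → ℂ} {κ : ℂ} {V : ℝ} {Y : ℤ} {N : ℕ}
    (hL : ∀ β : Fˣ, L β = κ * χ₁ β * ((rimCount Y (|ord (β : F)| - N) : ℤ) *
      (cosetWeight F (ord (β : F)).natAbs * V) : ℝ)) :
    ∃ Lp Lm : Fˣ → ℂ, IsPlusMinusSplitting χ₁ L Lp Lm := by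
  have hshape : HasTranslateShape χ₁ fun β => L β / 2 := by
    refine hasTranslateShape_of_eventually hπ (n := N + 1)
      (g := fun k => κ * ((rimCount Y (k - N) : ℤ) * (cosetWeight F k * V) : ℝ) / 2)
      (fun β => ?_) (Nat.succ_pos N) (c₁ := κ * (2 * V / (1 + (resCard F : ℝ)⁻¹) : ℝ))
      (c₂ := κ * ((Y - 2 * N) * V / (1 + (resCard F : ℝ)⁻¹) : ℝ)) (fun k hk => ?_)
    · rw [hL, Int.natCast_natAbs]
      ring
    · rw [cosetWeight, if_neg (by omega), rimCount, if_neg (by omega), if_neg (by omega)]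
      push_cast
      ring
  refine ⟨fun β => L β / 2, fun β => L β / 2, hshape, ?_, fun β => (add_halves _).symm,
    fun _ => rfl⟩
  rw [inv_eq_self_of_sq_eq_one h]
  exact hshape

theorem split_error_bound {dg : Measure (PGL(2, F))} {χ₁ : Fˣ →* ℂˣ} (h : χ₁ ^ 2 = 1)
    {x u b : Fˣ} (v c : ℝ) (hb : 1 ≤ ord (b : F)) {W E : ℂ}
    (hWE : W = (v : ℂ) * ((c * absF (b : F) : ℝ) *
      (E + (volSplit dg : ℂ) * splitError χ₁ x u b))) :
    ‖W - (v : ℂ) * ((c * absF (b : F) : ℝ) * E)‖ ≤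
      (|v * c * volSplit dg| * (|ord (x : F)| + 2 : ℤ)) *
        (absF (b : F) * (ord (b : F) : ℝ)) := by
  have e : W - (v : ℂ) * ((c * absF (b : F) : ℝ) * E) = χ₁ (b * u) *
      ((v * c * volSplit dg * absF (b : F) * splitErrorReal x u b : ℝ) : ℂ) := by
    rw [hWE, splitError_eq]
    push_cast
    ring
  have hχ : ‖((χ₁ (b * u) : ℂˣ) : ℂ)‖ = 1 := by
    rcases quadratic_values h (b * u) with h1 | h1 <;> rw [h1] <;> simp
  rw [e, norm_mul, hχ, one_mul, Complex.norm_real, Real.norm_eq_abs, abs_mul, abs_mul _ (absF _),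
    abs_of_nonneg (absF_nonneg (b : F))]
  have := mul_le_mul_of_nonneg_left (abs_splitErrorReal_le (x := x) (u := u) hb)
    (mul_nonneg (abs_nonneg (v * c * volSplit dg)) (absF_nonneg (b : F)))
  refine this.trans (le_of_eq ?_)
  ring

variable [MeasurableSpace F] [BorelSpace F] {da : Measure F} [da.IsAddHaarMeasure]
  {dma : Measure Fˣ} [dma.IsHaarMeasure] {ψ : AddChar F Circle}

theorem split_comparison (hψ : IsUnramifiedAddChar ψ) {dg : Measure (PGL(2, F))} {π : Fˣ}
    (hπ : ord (π : F) = 1) {χ₁ : Fˣ →* ℂˣ} (h : χ₁ ^ 2 = 1) (hχ₁ : IsUnram χ₁) {x u ξ η : Fˣ}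
    (hu : (u : F) = 1 - x) (hξ : (ξ : F) = x / (x - 1)) (hη : (η : F) = 1 - ξ) {L Lp Lm : Fˣ → ℂ}
    (hL : ∀ β : Fˣ, L β = χ₁ u * χ₁ β * ((rimCount |ord (x : F)|
      (|ord (β : F)| - max (ord (u : F)) 0) : ℤ) *
        (cosetWeight F (ord (β : F)).natAbs * dg.real (maxCompact F)) : ℝ))
    (hs : IsPlusMinusSplitting χ₁ L Lp Lm) {b : Fˣ} (hb : 0 ≤ ord (b : F)) :
    (volSplit dg : ℂ) * (thetaNew da dma ψ (omega (splitEmb F)) χ₁ (b * η) *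
        eisensteinNew da dma ψ (omega (splitEmb F)) (b * ξ)) =
      (volW da dma : ℂ) * ((√(absF ((ξ * η : Fˣ) : F)) * absF (b : F) : ℝ) *
        (geomHecke (omega (splitEmb F)) χ₁ π u b Lp Lm + (volSplit dg : ℂ) * splitError χ₁ x u b)) := by
  obtain ⟨B, hB⟩ := Int.eq_ofNat_of_zero_le hb
  obtain ⟨N, hN⟩ : ∃ N : ℕ, max (ord (u : F)) 0 = N :=
    Int.eq_ofNat_of_zero_le (le_max_right _ _)
  have hLm : Lm = Lp := (hs.2.2.2 h).symm
  have hLp : ∀ β, Lp β = L β / 2 := by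
    intro β
    rw [hs.2.2.1 β, hLm]
    ring
  have hε : ((χ₁ π : ℂˣ) : ℂ) = 1 ∨ ((χ₁ π : ℂˣ) : ℂ) = -1 := by
    rcases quadratic_values h π with h1 | h1 <;> rw [h1]
    · exact Or.inl rfl
    · exact Or.inr rfl
  have hpow : ∀ β : Fˣ, ((χ₁ β : ℂˣ) : ℂ) = ((χ₁ π : ℂˣ) : ℂ) ^ ord (β : F) := by
    intro β
    rw [hχ₁.eq_zpow hπ β, Units.val_zpow_eq_zpow_val]
  have hη' : η = u⁻¹ := by
    have hxu : (x : F) - 1 = -u := by rw [hu]; ring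
    ext
    have : (u : F) ≠ 0 := u.ne_zero
    rw [hη, hξ, hxu, Units.val_inv_eq_inv_val]
    field_simp
    rw [hu]; ring
  have hχη : χ₁ (b * η) = χ₁ (b * u) := by
    rw [hη', map_mul, map_mul, map_inv, ← MonoidHom.inv_apply, inv_eq_self_of_sq_eq_one h]
  obtain ⟨hξo, hηo⟩ := ord_xi_eta hu hξ hη
  rw [newform_product hψ (Or.inl rfl) (fun a => by rw [omega_splitEmb, _root_.one_zpow]) h,
    sqrt_absF_mul, sum_Icc_one_zpow, sum_Icc_one_zpow, geomHecke, inv_eq_self_of_sq_eq_one h, hLm,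
    heckePart_eq hπ hB hε rfl (l := fun n => χ₁ u * ((rimCount |ord (x : F)| (n - N) : ℤ) *
      (cosetWeight F n * dg.real (maxCompact F)) : ℝ) / 2) (fun β => by
        rw [hLp, hL, hN, ← hpow, Int.natCast_natAbs]; ring),
    omega_splitEmb, Units.val_mul b η, ord_mul b.ne_zero η.ne_zero, Units.val_mul b ξ,
    ord_mul b.ne_zero ξ.ne_zero, hξo, hηo, hχη, splitError_eq]
  have hχb : ((χ₁ π : ℂˣ) : ℂ) ^ B = χ₁ b := by
    rw [hpow b, hB, zpow_natCast]
  rw [hχb, map_mul, Units.val_mul]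
  have key := congrArg (fun r : ℝ => (r : ℂ)) (sum_rimCount_add_splitErrorReal hu hB hN)
  have hsum : ∑ j ∈ Finset.range (B + 1), (1 : ℂ) ^ (B - j) * (resCard F : ℂ) ^ j *
      ((χ₁ u : ℂ) * ((rimCount |ord (x : F)| (j - N) : ℤ) *
        (cosetWeight F j * dg.real (maxCompact F)) : ℝ) / 2) =
      χ₁ u * dg.real (maxCompact F) / 2 * ((∑ j ∈ Finset.range (B + 1),
        (rimCount |ord (x : F)| (j - N) : ℝ) * ((resCard F : ℝ) ^ j * cosetWeight F j) : ℝ) : ℂ) := by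
    rw [Complex.ofReal_sum, Finset.mul_sum]
    refine Finset.sum_congr rfl fun j _ => ?_
    rw [one_pow]
    push_cast
    ring
  rw [hsum, volSplit, div_eq_mul_inv (dg.real _)]
  rw [← sub_eq_add_neg]
  push_cast at key ⊢
  linear_combination (volW da dma : ℂ) * (√(absF ((ξ : F) * (η : F))) : ℂ) * (absF (b : F) : ℂ) *
    χ₁ b * χ₁ u * (dg.real (maxCompact F) : ℂ) * -key

end SplitCase

end LocalGZ

end

theorem mainTheorem3 {F : Type*} [Field F] [ValuativeRel F] [TopologicalSpace F]
    [IsNonarchimedeanLocalField F] [MeasurableSpace F] [BorelSpace F]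
    (hF : ringChar 𝓀[F] ≠ 2)
    (ψ : AddChar F Circle) (hψ : LocalGZ.IsUnramifiedAddChar ψ)
    (da : Measure F) [da.IsAddHaarMeasure] (dma : Measure Fˣ) [dma.IsHaarMeasure]
    (dg : Measure (PGL(2, F))) [dg.IsHaarMeasure]
    (π : Fˣ) (hπ : LocalGZ.ord (π : F) = 1) :
    -- `K = F(√A)` an unramified field extension
    (∀ A : F, A ≠ 0 → LocalGZ.ord A = 0 → ¬ IsSquare A →
      ∀ (dt : Measure (LocalGZ.torus (LocalGZ.fieldEmb A))) [dt.IsHaarMeasure]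
        (dy : Measure (Quotient (QuotientGroup.rightRel (LocalGZ.torus (LocalGZ.fieldEmb A))))),
      LocalGZ.IsQuotientMeasure (LocalGZ.torus (LocalGZ.fieldEmb A)) dg dt dy →
      ∀ χ : (QuadraticAlgebra F A 0)ˣ →* ℂˣ,
      LocalGZ.IsTorusChar F χ → LocalGZ.IsUnramifiedChar F χ →
      (∃ χ₁ : Fˣ →* ℂˣ, χ = χ₁.comp (LocalGZ.normHom (LocalGZ.fieldEmb A))) ∧
      ∀ χ₁ : Fˣ →* ℂˣ, χ = χ₁.comp (LocalGZ.normHom (LocalGZ.fieldEmb A)) →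
      ∀ x u ξ η : Fˣ, (u : F) = 1 - x → (ξ : F) = x / (x - 1) → (η : F) = 1 - ξ →
      ∀ b : Fˣ, 0 ≤ LocalGZ.ord (b : F) →
        let ω := LocalGZ.omega (LocalGZ.fieldEmb A)
        let φ := LocalGZ.sphericalFn (LocalGZ.fieldEmb A) χ
        let L := LocalGZ.translatedLinkingNumber (LocalGZ.fieldEmb A) (LocalGZ.fieldEps A)
          dt dy φ φ (x : F)
        (LocalGZ.volCompact dg u : ℂ) *
            (LocalGZ.thetaNew da dma ψ ω χ₁ (b * η) * LocalGZ.eisensteinNew da dma ψ ω (b * ξ)) =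
          (LocalGZ.volW da dma : ℂ) *
            ((Real.sqrt (LocalGZ.absF ((ξ * η : Fˣ) : F)) * LocalGZ.absF (b : F) : ℝ) *
              LocalGZ.geomHecke ω 1 π u b L L)) ∧
    -- `K = F ⊕ F`
    (∀ (dt : Measure (LocalGZ.torus (LocalGZ.splitEmb F))) [dt.IsHaarMeasure]
        (dy : Measure (Quotient (QuotientGroup.rightRel (LocalGZ.torus (LocalGZ.splitEmb F))))),
      LocalGZ.IsQuotientMeasure (LocalGZ.torus (LocalGZ.splitEmb F)) dg dt dy →
      ∀ χ : (F × F)ˣ →* ℂˣ,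
      LocalGZ.IsTorusChar F χ → LocalGZ.IsUnramifiedChar F χ →
      (LocalGZ.firstComponent χ) ^ 2 = 1 →
      ∀ x u ξ η : Fˣ, (u : F) = 1 - x → (ξ : F) = x / (x - 1) → (η : F) = 1 - ξ →
        let χ₁ := LocalGZ.firstComponent χ
        let ω := LocalGZ.omega (LocalGZ.splitEmb F)
        let φ := LocalGZ.sphericalFn (LocalGZ.splitEmb F) χ
        let L := LocalGZ.translatedLinkingNumber (LocalGZ.splitEmb F) (LocalGZ.splitEps F)
          dt dy φ φ (x : F)
        (∃ Lp Lm : Fˣ → ℂ, LocalGZ.IsPlusMinusSplitting χ₁ L Lp Lm) ∧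
        ∀ Lp Lm : Fˣ → ℂ, LocalGZ.IsPlusMinusSplitting χ₁ L Lp Lm →
          (∀ b : Fˣ, 0 ≤ LocalGZ.ord (b : F) →
            (LocalGZ.volSplit dg : ℂ) *
                (LocalGZ.thetaNew da dma ψ ω χ₁ (b * η) *
                  LocalGZ.eisensteinNew da dma ψ ω (b * ξ)) =
              (LocalGZ.volW da dma : ℂ) *
                ((Real.sqrt (LocalGZ.absF ((ξ * η : Fˣ) : F)) * LocalGZ.absF (b : F) : ℝ) *
                  (LocalGZ.geomHecke ω χ₁ π u b Lp Lm +
                    (LocalGZ.volSplit dg : ℂ) * LocalGZ.splitError χ₁ x u b))) ∧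
          (∃ C : ℝ, ∀ b : Fˣ, 1 ≤ LocalGZ.ord (b : F) →
            ‖(LocalGZ.volSplit dg : ℂ) *
                (LocalGZ.thetaNew da dma ψ ω χ₁ (b * η) *
                  LocalGZ.eisensteinNew da dma ψ ω (b * ξ)) -
              (LocalGZ.volW da dma : ℂ) *
                ((Real.sqrt (LocalGZ.absF ((ξ * η : Fˣ) : F)) * LocalGZ.absF (b : F) : ℝ) *
                  LocalGZ.geomHecke ω χ₁ π u b Lp Lm)‖ ≤
              C * (LocalGZ.absF (b : F) * (LocalGZ.ord (b : F) : ℝ)))) := by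
  refine ⟨?_, ?_⟩
  · intro A hA hA0 hsq dt _ dy hq χ hT hU
    obtain rfl := LocalGZ.unramified_torusChar_eq_one hF hA hA0 hsq hT hU
    refine ⟨⟨1, (MonoidHom.one_comp _).symm⟩, ?_⟩
    intro χ₁ hχ₁ x u ξ η hu hξ hη b hb
    exact LocalGZ.field_comparison hF hψ hπ hA hA0 hsq hq hχ₁ hu hξ hη hb
  · intro dt _ dy hq χ hT hU h x u ξ η hu hξ hη
    have hχ₁ := LocalGZ.firstComponent_isUnram hU
    have hL := LocalGZ.splitLinking (x := x) (u := u) hπ hq h hχ₁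
      (LocalGZ.eq_firstComponent_comp_normHom hT h) hu
    intro χ₁ ω φ L
    refine ⟨?_, fun Lp Lm hs => ?_⟩
    · obtain ⟨N, hN⟩ : ∃ N : ℕ, max (LocalGZ.ord (u : F)) 0 = N :=
        Int.eq_ofNat_of_zero_le (le_max_right _ _)
      rw [hN] at hL
      exact LocalGZ.split_splitting hπ h hL
    · have key : ∀ b : Fˣ, 0 ≤ LocalGZ.ord (b : F) → _ := fun b hb =>
        LocalGZ.split_comparison (da := da) (dma := dma) hψ hπ h hχ₁ hu hξ hη hL hs hb
      exact ⟨key, _, fun b hb => LocalGZ.split_error_bound h _ _ hb (key b (by omega))⟩
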